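/- **Setting.** Let $\mathscr A=\{a_1,\dots,a_n\}$ be a finite set of $n$ distinct points of the lattice $\mathcal N=\mathbb Z^d$ ($d\ge 1$) whose first coordinate is $1$ (for instance all lattice points of a lattice polytope in that hyperplane), and suppose that $A:\mathbb Z^n\to \mathcal N$, $e_i\mapsto a_i$, is surjective and that $\ker A$ has rank $1$. Let $v=(v_1,\dots,v_n)$ generate $\ker A$, let $p_\pm=\{i:\pm v_i>0\}$, and let $N=\sum_{i\in p_+}v_i$. Grade $S=\mathbb C[x_1,\dots,x_n]$ by $\deg x_i=v_i\in\mathbb Z$, and write $S(k)_j=S_{k+j}$. A *phase* is a regular triangulation $\Sigma$ of $\mathscr A$ (not necessarily using all points). Its Cox ideal is $B_\Sigma=\bigl(\prod_{i\notin\sigma}x_i:\sigma\in\Sigma\bigr)\subset S$, and its derived category is the Verdier quotient $\mathbf D(X_\Sigma)=\mathbf D(\mathrm{gr-}S)/T_\Sigma$, where $\mathbf D(\mathrm{gr-}S)$ is the bounded derived category of finitely generated graded $S$-modules and $T_\Sigma$ is the triangulated subcategory generated by the modules killed by a power of $B_\Sigma$. Let $\widetilde S(k)$ be the image of $S(k)$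 in $\mathbf D(X_\Sigma)$. An integer $\delta$ is $B_\Sigma$-*acyclic* if $H^i_{B_\Sigma}(S)_\delta=0$ for all $i$. A finite family $P_1,\dots,P_m$ of objects of a triangulated category is a *tilting set* if every $P_i$ is indecomposable, $\operatorname{Hom}(P_i,P_j[k])=0$ for all $i,j$ and all $k>0$, the smallest full triangulated subcategory (closed under isomorphism) containing all $P_i$ is the whole category, and $\operatorname{End}(P_1\oplus\dots\oplus P_m)$ has finite global dimension. **Theorem (wholesomeness for $r=1$).** One has $N>0$. There are exactly two phases $\Sigma_+\neq\Sigma_-$, where $\Sigma_\pm=\{\sigma\subseteq\{1,\dots,n\}:p_\pm\not\subseteq\sigma\}$, and $B_{\Sigma_\pm}=(x_i:i\in p_\pm)$. Moreover, for each of the two phases $\Sigma=\Sigma_\pm$, with $p=p_\pm$ respectively: 1. only finitely many $\delta\in\mathbb Z$ are such that $\delta$ and $-\delta$ are both $B_\Sigma$-acyclic; 2. all differences of elements of $\{0,1,\dots,N-1\}$ are $B_\Sigma$-acyclic, and no set of integers properly containing $\{0,\dots,N-1\}$ has this property; 3. the classes of $\widetilde S,\widetilde S(1),\dots,\widetilde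 S(N-1)$ form a $\mathbb Z$-basis of the Grothendieck group of $\mathbf D(X_\Sigma)$, which is therefore free of rank $N$, and none of these $N$ objects lies in the full triangulated subcategory generated by the others; 4. $\widetilde S,\widetilde S(1),\dots,\widetilde S(N-1)$ is a tilting set in $\mathbf D(X_\Sigma)$; in particular these line bundles generate $\mathbf D(X_\Sigma)$. Moreover, for every $k\in\mathbb Z$, in the shift by $k$ of the Koszul complex of $S/B_\Sigma$, whose terms are sums of the $S(k-\sum_{i\in I}v_i)$ with $I\subseteq p$, each of the two end terms can be built from the remaining terms: $\widetilde S(k)$ lies in the triangulated subcategory of $\mathbf D(X_\Sigma)$ generated by the $\widetilde S(k-\sum_{i\in I}v_i)$ with $\emptyset\neq I\subseteq p$, and $\widetilde S(k-\sum_{i\in p}v_i)$ lies in the one generated by the $\widetilde S(k-\sum_{i\in I}v_i)$ with $I\subsetneq p$. In particular the same tilting set works in both phases. -/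

import Mathlib

noncomputable section

namespace ToricPhases

open CategoryTheory CategoryTheory.Limits
open scoped ZeroObject

/-! ### Finitely generated graded modules over a polynomial ring -/

/-- The homogeneous coordinate ring `S = ℂ[x₁, …, xₙ]`. -/
abbrev PolyRing (n : ℕ) : Type := MvPolynomial (Fin n) ℂ

/-- A finitely generated `ℤ`-graded module over `S = ℂ[x₁, …, xₙ]`, where `S` carries the
`ℤ`-grading in which `xᵢ` has degree `q i`. -/
structure GrMod {n : ℕ} (q : Fin n → ℤ) : Type 1 where
  carrier : Type
  [addCommGroup : AddCommGroup carrier]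
  [module : Module (PolyRing n) carrier]
  /-- the homogeneous parts -/
  gr : ℤ → AddSubgroup carrier
  isInternal : DirectSum.IsInternal gr
  smul_mem : ∀ {i j : ℤ} {s : PolyRing n} {m : carrier},
    MvPolynomial.IsWeightedHomogeneous q s i → m ∈ gr j → s • m ∈ gr (i + j)
  [finite : Module.Finite (PolyRing n) carrier]

attribute [instance] GrMod.addCommGroup GrMod.module GrMod.finite

/-- A family of additive projections exhibits an internal direct sum. -/
theorem isInternal_of_proj {A : Type} [AddCommGroup A] (gr : ℤ → AddSubgroup A)
    (p : ℤ → A →+ A) (hmem : ∀ k a, p k a ∈ gr k)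
    (hsame : ∀ k a, a ∈ gr k → p k a = a) (hne : ∀ j k a, a ∈ gr j → j ≠ k → p k a = 0)
    (hsum : ∀ a, ∃ t : Finset ℤ, a = ∑ k ∈ t, p k a) : DirectSum.IsInternal gr := by
  classical
  constructor
  · rw [injective_iff_map_eq_zero]
    intro x hx
    ext k
    have h : p k (DirectSum.coeAddMonoidHom gr x) = (x k : A) := by
      clear hx
      induction x using DirectSum.induction_on with
      | zero => simp
      | of i y =>
        rw [DirectSum.coeAddMonoidHom_of]
        by_cases hik : i = k
        · subst hik
          rw [DirectSum.of_eq_same, hsame _ _ y.2]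
        · rw [DirectSum.of_eq_of_ne _ _ _ (Ne.symm hik), hne _ _ _ y.2 hik]; rfl
      | add x y hx hy => rw [map_add, map_add, hx, hy]; rfl
    rw [hx, map_zero] at h
    exact h.symm
  · intro a
    obtain ⟨t, ht⟩ := hsum a
    refine ⟨∑ k ∈ t, DirectSum.of (fun i => gr i) k ⟨p k a, hmem k a⟩, ?_⟩
    rw [map_sum]
    simp only [DirectSum.coeAddMonoidHom_of]
    exact ht.symm

namespace GrMod

variable {n : ℕ} {q : Fin n → ℤ}

/-- The projection to the homogeneous part of degree `k`. -/
def proj (M : GrMod q) (k : ℤ) : M.carrier →+ M.carrier :=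
  (M.gr k).subtype.comp ((DFinsupp.evalAddMonoidHom k).comp
    (AddEquiv.ofBijective (DirectSum.coeAddMonoidHom M.gr) M.isInternal).symm.toAddMonoidHom)

theorem proj_mem (M : GrMod q) (k : ℤ) (m : M.carrier) : M.proj k m ∈ M.gr k :=
  Subtype.property _

theorem proj_coe (M : GrMod q) (k : ℤ) (x : DirectSum ℤ fun i => M.gr i) :
    M.proj k (DirectSum.coeAddMonoidHom M.gr x) = (x k : M.carrier) := by
  have h : (AddEquiv.ofBijective (DirectSum.coeAddMonoidHom M.gr) M.isInternal).symm
      (DirectSum.coeAddMonoidHom M.gr x) = x :=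
    (AddEquiv.ofBijective (DirectSum.coeAddMonoidHom M.gr) M.isInternal).symm_apply_apply x
  change (((AddEquiv.ofBijective (DirectSum.coeAddMonoidHom M.gr) M.isInternal).symm
      (DirectSum.coeAddMonoidHom M.gr x)) k : M.carrier) = _
  rw [h]

theorem proj_same (M : GrMod q) (k : ℤ) (m : M.carrier) (hm : m ∈ M.gr k) :
    M.proj k m = m := by
  have := M.proj_coe k (DirectSum.of (fun i => M.gr i) k ⟨m, hm⟩)
  rwa [DirectSum.coeAddMonoidHom_of, DirectSum.of_eq_same] at this

theorem proj_ne (M : GrMod q) (j k : ℤ) (m : M.carrier) (hm : m ∈ M.gr j) (hjk : j ≠ k) :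
    M.proj k m = 0 := by
  have := M.proj_coe k (DirectSum.of (fun i => M.gr i) j ⟨m, hm⟩)
  rwa [DirectSum.coeAddMonoidHom_of, DirectSum.of_eq_of_ne _ _ _ (Ne.symm hjk)] at this

theorem exists_sum_proj (M : GrMod q) (m : M.carrier) :
    ∃ t : Finset ℤ, ∀ t', t ⊆ t' → m = ∑ k ∈ t', M.proj k m := by
  classical
  obtain ⟨x, rfl⟩ := M.isInternal.2 m
  refine ⟨DFinsupp.support x, fun t' ht => ?_⟩
  simp only [proj_coe]
  rw [DirectSum.coeAddMonoidHom_eq_dfinsuppSum, DFinsupp.sum]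
  refine Finset.sum_subset ht ?_
  intro k _ hk
  rw [DFinsupp.notMem_support_iff] at hk
  rw [hk]; rfl

/-! #### Morphisms: `S`-linear maps of degree zero -/

/-- A degree-preserving `S`-linear map. -/
@[ext]
structure Hom (M N : GrMod q) where
  lin : M.carrier →ₗ[PolyRing n] N.carrier
  map_mem : ∀ k m, m ∈ M.gr k → lin m ∈ N.gr k

instance : Category (GrMod q) where
  Hom := Hom
  id M := ⟨LinearMap.id, fun _ _ h => h⟩
  comp f g := ⟨g.lin.comp f.lin, fun k m h => g.map_mem k _ (f.map_mem k m h)⟩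

@[ext]
theorem hom_ext {M N : GrMod q} {f g : M ⟶ N} (h : ∀ m, f.lin m = g.lin m) : f = g :=
  Hom.ext (LinearMap.ext h)

@[simp] theorem id_lin (M : GrMod q) (m : M.carrier) : Hom.lin (𝟙 M) m = m := rfl
@[simp] theorem comp_lin {M N P : GrMod q} (f : M ⟶ N) (g : N ⟶ P) (m : M.carrier) :
    Hom.lin (f ≫ g) m = g.lin (f.lin m) := rfl

theorem lin_proj {M N : GrMod q} (f : M ⟶ N) (k : ℤ) (m : M.carrier) :
    f.lin (M.proj k m) = N.proj k (f.lin m) := by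
  obtain ⟨t, ht⟩ := M.exists_sum_proj m
  have h1 : f.lin m = ∑ j ∈ insert k t, f.lin (M.proj j m) := by
    conv_lhs => rw [ht _ (Finset.subset_insert k t), map_sum]
  rw [h1, map_sum, Finset.sum_eq_single k]
  · rw [N.proj_same k _ (f.map_mem _ _ (M.proj_mem k m))]
  · intro j _ hj
    exact N.proj_ne j k _ (f.map_mem _ _ (M.proj_mem j m)) hj
  · intro h
    exact absurd (Finset.mem_insert_self k t) h

section Preadditive

variable (M N : GrMod q)

instance : Zero (M ⟶ N) := ⟨⟨0, fun k _ _ => (N.gr k).zero_mem⟩⟩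
instance : Add (M ⟶ N) :=
  ⟨fun f g => ⟨f.lin + g.lin, fun k m h => (N.gr k).add_mem (f.map_mem k m h) (g.map_mem k m h)⟩⟩
instance : Neg (M ⟶ N) :=
  ⟨fun f => ⟨-f.lin, fun k m h => (N.gr k).neg_mem (f.map_mem k m h)⟩⟩
instance : Sub (M ⟶ N) :=
  ⟨fun f g => ⟨f.lin - g.lin, fun k m h => (N.gr k).sub_mem (f.map_mem k m h) (g.map_mem k m h)⟩⟩
instance : SMul ℕ (M ⟶ N) :=
  ⟨fun a f => ⟨a • f.lin, fun k m h => (N.gr k).nsmul_mem (f.map_mem k m h) a⟩⟩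
instance : SMul ℤ (M ⟶ N) :=
  ⟨fun a f => ⟨a • f.lin, fun k m h => (N.gr k).zsmul_mem (f.map_mem k m h) a⟩⟩

theorem lin_injective : Function.Injective (fun f : M ⟶ N => f.lin) :=
  fun _ _ h => Hom.ext h

instance : AddCommGroup (M ⟶ N) :=
  (lin_injective M N).addCommGroup _ rfl (fun _ _ => rfl) (fun _ => rfl) (fun _ _ => rfl)
    (fun _ _ => rfl) (fun _ _ => rfl)

end Preadditive

@[simp] theorem zero_lin {M N : GrMod q} (m : M.carrier) : Hom.lin (0 : M ⟶ N) m = 0 := rfl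
@[simp] theorem add_lin {M N : GrMod q} (f g : M ⟶ N) (m : M.carrier) :
    Hom.lin (f + g) m = f.lin m + g.lin m := rfl
@[simp] theorem sub_lin {M N : GrMod q} (f g : M ⟶ N) (m : M.carrier) :
    Hom.lin (f - g) m = f.lin m - g.lin m := rfl

instance : Preadditive (GrMod q) where
  add_comp _ _ _ f f' g := by ext m; simp
  comp_add _ _ _ f g g' := by ext m; simp

/-! #### Submodules, quotients and direct sums -/

/-- A homogeneous submodule, as a graded module. -/
def sub (M : GrMod q) (P : Submodule (PolyRing n) M.carrier)
    (hP : ∀ m ∈ P, ∀ k, M.proj k m ∈ P) : GrMod q where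
  carrier := P
  gr k := (M.gr k).comap P.subtype.toAddMonoidHom
  isInternal := by
    refine isInternal_of_proj _
      (fun k => AddMonoidHom.mk' (fun m => (⟨M.proj k m.1, hP m.1 m.2 k⟩ : P))
        (fun a b => Subtype.ext (map_add (M.proj k) a.1 b.1))) ?_ ?_ ?_ ?_
    · intro k m; exact M.proj_mem k m.1
    · intro k m hm; exact Subtype.ext (M.proj_same k m.1 hm)
    · intro j k m hm hjk; exact Subtype.ext (M.proj_ne j k m.1 hm hjk)
    · intro m
      obtain ⟨t, ht⟩ := M.exists_sum_proj m.1
      refine ⟨t, Subtype.ext ?_⟩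
      rw [AddSubmonoidClass.coe_finsetSum]
      exact ht t (Finset.Subset.refl t)
  smul_mem hs hm := M.smul_mem hs hm

/-- The quotient by a homogeneous submodule, as a graded module. -/
def quot (M : GrMod q) (P : Submodule (PolyRing n) M.carrier)
    (hP : ∀ m ∈ P, ∀ k, M.proj k m ∈ P) : GrMod q where
  carrier := M.carrier ⧸ P
  gr k := (M.gr k).map P.mkQ.toAddMonoidHom
  isInternal := by
    have key : ∀ k m, (QuotientAddGroup.map P.toAddSubgroup P.toAddSubgroup (M.proj k)
        (fun m hm => hP m hm k)) (P.mkQ m) = P.mkQ (M.proj k m) := fun _ _ => rfl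
    refine isInternal_of_proj _ (fun k => QuotientAddGroup.map P.toAddSubgroup P.toAddSubgroup
      (M.proj k) (fun m hm => hP m hm k)) ?_ ?_ ?_ ?_
    · intro k m
      obtain ⟨m, rfl⟩ := P.mkQ_surjective m
      exact ⟨M.proj k m, M.proj_mem k m, (key k m).symm⟩
    · rintro k _ ⟨m, hm, rfl⟩
      exact (key k m).trans (congrArg P.mkQ (M.proj_same k m hm))
    · rintro j k _ ⟨m, hm, rfl⟩ hjk
      exact (key k m).trans ((congrArg P.mkQ (M.proj_ne j k m hm hjk)).trans (map_zero _))
    · intro m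
      obtain ⟨m, rfl⟩ := P.mkQ_surjective m
      obtain ⟨t, ht⟩ := M.exists_sum_proj m
      refine ⟨t, ?_⟩
      have h := congrArg P.mkQ (ht t (Finset.Subset.refl t))
      rw [map_sum] at h
      exact h
  smul_mem := by
    rintro i j s _ hs ⟨m, hm, rfl⟩
    exact ⟨s • m, M.smul_mem hs hm, rfl⟩

/-- The direct sum of two graded modules. -/
def prod (M N : GrMod q) : GrMod q where
  carrier := M.carrier × N.carrier
  gr k := (M.gr k).prod (N.gr k)
  isInternal := by
    refine isInternal_of_proj _ (fun k => (M.proj k).prodMap (N.proj k)) ?_ ?_ ?_ ?_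
    · intro k m; exact ⟨M.proj_mem k m.1, N.proj_mem k m.2⟩
    · intro k m hm; exact Prod.ext (M.proj_same k m.1 hm.1) (N.proj_same k m.2 hm.2)
    · intro j k m hm hjk
      exact Prod.ext (M.proj_ne j k m.1 hm.1 hjk) (N.proj_ne j k m.2 hm.2 hjk)
    · intro m
      obtain ⟨t, ht⟩ := M.exists_sum_proj m.1
      obtain ⟨t', ht'⟩ := N.exists_sum_proj m.2
      refine ⟨t ∪ t', Prod.ext ?_ ?_⟩
      · rw [Prod.fst_sum]; exact ht _ Finset.subset_union_left
      · rw [Prod.snd_sum]; exact ht' _ Finset.subset_union_right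
  smul_mem hs hm := ⟨M.smul_mem hs hm.1, N.smul_mem hs hm.2⟩

/-- The zero graded module. -/
def zeroMod : GrMod q where
  carrier := PUnit
  gr _ := ⊤
  isInternal := isInternal_of_proj _ (fun _ => 0) (fun _ _ => trivial) (fun _ _ _ => rfl)
    (fun _ _ _ _ _ => rfl) (fun _ => ⟨∅, rfl⟩)
  smul_mem _ _ := trivial

instance : HasZeroObject (GrMod q) :=
  ⟨zeroMod, ⟨fun _ => ⟨⟨⟨0⟩, fun f => by
      ext m
      have hm : m = 0 := Subsingleton.elim (α := PUnit) m 0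
      rw [hm]
      exact (map_zero f.lin).trans (map_zero _).symm⟩⟩,
    fun _ => ⟨⟨⟨0⟩, fun f => by ext m; exact Subsingleton.elim (α := PUnit) _ _⟩⟩⟩⟩

instance : HasBinaryBiproducts (GrMod q) where
  has_binary_biproduct M N := hasBinaryBiproduct_of_total
    { pt := prod M N
      fst := ⟨LinearMap.fst _ _ _, fun _ _ h => h.1⟩
      snd := ⟨LinearMap.snd _ _ _, fun _ _ h => h.2⟩
      inl := ⟨LinearMap.inl _ _ _, fun k _ h => ⟨h, (N.gr k).zero_mem⟩⟩
      inr := ⟨LinearMap.inr _ _ _, fun k _ h => ⟨(M.gr k).zero_mem, h⟩⟩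
      inl_fst := by ext m; rfl
      inl_snd := by ext m; rfl
      inr_fst := by ext m; rfl
      inr_snd := by ext m; rfl }
    (by
      ext m
      change (((m.1, 0) + (0, m.2) : M.carrier × N.carrier)) = m
      rw [Prod.mk_add_mk, add_zero, zero_add]
      rfl)

instance : HasFiniteProducts (GrMod q) :=
  have : HasTerminal (GrMod q) := HasZeroObject.hasTerminal
  hasFiniteProducts_of_has_binary_and_terminal

/-! #### The category of finitely generated graded modules is abelian -/

theorem ker_homogeneous {M N : GrMod q} (f : M ⟶ N) :
    ∀ m ∈ LinearMap.ker f.lin, ∀ k, M.proj k m ∈ LinearMap.ker f.lin := by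
  intro m hm k
  rw [LinearMap.mem_ker] at hm ⊢
  rw [lin_proj, hm, map_zero]

theorem range_homogeneous {M N : GrMod q} (f : M ⟶ N) :
    ∀ m ∈ LinearMap.range f.lin, ∀ k, N.proj k m ∈ LinearMap.range f.lin := by
  rintro _ ⟨m, rfl⟩ k
  exact ⟨M.proj k m, lin_proj f k m⟩

/-- The inclusion of the kernel. -/
def kerι {M N : GrMod q} (f : M ⟶ N) : sub M (LinearMap.ker f.lin) (ker_homogeneous f) ⟶ M :=
  ⟨(LinearMap.ker f.lin).subtype, fun _ _ h => h⟩

/-- The projection to the cokernel. -/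
def cokerπ {M N : GrMod q} (f : M ⟶ N) :
    N ⟶ quot N (LinearMap.range f.lin) (range_homogeneous f) :=
  ⟨(LinearMap.range f.lin).mkQ, fun _ m h => ⟨m, h, rfl⟩⟩

theorem kerι_comp {M N : GrMod q} (f : M ⟶ N) : kerι f ≫ f = 0 := by
  ext m
  exact m.2

theorem comp_cokerπ {M N : GrMod q} (f : M ⟶ N) : f ≫ cokerπ f = 0 := by
  ext m
  exact (Submodule.Quotient.mk_eq_zero _).2 ⟨m, rfl⟩

instance {M N : GrMod q} (f : M ⟶ N) : Mono (kerι f) :=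
  ⟨fun g h e => by
    ext m
    exact Subtype.ext (congrArg (fun l => Hom.lin l m) e)⟩

instance {M N : GrMod q} (f : M ⟶ N) : Epi (cokerπ f) :=
  ⟨fun g h e => by
    ext m
    obtain ⟨m, rfl⟩ := (LinearMap.range f.lin).mkQ_surjective m
    exact congrArg (fun l => Hom.lin l m) e⟩

instance : HasKernels (GrMod q) where
  has_limit f := ⟨⟨KernelFork.ofι (kerι f) (kerι_comp f),
    KernelFork.IsLimit.ofι' _ _ fun {T} g hg =>
      ⟨⟨g.lin.codRestrict _ (fun t => congrArg (fun h : T ⟶ _ => h.lin t) hg),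
        fun k m hm => g.map_mem k m hm⟩, rfl⟩⟩⟩

instance : HasCokernels (GrMod q) where
  has_colimit f := ⟨⟨CokernelCofork.ofπ (cokerπ f) (comp_cokerπ f),
    CokernelCofork.IsColimit.ofπ' _ _ fun {T} g hg =>
      ⟨⟨(LinearMap.range f.lin).liftQ g.lin (by
          rintro _ ⟨m, rfl⟩
          exact congrArg (fun h : _ ⟶ T => h.lin m) hg), by
          rintro k _ ⟨m, hm, rfl⟩
          exact g.map_mem k m hm⟩, rfl⟩⟩⟩

theorem injective_of_mono {M N : GrMod q} (f : M ⟶ N) [Mono f] :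
    Function.Injective f.lin := by
  rw [injective_iff_map_eq_zero]
  intro m hm
  have h : kerι f = 0 := by
    rw [← cancel_mono f, kerι_comp, zero_comp]
  exact congrArg (fun g => Hom.lin g (⟨m, hm⟩ : LinearMap.ker f.lin)) h

theorem surjective_of_epi {M N : GrMod q} (f : M ⟶ N) [Epi f] :
    Function.Surjective f.lin := by
  intro y
  have h : cokerπ f = 0 := by
    rw [← cancel_epi f, comp_cokerπ, comp_zero]
  exact (Submodule.Quotient.mk_eq_zero _).1 (congrArg (fun g => Hom.lin g y) h)

theorem mem_gr_of_injective {M N : GrMod q} (f : M ⟶ N) (hf : Function.Injective f.lin)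
    (k : ℤ) (m : M.carrier) (hm : f.lin m ∈ N.gr k) : m ∈ M.gr k := by
  have h : f.lin (M.proj k m) = f.lin m := by rw [lin_proj, N.proj_same k _ hm]
  rw [← hf h]
  exact M.proj_mem k m

instance : IsNormalMonoCategory (GrMod q) where
  normalMonoOfMono {M N} f hf := ⟨
    { Z := _
      g := cokerπ f
      w := comp_cokerπ f
      isLimit := by
        have inj := injective_of_mono f
        refine KernelFork.IsLimit.ofι' _ _ fun {T} g hg => ?_
        have hr : ∀ t, g.lin t ∈ LinearMap.range f.lin := fun t =>
          (Submodule.Quotient.mk_eq_zero _).1 (congrArg (fun h => Hom.lin h t) hg)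
        let l : T.carrier →ₗ[PolyRing n] M.carrier :=
          (LinearEquiv.ofInjective f.lin inj).symm.toLinearMap.comp (g.lin.codRestrict _ hr)
        have hl : ∀ t, f.lin (l t) = g.lin t := fun t =>
          congrArg Subtype.val ((LinearEquiv.ofInjective f.lin inj).apply_symm_apply
            ⟨g.lin t, hr t⟩)
        exact ⟨⟨l, fun k m hm => mem_gr_of_injective f inj k _ (by
          rw [hl]; exact g.map_mem k m hm)⟩, by ext t; exact hl t⟩ }⟩

instance : IsNormalEpiCategory (GrMod q) where
  normalEpiOfEpi {M N} f hf := ⟨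
    { W := _
      g := kerι f
      w := kerι_comp f
      isColimit := by
        have sur := surjective_of_epi f
        refine CokernelCofork.IsColimit.ofπ' _ _ fun {T} g hg => ?_
        have hk : LinearMap.ker f.lin ≤ LinearMap.ker g.lin := fun m hm =>
          LinearMap.mem_ker.2 (congrArg (fun h : sub M _ (ker_homogeneous f) ⟶ T =>
            h.lin (⟨m, hm⟩ : LinearMap.ker f.lin)) hg)
        let l : N.carrier →ₗ[PolyRing n] T.carrier :=
          ((LinearMap.ker f.lin).liftQ g.lin hk).comp
            (f.lin.quotKerEquivOfSurjective sur).symm.toLinearMap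
        have hl : ∀ m, l (f.lin m) = g.lin m := fun m => by
          have : (f.lin.quotKerEquivOfSurjective sur).symm (f.lin m)
              = (LinearMap.ker f.lin).mkQ m := by
            rw [LinearEquiv.symm_apply_eq]; rfl
          change ((LinearMap.ker f.lin).liftQ g.lin hk)
            ((f.lin.quotKerEquivOfSurjective sur).symm (f.lin m)) = _
          rw [this]; rfl
        refine ⟨⟨l, fun k y hy => ?_⟩, by ext m; exact hl m⟩
        obtain ⟨m, rfl⟩ := sur y
        rw [← N.proj_same k _ hy, ← lin_proj, hl]
        exact g.map_mem k _ (M.proj_mem k m) }⟩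

instance : Abelian (GrMod q) where

/-! #### The graded modules `S(a)` and `(S/I)(a)` -/

/-- The grading shift: `M(a)_k = M_{a+k}`. -/
def twist (M : GrMod q) (a : ℤ) : GrMod q where
  carrier := M.carrier
  gr k := M.gr (a + k)
  isInternal := by
    refine isInternal_of_proj _ (fun k => M.proj (a + k)) (fun k m => M.proj_mem _ m)
      (fun k m hm => M.proj_same _ m hm)
      (fun j k m hm hjk => M.proj_ne _ _ m hm (by omega)) ?_
    intro m
    obtain ⟨t, ht⟩ := M.exists_sum_proj m
    refine ⟨t.map (addLeftEmbedding (-a)), ?_⟩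
    rw [Finset.sum_map]
    simpa using ht t (Finset.Subset.refl t)
  smul_mem {i j s m} hs hm := by
    have h := M.smul_mem hs hm
    rwa [add_left_comm] at h

variable (q)

/-- The polynomial ring `S`, as a graded module over itself. -/
def free : GrMod q where
  carrier := PolyRing n
  gr k := (MvPolynomial.weightedHomogeneousSubmodule ℂ q k).toAddSubgroup
  isInternal := by
    refine isInternal_of_proj _
      (fun k => (MvPolynomial.weightedHomogeneousComponent q k).toAddMonoidHom) ?_ ?_ ?_ ?_
    · intro k s; exact MvPolynomial.weightedHomogeneousComponent_mem q s k
    · intro k s hs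
      exact MvPolynomial.IsWeightedHomogeneous.weightedHomogeneousComponent_same hs
    · intro j k s hs hjk
      exact MvPolynomial.IsWeightedHomogeneous.weightedHomogeneousComponent_ne k hs hjk.symm
    · intro s
      refine ⟨(MvPolynomial.weightedHomogeneousComponent_finsupp (w := q) s).toFinset, ?_⟩
      have h := MvPolynomial.sum_weightedHomogeneousComponent q s
      rw [finsum_eq_sum _ (MvPolynomial.weightedHomogeneousComponent_finsupp s)] at h
      exact h.symm
  smul_mem {i j s m} hs hm := MvPolynomial.IsWeightedHomogeneous.mul hs hm

/-- The graded module `S(a)`, so that `S(a)_k = S_{a+k}`. -/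
def S (a : ℤ) : GrMod q := (free q).twist a

theorem free_proj (k : ℤ) (f : PolyRing n) :
    (free q).proj k f = MvPolynomial.weightedHomogeneousComponent q k f := by
  have hs := MvPolynomial.weightedHomogeneousComponent_finsupp (w := q) f
  have h := MvPolynomial.sum_weightedHomogeneousComponent q f
  rw [finsum_eq_sum_of_support_subset (s := insert k hs.toFinset) _
    (fun j hj => Finset.mem_coe.2 (Finset.mem_insert_of_mem (hs.mem_toFinset.2 hj)))] at h
  have hmem : ∀ j, MvPolynomial.weightedHomogeneousComponent q j f ∈ (free q).gr j :=
    fun j => MvPolynomial.weightedHomogeneousComponent_mem q f j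
  have h' : (free q).proj k f = ∑ j ∈ insert k hs.toFinset,
      (free q).proj k (MvPolynomial.weightedHomogeneousComponent q j f) :=
    (congrArg ((free q).proj k) h.symm).trans (map_sum ((free q).proj k) _ _)
  rw [h', Finset.sum_eq_single k]
  · exact (free q).proj_same k _ (hmem k)
  · intro j _ hj
    exact (free q).proj_ne j k _ (hmem j) hj
  · intro hk
    exact absurd (Finset.mem_insert_self k _) hk

end GrMod

/-! ### Phases of a point configuration and their Cox ideals -/

/-- The map `A : ℤⁿ → N = ℤᵈ` sending the `i`-th basis vector to the point `a i`. -/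
def pointMap {n d : ℕ} (a : Fin n → Fin d → ℤ) : (Fin n → ℤ) →ₗ[ℤ] (Fin d → ℤ) :=
  Fintype.linearCombination ℤ a

/-- The regular subdivision of the points `a i` induced by the heights `ω i`, as the set of its
cells: `σ` is a cell when some linear functional agrees with `ω` on the points of `σ` and is
strictly smaller than `ω` on all other points. -/
def regularSubdivision {n d : ℕ} (a : Fin n → Fin d → ℤ) (ω : Fin n → ℝ) :
    Set (Finset (Fin n)) :=
  {σ | ∃ c : Fin d → ℝ, (∀ i ∈ σ, ∑ k, c k * (a i k : ℝ) = ω i) ∧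
    ∀ i ∉ σ, ∑ k, c k * (a i k : ℝ) < ω i}

/-- A phase: a regular subdivision of the point configuration all of whose cells are simplices
(a regular triangulation), recorded as the set of all its simplices. The points lie in an affine
hyperplane avoiding the origin, so that affine independence is linear independence. -/
def IsPhase {n d : ℕ} (a : Fin n → Fin d → ℤ) (Sig : Set (Finset (Fin n))) : Prop :=
  (∃ ω : Fin n → ℝ, Sig = regularSubdivision a ω) ∧
    ∀ σ ∈ Sig, LinearIndependent ℝ (fun (i : σ) (k : Fin d) => (a i k : ℝ))

/-- The Cox ideal `B_Σ`, generated by the monomials `∏_{i ∉ σ} xᵢ` for `σ ∈ Σ`. -/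
def coxIdeal {n : ℕ} (Sig : Set (Finset (Fin n))) : Ideal (PolyRing n) :=
  Ideal.span {f | ∃ σ ∈ Sig, f = ∏ i ∈ σᶜ, MvPolynomial.X i}

/-- The indices `p₊` of the positive entries of `v`. -/
def posSupport {n : ℕ} (v : Fin n → ℤ) : Finset (Fin n) := Finset.univ.filter fun i => 0 < v i

/-- The indices `p₋` of the negative entries of `v`. -/
def negSupport {n : ℕ} (v : Fin n → ℤ) : Finset (Fin n) := Finset.univ.filter fun i => v i < 0

/-- The simplicial complex whose only minimal non-face is `p`. -/
def complexOfNonface {n : ℕ} (p : Finset (Fin n)) : Set (Finset (Fin n)) := {σ | ¬ p ⊆ σ}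

/-- The sum of the positive entries of `v`. -/
def posSum {n : ℕ} (v : Fin n → ℤ) : ℕ := ∑ i, (v i).toNat

theorem coxIdeal_pow_homogeneous {n : ℕ} (q : Fin n → ℤ) (Sig : Set (Finset (Fin n))) (m : ℕ) :
    ∀ f ∈ coxIdeal Sig ^ m, ∀ k, (GrMod.free q).proj k f ∈ coxIdeal Sig ^ m := by
  let _ := MvPolynomial.weightedGradedAlgebra ℂ q
  have h : ∀ m : ℕ, (coxIdeal Sig ^ m).IsHomogeneous
      (MvPolynomial.weightedHomogeneousSubmodule ℂ q) := by
    intro m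
    induction m with
    | zero => rw [pow_zero, Ideal.one_eq_top]; exact Ideal.IsHomogeneous.top _
    | succ m ih =>
      rw [pow_succ]
      refine ih.mul (Ideal.homogeneous_span _ _ ?_)
      rintro _ ⟨σ, -, rfl⟩
      exact ⟨_, MvPolynomial.IsWeightedHomogeneous.prod σᶜ _ q
        (fun i _ => MvPolynomial.isWeightedHomogeneous_X ℂ q i)⟩
  intro f hf k
  rw [GrMod.free_proj]
  exact MvPolynomial.weightedHomogeneousComponent_mem_of_mem ℂ q (h m) hf k

/-! ### Graded local cohomology -/

section LocalCohomology

variable {n : ℕ} (q : Fin n → ℤ) (Sig : Set (Finset (Fin n)))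

/-- The graded module `S/B_Σ^m`. -/
def quotPow (m : ℕ) : GrMod q :=
  (GrMod.free q).quot (coxIdeal Sig ^ m) (coxIdeal_pow_homogeneous q Sig m)

/-- The inverse system `⋯ → S/B_Σ² → S/B_Σ → S/B_Σ⁰` of the canonical projections. -/
def quotPowSystem : ℕᵒᵖ ⥤ GrMod q where
  obj m := quotPow q Sig m.unop
  map {m m'} f :=
    ⟨Submodule.factor (Ideal.pow_le_pow_right (leOfHom f.unop)), by
      rintro k _ ⟨s, hs, rfl⟩
      exact ⟨s, hs, rfl⟩⟩
  map_id m := by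
    ext s
    obtain ⟨s, rfl⟩ := Submodule.mkQ_surjective _ s
    rfl
  map_comp f g := by
    ext s
    obtain ⟨s, rfl⟩ := Submodule.mkQ_surjective _ s
    rfl

instance : HasDerivedCategory.{1} (GrMod q) := HasDerivedCategory.standard _

instance : HasExt.{1} (GrMod q) := hasExt_of_hasDerivedCategory _

/-- The part of degree `δ` of the local cohomology module `Hⁱ_{B_Σ}(S)`: the direct limit over
`m` of the groups `Extⁱ(S/B_Σ^m, S(δ))` computed in the category of graded modules. -/
def localCohomologyPart (i : ℕ) (δ : ℤ) : AddCommGrpCat.{1} :=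
  colimit ((quotPowSystem q Sig).rightOp ⋙
    (Abelian.extFunctor (C := GrMod q) i).flip.obj (GrMod.S q δ))

/-- `δ` is `B_Σ`-acyclic: all local cohomology groups of `S` vanish in degree `δ`. -/
def IsAcyclic (δ : ℤ) : Prop := ∀ i : ℕ, IsZero (localCohomologyPart q Sig i δ)

/-- All pairwise differences of elements of `s` are `B_Σ`-acyclic. -/
def IsAcyclicSet (s : Set ℤ) : Prop := ∀ i ∈ s, ∀ j ∈ s, IsAcyclic q Sig (i - j)

end LocalCohomology

/-! ### Generation, Grothendieck groups and tilting in triangulated categories -/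

section Triangulated

variable {C : Type*} [Category* C] [HasZeroObject C] [HasShift C ℤ] [Preadditive C]
  [∀ k : ℤ, (shiftFunctor C k).Additive] [Pretriangulated C]

/-- The smallest full triangulated subcategory (closed under isomorphisms) containing `P`. -/
def triangulatedHull (P : ObjectProperty C) : ObjectProperty C := fun X =>
  ∀ Q : ObjectProperty C, Q.IsTriangulated → Q.IsClosedUnderIsomorphisms → P ≤ Q → Q X

instance (P : ObjectProperty C) : (triangulatedHull P).IsClosedUnderIsomorphisms where
  of_iso e h Q hQ hQ' hP := Q.prop_of_iso e (h Q hQ hQ' hP)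

instance (P : ObjectProperty C) : (triangulatedHull P).IsTriangulated where
  exists_zero := ⟨0, isZero_zero C, fun Q _ _ _ => Q.prop_zero⟩
  isStableUnderShiftBy k := ⟨fun _ h Q hQ hQ' hP => Q.le_shift k _ (h Q hQ hQ' hP)⟩
  toIsTriangulatedClosed₂ := .mk' fun T hT h₁ h₃ Q hQ hQ' hP =>
    Q.ext_of_isTriangulatedClosed₂ T hT (h₁ Q hQ hQ' hP) (h₃ Q hQ hQ' hP)

variable (C) in
/-- The Grothendieck group: generated by the objects, with a relation `[Y] = [X] + [Z]` for every
distinguished triangle `X → Y → Z → X⟦1⟧`. -/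
def K0 : Type _ :=
  FreeAbelianGroup C ⧸ AddSubgroup.closure {r : FreeAbelianGroup C |
    ∃ T ∈ distTriang C, r = .of T.obj₁ - .of T.obj₂ + .of T.obj₃}

variable (C) in
instance : AddCommGroup (K0 C) := inferInstanceAs (AddCommGroup (FreeAbelianGroup C ⧸ _))

/-- The class of an object in the Grothendieck group. -/
def K0.cls (X : C) : K0 C := QuotientAddGroup.mk (FreeAbelianGroup.of X)

/-- The (left) global dimension of `A` is finite. -/
def HasFiniteGlobalDimension.{u} (A : Type u) [Ring A] : Prop :=
  ∃ g : ℕ, ∀ M : ModuleCat.{u} A, HasProjectiveDimensionLE M g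

/-- The finite family `P` is a tilting set: its members are indecomposable, there are no higher
`Ext`'s between them, they generate the triangulated category, and the endomorphism ring of their
direct sum has finite global dimension. -/
structure IsTiltingSet [HasFiniteBiproducts C] {m : ℕ} (P : Fin m → C) : Prop where
  indecomposable : ∀ i, Indecomposable (P i)
  ext_eq_zero : ∀ i j, ∀ k : ℤ, 0 < k → ∀ f : P i ⟶ (P j)⟦k⟧, f = 0
  generates : ∀ X, triangulatedHull (fun Y => ∃ i, Y = P i) X
  globalDimension : HasFiniteGlobalDimension (End (⨁ P))

end Triangulated

/-! ### The derived category of a phase -/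

section Derived

variable {n : ℕ} (q : Fin n → ℤ) (Sig : Set (Finset (Fin n)))

/-- The bounded derived category `D(gr-S)` of finitely generated graded `S`-modules. -/
abbrev DGr : Type 1 :=
  (DerivedCategory.TStructure.t (C := GrMod q)).bounded.FullSubcategory

/-- A graded module, as a complex concentrated in degree `0`. -/
def toDGr (M : GrMod q) : DGr q :=
  ⟨(DerivedCategory.singleFunctor (GrMod q) 0).obj M, ⟨0, inferInstance⟩, ⟨0, inferInstance⟩⟩

/-- The full triangulated subcategory `T_Σ` of `D(gr-S)` generated by the graded modules which are
killed by a power of `B_Σ`. -/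
def torsion : ObjectProperty (DGr q) :=
  triangulatedHull fun X => ∃ M : GrMod q,
    (∃ m : ℕ, ∀ s ∈ coxIdeal Sig ^ m, ∀ x : M.carrier, s • x = 0) ∧ X = toDGr q M

instance : (torsion q Sig).IsTriangulated := by unfold torsion; infer_instance

/-- The derived category `D(X_Σ) = D(gr-S) / T_Σ` (Verdier quotient). -/
abbrev DX : Type 1 := (torsion q Sig).trW.Localization

/-- The line bundle `S̃(k)` on `X_Σ`, as an object of `D(X_Σ)`. -/
def lineBundle (k : ℤ) : DX q Sig := (torsion q Sig).trW.Q.obj (toDGr q (GrMod.S q k))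

end Derived

end ToricPhases

end

open CategoryTheory ToricPhases

/-!
The proof reduces everything to one kind of computation: `Ext` groups between quotients of
`S = ℂ[x₁, …, xₙ]` by powers of variables.

*Phases.* A splitting of `ℤⁿ → ℤᵈ` shows that a height vector `ω` matters only through the sign of
`v · ω`. If `v · ω = 0` the whole configuration is a cell, which is not a simplex; the two signs give
the complexes whose unique minimal non-faces are `p₊` and `p₋` (`IsSplit.isPhase_iff`). From there on
both phases are instances of the structure `IsSide`, a support `p` with a sign `ε`.

*Acyclicity.* For disjoint sets `A`, `R` of variables, `Ext` from `S/(xᵢ ^ eᵢ : i ∈ A)` to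
`S/(xᵢ ^ eᵢ : i ∈ R)` lives in the single degree `|A|`, where it is a twist of
`S/(xᵢ ^ eᵢ : i ∈ A ∪ R)` (`exists_extModel`). Passing to the limit, `δ` is acyclic unless `-εδ - N`
lies in the numerical semigroup generated by the `|vᵢ|` (`IsSide.isAcyclic_iff`). This gives
acyclicity for `|δ| < N`, finiteness because the `vᵢ` are coprime (`IsSide.finite`), and maximality
because the semigroup has no gaps of length `N` (`IsSide.maximal`).

*Generation.* Hilbert's syzygy theorem is proved as an induction principle (`ResClass.hilbert`): a
graded module over `S` has a two-term resolution by modules `M₀[x₁]` with `M₀` graded over one variable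
less. Hence the `S(k)` generate `D(gr-S)` (`hull_toDGr_S`). The module `S/(xᵢ : i ∈ p)` vanishes in
`D(X_Σ)`, so that either end of a twisted Koszul complex is built from the other terms
(`hull_lineBundle_first`, `hull_lineBundle_last`), and this moves the window `0, …, N - 1` by one
step in each direction (`IsSide.hull_window`).

*Morphisms.* A map from `S(k)` to a torsion object is killed by powers of the `xᵢ`, `i ∈ p`, and
therefore factors through some `S/(xᵢ ^ eᵢ : i ∈ p)(k)` (`exists_factor_K`). When these modules have no
`Ext` groups into `M`, maps from `S(k)` to the shifts of `M` are the same in `D(X_Σ)` as in `D(gr-S)`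
(`sheaf_map_bijective`, `hom_shift_eq_zero`). By the `Ext` computation this applies to `M = S(j)` and
to `M = (S/(xᵢ : i ∉ p))(j)` whenever `|j - k| < N`.

*Grothendieck group.* The classes of the window generate by the above. They are independent because
the Euler characteristics against the objects `(S/(xᵢ : i ∉ p))(j)` form a triangular matrix
(`IsSide.linearIndependent_cls`); consequently no member of the window is generated by the others.

*Global dimension.* The endomorphism ring of the sum of the window consists of the matrices over `S`
with homogeneous entries of degree `j - i`, and its modules are the parts of degrees `0, …, N - 1` of
graded `S`-modules (`IsGradedMatrixRing.exists_cyclic_equiv`). The window of `S(-d)` is projective for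
`0 ≤ d < N`. For other `d` it is the window of an ideal of monomials of large weight in the variables
of one sign, and this ideal is resolved by free modules with generators in degrees `0, …, N - 1`
(`ResClass.weightMod`). With the syzygy theorem this bounds the projective dimension of all cyclic
modules, and Auslander's criterion finishes the proof
(`IsGradedMatrixRing.hasFiniteGlobalDimension`).
-/

noncomputable section

namespace ToricPhases

open CategoryTheory CategoryTheory.Limits
open scoped ZeroObject

/-! ### Graded modules and short exact sequences -/

namespace GrMod

variable {n : ℕ} {q : Fin n → ℤ}

theorem mono_of_injective {M N : GrMod q} (f : M ⟶ N) (hf : Function.Injective f.lin) : Mono f :=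
  ⟨fun g h e => by
    ext m
    exact hf (congrArg (fun l => Hom.lin l m) e)⟩

theorem epi_of_surjective {M N : GrMod q} (f : M ⟶ N) (hf : Function.Surjective f.lin) : Epi f :=
  ⟨fun g h e => by
    ext m
    obtain ⟨m, rfl⟩ := hf m
    exact congrArg (fun l => Hom.lin l m) e⟩

/-- Lifting a morphism through an injective one. -/
theorem exists_lift {T M N : GrMod q} (f : M ⟶ N) (hf : Function.Injective f.lin) (g : T ⟶ N)
    (hg : ∀ t, ∃ m, f.lin m = g.lin t) : ∃ h : T ⟶ M, h ≫ f = g := by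
  let l : T.carrier →ₗ[PolyRing n] M.carrier :=
    (LinearEquiv.ofInjective f.lin hf).symm.toLinearMap.comp
      (g.lin.codRestrict (LinearMap.range f.lin) hg)
  have hl : ∀ t, f.lin (l t) = g.lin t := fun t =>
    congrArg Subtype.val ((LinearEquiv.ofInjective f.lin hf).apply_symm_apply ⟨g.lin t, hg t⟩)
  refine ⟨⟨l, fun k t ht => mem_gr_of_injective f hf k _ ?_⟩, by ext t; exact hl t⟩
  rw [hl]
  exact g.map_mem k t ht

theorem shortExact_of {A B C : GrMod q} (f : A ⟶ B) (g : B ⟶ C) (w : f ≫ g = 0)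
    (hf : Function.Injective f.lin) (hg : Function.Surjective g.lin)
    (h : ∀ b, g.lin b = 0 → ∃ a, f.lin a = b) : (ShortComplex.mk f g w).ShortExact := by
  have hm : Mono (ShortComplex.mk f g w).f := mono_of_injective f hf
  refine ShortComplex.ShortExact.mk' (ShortComplex.exact_of_f_is_kernel _ ?_) hm
    (epi_of_surjective g hg)
  refine KernelFork.IsLimit.ofι' _ _ fun {T} k hk => ?_
  have := exists_lift f hf k (fun t => h _ (congrArg (fun l : T ⟶ C => l.lin t) hk))
  exact ⟨this.choose, this.choose_spec⟩

theorem exact_apply {X : ShortComplex (GrMod q)} (hX : X.ShortExact) (b : X.X₂.carrier)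
    (hb : X.g.lin b = 0) : ∃ a, X.f.lin a = b := by
  have := hX.mono_f
  obtain ⟨l, hl⟩ : ∃ l, l ≫ X.f = kerι X.g := ⟨hX.exact.lift _ (kerι_comp X.g),
    hX.exact.lift_f _ _⟩
  exact ⟨l.lin ⟨b, hb⟩, congrArg (fun h : _ ⟶ X.X₂ => h.lin (⟨b, hb⟩ : LinearMap.ker X.g.lin)) hl⟩

theorem isIso_of_bijective {M N : GrMod q} (f : M ⟶ N) (hf : Function.Bijective f.lin) :
    IsIso f := by
  have := mono_of_injective f hf.1
  have := epi_of_surjective f hf.2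
  exact isIso_of_mono_of_epi f

/-- A bijective degree-preserving linear map is an isomorphism of graded modules. -/
def isoOfBijective {M N : GrMod q} (f : M ⟶ N) (hf : Function.Bijective f.lin) : M ≅ N :=
  have := isIso_of_bijective f hf
  asIso f

theorem isZero_of_subsingleton (M : GrMod q) [Subsingleton M.carrier] : IsZero M := by
  rw [IsZero.iff_id_eq_zero]
  ext m
  exact Subsingleton.elim _ _

/-- Homogeneity may be tested on the variables and the constants. -/
theorem smul_mem_of_X {A : Type} [AddCommGroup A] [Module (PolyRing n) A] (gr : ℤ → AddSubgroup A)
    (hC : ∀ (c : ℂ) (j : ℤ) (m : A), m ∈ gr j → (MvPolynomial.C c : PolyRing n) • m ∈ gr j)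
    (hX : ∀ (i : Fin n) (j : ℤ) (m : A), m ∈ gr j →
      (MvPolynomial.X i : PolyRing n) • m ∈ gr (q i + j))
    {i j : ℤ} {s : PolyRing n} {m : A} (hs : MvPolynomial.IsWeightedHomogeneous q s i)
    (hm : m ∈ gr j) : s • m ∈ gr (i + j) := by
  have key : ∀ (b : Fin n →₀ ℕ) (c : ℂ) (j : ℤ) (m : A), m ∈ gr j →
      (MvPolynomial.monomial b c : PolyRing n) • m ∈ gr (Finsupp.weight q b + j) := by
    intro b
    induction b using Finsupp.induction_linear with
    | zero => intro c j m hm; simpa using hC c j m hm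
    | add b b' hb hb' =>
      intro c j m hm
      have h := hb c _ _ (hb' 1 j m hm)
      rw [← mul_smul, MvPolynomial.monomial_mul, mul_one] at h
      rwa [map_add, add_assoc]
    | single a k =>
      intro c j m hm
      induction k generalizing c j m with
      | zero => simpa using hC c j m hm
      | succ k ih =>
        have h := ih c _ _ (hX a j m hm)
        rw [← mul_smul, MvPolynomial.X, MvPolynomial.monomial_mul, mul_one,
          ← Finsupp.single_add] at h
        convert h using 2
        simp only [Finsupp.weight_single, nsmul_eq_mul]
        push_cast
        ring
  rw [← MvPolynomial.support_sum_monomial_coeff s, Finset.sum_smul]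
  refine AddSubgroup.sum_mem _ fun b hb => ?_
  rw [← hs (MvPolynomial.mem_support_iff.1 hb)]
  exact key b _ j m hm

/-! #### Twists and multiplication maps -/

/-- The twist of a morphism. -/
def twistMap {M N : GrMod q} (g : M ⟶ N) (k : ℤ) : M.twist k ⟶ N.twist k :=
  ⟨g.lin, fun _ m hm => g.map_mem _ m hm⟩

/-- Multiplication by a homogeneous polynomial of degree `l - k`, as a map `M(k) → M(l)`. -/
def mulHom (M : GrMod q) (f : PolyRing n) (k l : ℤ)
    (hf : MvPolynomial.IsWeightedHomogeneous q f (l - k)) : M.twist k ⟶ M.twist l :=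
  ⟨LinearMap.lsmul (PolyRing n) M.carrier f, fun j m hm => by
    have h := M.smul_mem hf hm
    rwa [← add_assoc, sub_add_cancel] at h⟩

theorem mulHom_naturality {M N : GrMod q} (g : M ⟶ N) (f : PolyRing n) (k l : ℤ)
    (hf : MvPolynomial.IsWeightedHomogeneous q f (l - k)) :
    mulHom M f k l hf ≫ twistMap g l = twistMap g k ≫ mulHom N f k l hf := by
  ext m
  exact map_smul g.lin f (m : M.carrier)

theorem isWeightedHomogeneous_X_pow (i : Fin n) (m : ℕ) (k : ℤ) :
    MvPolynomial.IsWeightedHomogeneous q ((MvPolynomial.X i : PolyRing n) ^ m)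
      (k - (k - m * q i)) := by
  have h := (MvPolynomial.isWeightedHomogeneous_X ℂ q i).pow m
  rwa [nsmul_eq_mul, ← sub_sub_cancel k (m * q i)] at h

/-! #### Maps out of free modules -/

variable (q) in
theorem one_mem_S (k : ℤ) : (1 : PolyRing n) ∈ (S q k).gr (-k) := by
  change MvPolynomial.IsWeightedHomogeneous q 1 (k + -k)
  rw [add_neg_cancel]
  exact MvPolynomial.isWeightedHomogeneous_one ℂ q

/-- The map `S(k) → M` sending `1` to `m`. -/
def ofMem (M : GrMod q) (k : ℤ) (m : M.carrier) (hm : m ∈ M.gr (-k)) : S q k ⟶ M :=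
  ⟨LinearMap.toSpanSingleton (PolyRing n) M.carrier m, fun j s hs => by
    have h := M.smul_mem (i := k + j) hs hm
    rwa [show k + j + -k = j by ring] at h⟩

theorem S_hom_ext {M : GrMod q} {k : ℤ} {f g : S q k ⟶ M}
    (h : f.lin (1 : PolyRing n) = g.lin (1 : PolyRing n)) : f = g := by
  have key : ∀ (g : S q k ⟶ M) (s : PolyRing n), g.lin s = s • g.lin (1 : PolyRing n) :=
    fun g s => (congrArg g.lin (mul_one s).symm).trans (map_smul g.lin s (1 : PolyRing n))
  ext s
  rw [key f s, key g s, h]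

/-- Maps `S(k) → M` are elements of `M` of degree `-k`. -/
def homS (M : GrMod q) (k : ℤ) : (S q k ⟶ M) ≃+ M.gr (-k) where
  toFun f := ⟨f.lin (1 : PolyRing n), f.map_mem _ _ (one_mem_S q k)⟩
  invFun m := ofMem M k m.1 m.2
  left_inv _ := S_hom_ext (one_smul _ _)
  right_inv m := Subtype.ext (one_smul (PolyRing n) m.1)
  map_add' _ _ := rfl

instance projective_S (k : ℤ) : Projective (S q k) where
  factors {E X} f e _ := by
    -- lift the image of `1` and project the lift to degree `-k`
    obtain ⟨y, hy⟩ := surjective_of_epi e (f.lin (1 : PolyRing n))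
    refine ⟨ofMem E k _ (E.proj_mem (-k) y), S_hom_ext ?_⟩
    change e.lin ((1 : PolyRing n) • E.proj (-k) y) = _
    rw [one_smul, lin_proj, hy, X.proj_same _ _ (f.map_mem _ _ (one_mem_S q k))]

/-! #### Quotients by powers of variables -/

/-- The ideal generated by the powers `xᵢ ^ eᵢ` for `i ∈ A`. -/
def powIdeal (e : Fin n → ℕ) (A : Finset (Fin n)) : Ideal (PolyRing n) :=
  Ideal.span ((fun i => (MvPolynomial.X i : PolyRing n) ^ e i) '' (A : Set (Fin n)))

theorem mem_powIdeal {e : Fin n → ℕ} {A : Finset (Fin n)} {f : PolyRing n} :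
    f ∈ powIdeal e A ↔ ∀ b ∈ f.support, ∃ i ∈ A, e i ≤ b i := by
  have h : powIdeal e A = Ideal.span ((fun s => MvPolynomial.monomial s (1 : ℂ)) ''
      ((fun i => Finsupp.single i (e i)) '' (A : Set (Fin n)))) := by
    rw [powIdeal, Set.image_image]
    simp only [MvPolynomial.X_pow_eq_monomial]
  rw [h, MvPolynomial.mem_ideal_span_monomial_image]
  refine forall₂_congr fun b _ => ?_
  simp only [Set.mem_image, Finset.mem_coe, exists_exists_and_eq_and, Finsupp.single_le_iff]

theorem mul_mem_powIdeal_iff {e : Fin n → ℕ} {A : Finset (Fin n)} {i : Fin n} (hi : i ∉ A)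
    (m : ℕ) (f : PolyRing n) :
    (MvPolynomial.X i : PolyRing n) ^ m * f ∈ powIdeal e A ↔ f ∈ powIdeal e A := by
  refine ⟨fun h => ?_, fun h => Ideal.mul_mem_left _ _ h⟩
  rw [mem_powIdeal] at h ⊢
  intro b hb
  obtain ⟨j, hj, hle⟩ := h (Finsupp.single i m + b) (by
    rw [MvPolynomial.mem_support_iff] at hb ⊢
    rwa [MvPolynomial.X_pow_eq_monomial, MvPolynomial.coeff_monomial_mul, one_mul])
  refine ⟨j, hj, ?_⟩
  rw [Finsupp.add_apply, Finsupp.single_apply, if_neg (by rintro rfl; exact hi hj),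
    zero_add] at hle
  exact hle

theorem powIdeal_homogeneous (q : Fin n → ℤ) (e : Fin n → ℕ) (A : Finset (Fin n)) :
    ∀ f ∈ powIdeal e A, ∀ k, (GrMod.free q).proj k f ∈ powIdeal e A := by
  intro f hf k
  rw [mem_powIdeal] at hf
  rw [GrMod.free_proj]
  refine mem_powIdeal.2 fun b hb => hf b ?_
  rw [MvPolynomial.mem_support_iff] at hb ⊢
  rw [MvPolynomial.coeff_weightedHomogeneousComponent] at hb
  exact fun h => hb (by rw [h, ite_self])

variable (q) in
/-- The graded module `S/(xᵢ ^ eᵢ : i ∈ A)`. -/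
def quotPows (e : Fin n → ℕ) (A : Finset (Fin n)) : GrMod q :=
  (free q).quot (powIdeal e A) (powIdeal_homogeneous q e A)

variable (q) in
/-- The twist `(S/(xᵢ ^ eᵢ : i ∈ A))(k)`. -/
abbrev K (e : Fin n → ℕ) (A : Finset (Fin n)) (k : ℤ) : GrMod q := (quotPows q e A).twist k

theorem powIdeal_mono {e e' : Fin n → ℕ} {A A' : Finset (Fin n)}
    (h : ∀ i ∈ A, i ∈ A' ∧ e' i ≤ e i) : powIdeal e A ≤ powIdeal e' A' := by
  intro f hf
  rw [mem_powIdeal] at hf ⊢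
  intro b hb
  obtain ⟨i, hi, hle⟩ := hf b hb
  exact ⟨i, (h i hi).1, (h i hi).2.trans hle⟩

variable (q) in
/-- The projection `S/(xᵢ ^ eᵢ : i ∈ A) → S/(xᵢ ^ e'ᵢ : i ∈ A')`. -/
def quotPowsMap {e e' : Fin n → ℕ} {A A' : Finset (Fin n)}
    (h : ∀ i ∈ A, i ∈ A' ∧ e' i ≤ e i) : quotPows q e A ⟶ quotPows q e' A' :=
  ⟨Submodule.factor (powIdeal_mono h), by
    rintro k _ ⟨s, hs, rfl⟩
    exact ⟨s, hs, rfl⟩⟩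

/-- For `i ∉ A`, the power `xᵢ ^ eᵢ` is a non-zero-divisor on `S/(xⱼ ^ eⱼ : j ∈ A)`. These sequences
replace the Koszul complex: all statements about it are proved by induction on `A`. -/
theorem K_shortExact (e : Fin n → ℕ) (A : Finset (Fin n)) (i : Fin n) (hi : i ∉ A) (k : ℤ) :
    ∃ w, (ShortComplex.mk (mulHom (quotPows q e A) ((MvPolynomial.X i) ^ e i)
        (k - e i * q i) k (isWeightedHomogeneous_X_pow i (e i) k) : K q e A (k - e i * q i) ⟶ K q e A k)
      (twistMap (quotPowsMap q (A' := insert i A) (e' := e)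
        (fun _ h => ⟨Finset.mem_insert_of_mem h, le_rfl⟩)) k :
        K q e A k ⟶ K q e (insert i A) k) w).ShortExact := by
  have w : (mulHom (quotPows q e A) ((MvPolynomial.X i) ^ e i)
        (k - e i * q i) k (isWeightedHomogeneous_X_pow i (e i) k) : K q e A (k - e i * q i) ⟶ K q e A k) ≫
      (twistMap (quotPowsMap q (A' := insert i A) (e' := e)
        (fun _ h => ⟨Finset.mem_insert_of_mem h, le_rfl⟩)) k :
        K q e A k ⟶ K q e (insert i A) k) = 0 := by
    ext s
    obtain ⟨s, rfl⟩ := (powIdeal e A).mkQ_surjective s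
    refine (Submodule.Quotient.mk_eq_zero (powIdeal e (insert i A))).2 ?_
    change (MvPolynomial.X i) ^ e i * s ∈ _
    exact Ideal.mul_mem_right _ _ (Ideal.subset_span ⟨i, by simp, rfl⟩)
  refine ⟨w, shortExact_of _ _ w ?_ ?_ ?_⟩
  · rw [injective_iff_map_eq_zero]
    intro s hs
    obtain ⟨s, rfl⟩ := (powIdeal e A).mkQ_surjective s
    refine (Submodule.Quotient.mk_eq_zero (powIdeal e A)).2 ?_
    have hs' : (MvPolynomial.X i) ^ e i * s ∈ powIdeal e A :=
      (Submodule.Quotient.mk_eq_zero (powIdeal e A)).1 hs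
    exact (mul_mem_powIdeal_iff hi _ _).1 hs'
  · intro s
    obtain ⟨s, rfl⟩ := (powIdeal e (insert i A)).mkQ_surjective s
    exact ⟨(powIdeal e A).mkQ s, rfl⟩
  · intro s hs
    obtain ⟨s, rfl⟩ := (powIdeal e A).mkQ_surjective s
    have hs' : s ∈ powIdeal e (insert i A) :=
      (Submodule.Quotient.mk_eq_zero (powIdeal e (insert i A))).1 hs
    rw [powIdeal, Finset.coe_insert, Set.image_insert_eq, Ideal.span_insert,
      Submodule.mem_sup] at hs'
    obtain ⟨y, hy, z, hz, rfl⟩ := hs'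
    obtain ⟨t, rfl⟩ := Ideal.mem_span_singleton'.1 hy
    refine ⟨(powIdeal e A).mkQ t, ?_⟩
    change (powIdeal e A).mkQ ((MvPolynomial.X i) ^ e i * t) = (powIdeal e A).mkQ _
    rw [map_add, (Submodule.Quotient.mk_eq_zero (powIdeal e A)).2 hz |> fun h =>
      (show (powIdeal e A).mkQ z = 0 from h), add_zero, mul_comm]

/-- The projection `S(k) → (S/(xᵢ ^ eᵢ : i ∈ A))(k)`. -/
def KMk (e : Fin n → ℕ) (A : Finset (Fin n)) (k : ℤ) : S q k ⟶ K q e A k :=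
  ⟨(powIdeal e A).mkQ, fun _ s hs => ⟨s, hs, rfl⟩⟩

theorem KMk_empty_bijective (e : Fin n → ℕ) (k : ℤ) :
    Function.Bijective (KMk (q := q) e ∅ k).lin := by
  constructor
  · rw [injective_iff_map_eq_zero]
    intro s hs
    have h := (Submodule.Quotient.mk_eq_zero (powIdeal e ∅)).1 hs
    rw [powIdeal, Finset.coe_empty, Set.image_empty, Ideal.span_empty] at h
    exact h
  · exact (powIdeal e ∅).mkQ_surjective

/-- `S(k)` is the quotient by no powers. -/
def KEmptyIso (e : Fin n → ℕ) (k : ℤ) : S q k ≅ K q e ∅ k :=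
  isoOfBijective (KMk e ∅ k) (KMk_empty_bijective e k)

theorem K_gr_eq_zero_iff (e : Fin n → ℕ) (A : Finset (Fin n)) (j : ℤ) :
    (∀ x ∈ (quotPows q e A).gr j, x = 0) ↔
      ∀ b : Fin n →₀ ℕ, Finsupp.weight q b = j → ∃ i ∈ A, e i ≤ b i := by
  constructor
  · intro h b hb
    have h1 := h ((powIdeal e A).mkQ (MvPolynomial.monomial b 1))
      ⟨_, MvPolynomial.isWeightedHomogeneous_monomial q b 1 hb, rfl⟩
    have h2 := (Submodule.Quotient.mk_eq_zero (powIdeal e A)).1 h1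
    exact mem_powIdeal.1 h2 b (by classical rw [MvPolynomial.support_monomial]; simp)
  · rintro h _ ⟨s, hs, rfl⟩
    refine (Submodule.Quotient.mk_eq_zero (powIdeal e A)).2 (mem_powIdeal.2 fun b hb => ?_)
    exact h b (hs (MvPolynomial.mem_support_iff.1 hb))

end GrMod

/-! ### Phases of a configuration of corank one -/

section Configuration

variable {n d : ℕ} {a : Fin n → Fin d → ℤ} {v : Fin n → ℤ}

theorem sum_relation (hv : LinearMap.ker (pointMap a) = Submodule.span ℤ {v}) (k : Fin d) :
    ∑ i, v i * a i k = 0 := by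
  have h : v ∈ LinearMap.ker (pointMap a) := hv ▸ Submodule.mem_span_singleton_self v
  have h' := congrFun (LinearMap.mem_ker.1 h) k
  simpa [pointMap, Fintype.linearCombination_apply] using h'

theorem relation_ne_zero (hrank : Module.finrank ℤ (LinearMap.ker (pointMap a)) = 1)
    (hv : LinearMap.ker (pointMap a) = Submodule.span ℤ {v}) : v ≠ 0 := by
  rintro rfl
  rw [hv, Submodule.span_zero_singleton] at hrank
  simp at hrank

/-- A section `β` of the surjection `ℤⁿ → ℤᵈ` splits off the kernel `ℤ v`. -/
theorem exists_splitting (hsurj : Function.Surjective (pointMap a))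
    (hv : LinearMap.ker (pointMap a) = Submodule.span ℤ {v}) :
    ∃ (β : Fin d → Fin n → ℤ) (c : Fin n → ℤ), ∀ i j,
      (if i = j then 1 else 0) = ∑ k, a i k * β k j + c i * v j := by
  classical
  obtain ⟨B, hB⟩ := Module.projective_lifting_property (pointMap a) LinearMap.id hsurj
  have hB' : ∀ x, pointMap a (B x) = x := fun x => LinearMap.congr_fun hB x
  have hpt : ∀ i, pointMap a (Pi.single i 1) = a i := fun i => by
    simp [pointMap, Fintype.linearCombination_apply_single]
  have hker : ∀ i, ∃ c : ℤ, c • v = Pi.single i 1 - B (a i) := fun i => by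
    rw [← Submodule.mem_span_singleton, ← hv, LinearMap.mem_ker, map_sub, hB', hpt, sub_self]
  choose c hc using hker
  refine ⟨fun k => B (Pi.single k 1), c, fun i j => ?_⟩
  have h1 : B (a i) = ∑ k, a i k • B (Pi.single k 1) := by
    conv_lhs => rw [← Finset.univ_sum_single (a i), map_sum]
    refine Finset.sum_congr rfl fun k _ => ?_
    rw [← map_smul, ← Pi.single_smul, smul_eq_mul, mul_one]
  have h2 := congrFun (hc i) j
  rw [h1] at h2
  simp only [Pi.smul_apply, smul_eq_mul, Pi.sub_apply, Finset.sum_apply, Pi.single_apply] at h2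
  rw [h2]
  simp only [eq_comm]
  ring

variable (a v) in
/-- The numerical data extracted from a point configuration of corank one: a nonzero relation `v`
among the points, with coefficient sum zero, and a splitting of `ℤⁿ → ℤᵈ`. -/
structure IsSplit (β : Fin d → Fin n → ℤ) (c : Fin n → ℤ) : Prop where
  rel : ∀ k, ∑ i, v i * a i k = 0
  ne_zero : v ≠ 0
  sum_eq_zero : ∑ i, v i = 0
  split : ∀ i j, (if i = j then 1 else 0) = ∑ k, a i k * β k j + c i * v j

variable {β : Fin d → Fin n → ℤ} {c : Fin n → ℤ}

/-- `v` is primitive. -/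
theorem IsSplit.sum_mul_eq_one (h : IsSplit a v β c) : ∑ i, c i * v i = 1 := by
  obtain ⟨j, hj⟩ := Function.ne_iff.1 h.ne_zero
  have h1 : ∑ i, v i * (if i = j then (1 : ℤ) else 0)
      = ∑ i, v i * (∑ k, a i k * β k j + c i * v j) :=
    Finset.sum_congr rfl fun i _ => by rw [h.split i j]
  simp only [mul_ite, mul_one, mul_zero, Finset.sum_ite_eq', Finset.mem_univ, if_true, mul_add,
    Finset.sum_add_distrib, Finset.mul_sum] at h1
  rw [Finset.sum_comm] at h1
  have h2 : ∑ k, ∑ i, v i * (a i k * β k j) = 0 := Finset.sum_eq_zero fun k _ => by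
    simp only [← mul_assoc]
    rw [← Finset.sum_mul, h.rel, zero_mul]
  have h3 : ∑ i, v i * (c i * v j) = (∑ i, c i * v i) * v j := by
    rw [Finset.sum_mul]
    exact Finset.sum_congr rfl fun i _ => by ring
  rw [h2, zero_add, h3] at h1
  exact mul_right_cancel₀ hj (by rw [one_mul]; exact h1.symm)

/-- Every real vector consists of the values of a linear functional at the points, up to a multiple
of `c`; in particular the vectors orthogonal to `v` are such values. -/
theorem IsSplit.real_split (h : IsSplit a v β c) (u : Fin n → ℝ) (i : Fin n) :
    u i = ∑ k, (∑ j, (β k j : ℝ) * u j) * a i k + c i * ∑ j, v j * u j := by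
  have h1 : u i = ∑ j, (if i = j then (1 : ℝ) else 0) * u j := by simp
  have h2 : ∀ j, (if i = j then (1 : ℝ) else 0) = ∑ k, (a i k : ℝ) * β k j + c i * v j :=
    fun j => by
      have := h.split i j
      have := congrArg (Int.cast : ℤ → ℝ) this
      push_cast at this
      exact this
  rw [h1]
  simp only [h2, add_mul, Finset.sum_add_distrib, Finset.sum_mul, Finset.mul_sum]
  rw [Finset.sum_comm]
  congr 1
  · exact Finset.sum_congr rfl fun k _ => Finset.sum_congr rfl fun j _ => by ring
  · exact Finset.sum_congr rfl fun j _ => by ring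

theorem IsSplit.exists_pos (h : IsSplit a v β c) : ∃ i, 0 < v i := by
  by_contra! hn
  refine h.ne_zero (funext fun i => ?_)
  exact (Finset.sum_eq_zero_iff_of_nonpos fun i _ => hn i).1 h.sum_eq_zero i (Finset.mem_univ i)

theorem IsSplit.exists_neg (h : IsSplit a v β c) : ∃ i, v i < 0 := by
  by_contra! hn
  refine h.ne_zero (funext fun i => ?_)
  exact (Finset.sum_eq_zero_iff_of_nonneg fun i _ => hn i).1 h.sum_eq_zero i (Finset.mem_univ i)

/-- Cells of the subdivision are the zero sets of the slack vectors `s ≥ 0` with `v · s = v · ω`,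
because the values `c · aᵢ` of linear functionals are the vectors orthogonal to `v`. -/
theorem IsSplit.mem_regularSubdivision (h : IsSplit a v β c) (ω : Fin n → ℝ)
    (σ : Finset (Fin n)) : σ ∈ regularSubdivision a ω ↔
      ∃ s : Fin n → ℝ, (∀ i ∈ σ, s i = 0) ∧ (∀ i ∉ σ, 0 < s i) ∧
        ∑ i, v i * s i = ∑ i, v i * ω i := by
  constructor
  · rintro ⟨c, h1, h2⟩
    refine ⟨fun i => ω i - ∑ k, c k * (a i k : ℝ), fun i hi => sub_eq_zero.2 (h1 i hi).symm,
      fun i hi => sub_pos.2 (h2 i hi), ?_⟩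
    have h3 : ∑ i, (v i : ℝ) * ∑ k, c k * (a i k : ℝ) = 0 := by
      simp only [Finset.mul_sum]
      rw [Finset.sum_comm]
      refine Finset.sum_eq_zero fun k _ => ?_
      have h4 : ∑ i, (v i : ℝ) * a i k = 0 := by exact_mod_cast h.rel k
      calc ∑ i, (v i : ℝ) * (c k * a i k) = c k * ∑ i, (v i : ℝ) * a i k := by
            rw [Finset.mul_sum]; exact Finset.sum_congr rfl fun i _ => by ring
        _ = 0 := by rw [h4, mul_zero]
    simp only [mul_sub, Finset.sum_sub_distrib, h3, sub_zero]
  · rintro ⟨s, h1, h2, h3⟩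
    have h4 : ∑ i, (v i : ℝ) * (ω i - s i) = 0 := by
      simp only [mul_sub, Finset.sum_sub_distrib, h3, sub_self]
    have h5 : ∀ i, ∑ k, (∑ j, (β k j : ℝ) * (ω j - s j)) * a i k = ω i - s i := fun i => by
      rw [h.real_split (fun j => ω j - s j) i, h4, mul_zero, add_zero]
    exact ⟨fun k => ∑ j, (β k j : ℝ) * (ω j - s j), fun i hi => by rw [h5, h1 i hi, sub_zero],
      fun i hi => by rw [h5]; linarith [h2 i hi]⟩

theorem neg_relation_posSupport : posSupport (-v) = negSupport v := by
  ext i; simp [posSupport, negSupport]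

/-- Heights with `v · ω > 0` induce the complex whose minimal non-face is `p₊`: slacks vanishing on
`σ ⊇ p₊` have nonpositive pairing with `v`, and otherwise a slack off `σ` in `p₊` can be chosen
large. -/
theorem exists_slack_iff {t : ℝ} (ht : 0 < t) (σ : Finset (Fin n)) :
    (∃ s : Fin n → ℝ, (∀ i ∈ σ, s i = 0) ∧ (∀ i ∉ σ, 0 < s i) ∧ ∑ i, v i * s i = t) ↔
      ¬ posSupport v ⊆ σ := by
  classical
  constructor
  · rintro ⟨s, h1, h2, h3⟩ hσ
    have : ∑ i, (v i : ℝ) * s i ≤ 0 := Finset.sum_nonpos fun i _ => by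
      by_cases hi : i ∈ σ
      · rw [h1 i hi, mul_zero]
      · have hvi : v i ≤ 0 := by
          by_contra hc
          exact hi (hσ (by simpa [posSupport] using hc))
        exact mul_nonpos_of_nonpos_of_nonneg (by exact_mod_cast hvi) (h2 i hi).le
    linarith
  · intro hσ
    obtain ⟨i, hi, hiσ⟩ := Finset.not_subset.1 hσ
    have hvi : (0 : ℝ) < v i := by
      have : 0 < v i := by simpa [posSupport] using hi
      exact_mod_cast this
    -- small slack `η` off `σ`, and the slack of `i` adjusted to give the sum `t`
    let r : ℝ := ∑ j ∈ σᶜ.erase i, (v j : ℝ)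
    obtain ⟨η, hη, hηr⟩ : ∃ η : ℝ, 0 < η ∧ η * r < t := by
      refine ⟨t / (|r| + 1), by positivity, ?_⟩
      rw [div_mul_eq_mul_div, div_lt_iff₀ (by positivity)]
      nlinarith [le_abs_self r]
    refine ⟨fun j => if j = i then (t - η * r) / v i else if j ∈ σ then 0 else η, ?_, ?_, ?_⟩
    · intro j hj
      have : j ≠ i := by rintro rfl; exact hiσ hj
      simp [this, hj]
    · intro j hj
      by_cases hji : j = i
      · simp only [hji, if_true]
        exact div_pos (by linarith) hvi
      · simp [hji, hj, hη]
    · rw [← Finset.add_sum_erase _ _ (Finset.mem_univ i)]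
      simp only [if_true]
      have h1 : ∑ j ∈ Finset.univ.erase i, (v j : ℝ) *
          (if j = i then (t - η * r) / v i else if j ∈ σ then 0 else η) = η * r := by
        rw [Finset.mul_sum]
        symm
        refine Finset.sum_subset_zero_on_sdiff (Finset.erase_subset_erase _ (Finset.subset_univ _))
          ?_ ?_
        · intro j hj
          simp only [Finset.mem_sdiff, Finset.mem_erase, Finset.mem_univ, Finset.mem_compl] at hj
          have : j ∈ σ := by tauto
          simp [hj.1.1, this]
        · intro j hj
          simp only [Finset.mem_erase, Finset.mem_compl] at hj
          simp [hj.1, hj.2, mul_comm]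
      rw [h1, mul_div_cancel₀ _ hvi.ne']
      ring

theorem IsSplit.regularSubdivision_of_pos (h : IsSplit a v β c) (ω : Fin n → ℝ)
    (hω : 0 < ∑ i, v i * ω i) :
    regularSubdivision a ω = complexOfNonface (posSupport v) := by
  ext σ
  rw [h.mem_regularSubdivision, exists_slack_iff hω]
  rfl

theorem IsSplit.neg (h : IsSplit a v β c) : IsSplit a (-v) β (-c) where
  rel k := by simpa using h.rel k
  ne_zero := neg_ne_zero.2 h.ne_zero
  sum_eq_zero := by simpa using h.sum_eq_zero
  split i j := by simpa using h.split i j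

theorem IsSplit.regularSubdivision_of_neg (h : IsSplit a v β c) (ω : Fin n → ℝ)
    (hω : ∑ i, v i * ω i < 0) :
    regularSubdivision a ω = complexOfNonface (negSupport v) := by
  rw [← neg_relation_posSupport]
  exact h.neg.regularSubdivision_of_pos ω (by simpa using hω)

/-- Every proper subset of the support of the unique relation is independent. -/
theorem IsSplit.linearIndependent (h : IsSplit a v β c) (σ : Finset (Fin n)) (i : Fin n)
    (hi : i ∉ σ) (hvi : v i ≠ 0) :
    LinearIndependent ℝ (fun (i : σ) (k : Fin d) => (a i k : ℝ)) := by
  classical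
  rw [Fintype.linearIndependent_iff]
  intro g hg
  let u : Fin n → ℝ := fun j => if hj : j ∈ σ then g ⟨j, hj⟩ else 0
  have hu : ∀ k, ∑ j, u j * a j k = 0 := fun k => by
    have h1 := congrFun hg k
    simp only [Finset.sum_apply, Pi.smul_apply, smul_eq_mul, Pi.zero_apply] at h1
    rw [← Finset.sum_subset (Finset.subset_univ σ)
      (fun j _ hj => by simp [u, hj]), ← Finset.sum_coe_sort, ← h1]
    exact Finset.sum_congr rfl fun j _ => by simp [u]
  have key : ∀ j, u j = (∑ i, u i * c i) * v j := fun j => by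
    have h1 : u j = ∑ i, u i * (if i = j then (1 : ℝ) else 0) := by simp
    have h2 : ∀ i, (if i = j then (1 : ℝ) else 0) = ∑ k, (a i k : ℝ) * β k j + c i * v j :=
      fun i => by
        have := congrArg (Int.cast : ℤ → ℝ) (h.split i j)
        push_cast at this
        exact this
    rw [h1]
    simp only [h2, mul_add, Finset.sum_add_distrib, Finset.mul_sum, Finset.sum_mul]
    rw [Finset.sum_comm]
    have h3 : ∑ k, ∑ i, u i * ((a i k : ℝ) * β k j) = 0 := Finset.sum_eq_zero fun k _ => by
      simp only [← mul_assoc]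
      rw [← Finset.sum_mul, hu, zero_mul]
    rw [h3, zero_add]
    exact Finset.sum_congr rfl fun i _ => by ring
  have hui : u i = 0 := by simp [u, hi]
  have hz : ∑ i, u i * c i = 0 := by
    have := key i
    rw [hui] at this
    exact (mul_eq_zero.1 this.symm).resolve_right (by exact_mod_cast hvi)
  intro j
  have := key j
  rw [hz, zero_mul] at this
  simpa [u] using this

/-- The relation `v` shows that the whole configuration is not a simplex. -/
theorem IsSplit.not_linearIndependent (h : IsSplit a v β c) :
    ¬ LinearIndependent ℝ (fun (i : (Finset.univ : Finset (Fin n))) (k : Fin d) => (a i k : ℝ)) := by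
  intro hli
  rw [Fintype.linearIndependent_iff] at hli
  refine h.ne_zero (funext fun i => ?_)
  have := hli (fun i => (v i : ℝ)) (by
    ext k
    have h4 : ∑ i, (v i : ℝ) * a i k = 0 := by exact_mod_cast h.rel k
    simp only [Finset.sum_apply, Pi.smul_apply, smul_eq_mul, Pi.zero_apply]
    rw [Finset.sum_coe_sort Finset.univ (fun i => (v i : ℝ) * a i k)]
    exact h4) ⟨i, Finset.mem_univ i⟩
  exact_mod_cast this

theorem IsSplit.isPhase_iff (h : IsSplit a v β c) (Sig : Set (Finset (Fin n))) :
    IsPhase a Sig ↔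
      Sig = complexOfNonface (posSupport v) ∨ Sig = complexOfNonface (negSupport v) := by
  classical
  constructor
  · rintro ⟨⟨ω, rfl⟩, hli⟩
    rcases lt_trichotomy (∑ i, v i * ω i) 0 with ht | ht | ht
    · exact Or.inr (h.regularSubdivision_of_neg ω ht)
    · -- the whole configuration is a cell, and it is not a simplex
      exact absurd (hli Finset.univ ((h.mem_regularSubdivision ω _).2
        ⟨0, fun _ _ => rfl, fun i hi => absurd (Finset.mem_univ i) hi, by simpa using ht.symm⟩))
        h.not_linearIndependent
    · exact Or.inl (h.regularSubdivision_of_pos ω ht)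
  · rintro (rfl | rfl)
    · obtain ⟨i, hi⟩ := h.exists_pos
      refine ⟨⟨Pi.single i 1, (h.regularSubdivision_of_pos _ ?_).symm⟩, fun σ hσ => ?_⟩
      · simpa [Pi.single_apply] using hi
      · obtain ⟨j, hj, hjσ⟩ := Finset.not_subset.1 hσ
        exact h.linearIndependent σ j hjσ (by simp [posSupport] at hj; omega)
    · obtain ⟨i, hi⟩ := h.exists_neg
      refine ⟨⟨Pi.single i 1, (h.regularSubdivision_of_neg _ ?_).symm⟩, fun σ hσ => ?_⟩
      · simpa [Pi.single_apply] using hi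
      · obtain ⟨j, hj, hjσ⟩ := Finset.not_subset.1 hσ
        exact h.linearIndependent σ j hjσ (by simp [negSupport] at hj; omega)

theorem IsSplit.complex_ne (h : IsSplit a v β c) :
    complexOfNonface (posSupport v) ≠ complexOfNonface (negSupport v) := by
  intro he
  obtain ⟨i, hi⟩ := h.exists_neg
  have h1 : posSupport v ∈ complexOfNonface (negSupport v) := fun hs => by
    have := hs (show i ∈ negSupport v by simpa [negSupport] using hi)
    simp [posSupport] at this
    omega
  rw [← he] at h1
  exact h1 (Finset.Subset.refl _)

theorem coxIdeal_complexOfNonface (p : Finset (Fin n)) :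
    coxIdeal (complexOfNonface p) = Ideal.span (MvPolynomial.X '' (p : Set (Fin n))) := by
  classical
  apply le_antisymm
  · refine Ideal.span_le.2 ?_
    rintro _ ⟨σ, hσ, rfl⟩
    obtain ⟨i, hi, hiσ⟩ := Finset.not_subset.1 hσ
    exact Ideal.mem_of_dvd _ (Finset.dvd_prod_of_mem _ (Finset.mem_compl.2 hiσ))
      (Ideal.subset_span ⟨i, hi, rfl⟩)
  · refine Ideal.span_le.2 ?_
    rintro _ ⟨i, hi, rfl⟩
    refine Ideal.subset_span ⟨{i}ᶜ, fun hs => ?_, by simp⟩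
    simpa using hs hi

theorem posSum_eq (v : Fin n → ℤ) : (posSum v : ℤ) = ∑ i ∈ posSupport v, v i := by
  classical
  rw [posSum, posSupport, Finset.sum_filter]
  push_cast
  exact Finset.sum_congr rfl fun i _ => by split_ifs <;> omega

theorem IsSplit.posSum_eq_neg (h : IsSplit a v β c) :
    (posSum v : ℤ) = ∑ i ∈ negSupport v, -v i := by
  classical
  have h1 : (posSum v : ℤ) - ∑ i ∈ negSupport v, -v i = ∑ i, v i := by
    rw [posSum, negSupport, Finset.sum_filter]
    push_cast
    rw [← Finset.sum_sub_distrib]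
    exact Finset.sum_congr rfl fun i _ => by split_ifs <;> omega
  rw [h.sum_eq_zero] at h1
  omega

end Configuration

/-! ### `Ext` groups of quotients by powers of variables -/

namespace GrMod

open Abelian

variable {n : ℕ} {q : Fin n → ℤ}

/-- Two surjections with the same kernel have isomorphic targets. -/
theorem exists_addEquiv_of_ker_eq {G H H' : Type*} [AddCommGroup G] [AddCommGroup H]
    [AddCommGroup H'] (f : G →+ H) (g : G →+ H') (hf : Function.Surjective f)
    (hg : Function.Surjective g) (h : ∀ x, f x = 0 ↔ g x = 0) :
    ∃ e : H ≃+ H', ∀ x, e (f x) = g x := by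
  have hk : f.ker = g.ker := by ext x; exact h x
  refine ⟨(QuotientAddGroup.quotientKerEquivOfSurjective f hf).symm.trans
    ((QuotientAddGroup.quotientAddEquivOfEq hk).trans
      (QuotientAddGroup.quotientKerEquivOfSurjective g hg)), fun x => ?_⟩
  have h1 : (QuotientAddGroup.quotientKerEquivOfSurjective f hf).symm (f x) =
      QuotientAddGroup.mk x := by
    rw [AddEquiv.symm_apply_eq]; rfl
  rw [AddEquiv.trans_apply, h1]
  rfl

/-- The groups `Extˢ(C(k), Y)` are the homogeneous parts of degree `c - k` of the module `M`,
compatibly with multiplication by homogeneous polynomials, and all other `Ext` groups vanish. -/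
structure ExtModel (Y C M : GrMod q) (c : ℤ) (s : ℕ) where
  φ : ∀ k : ℤ, Ext (C.twist k) Y s ≃+ M.gr (c - k)
  vanish : ∀ (k : ℤ) (i : ℕ), i ≠ s → ∀ x : Ext (C.twist k) Y i, x = 0
  compat : ∀ (k l : ℤ) (f : PolyRing n) (hf : MvPolynomial.IsWeightedHomogeneous q f (l - k))
    (x : Ext (C.twist l) Y s),
    (φ k ((Ext.mk₀ (mulHom C f k l hf)).comp x (zero_add s)) : M.carrier) = f • (φ l x).1

instance (e : Fin n → ℕ) (k : ℤ) : Projective (K q e ∅ k) :=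
  Projective.of_iso (KEmptyIso e k) inferInstance

/-- Maps out of a free module compute the module. -/
theorem exists_extModel_empty (e : Fin n → ℕ) {Y M : GrMod q} {j : ℤ} (α : Y ≅ M.twist j) :
    Nonempty (ExtModel Y (quotPows q e ∅) M j 0) := by
  let h1 : ∀ k, (K q e ∅ k ⟶ Y) ≃+ (S q k ⟶ M.twist j) := fun k =>
    AddEquiv.mk' (((KEmptyIso e k).symm.homFromEquiv).trans α.homToEquiv) (fun f g => by
      simp [Iso.homFromEquiv, Iso.homToEquiv])
  let φ : ∀ k, Ext (K q e ∅ k) Y 0 ≃+ M.gr (j - k) := fun k =>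
    (Ext.addEquiv₀.trans (h1 k)).trans ((homS (M.twist j) k).trans
      (AddEquiv.addSubgroupCongr (by rw [sub_eq_add_neg]; rfl)))
  have hφ : ∀ k (g : K q e ∅ k ⟶ Y), (φ k (Ext.mk₀ g) : M.carrier) =
      α.hom.lin (g.lin ((powIdeal e ∅).mkQ 1)) := fun k g => by
    have : Ext.addEquiv₀ (Ext.mk₀ g) = g := by
      rw [← AddEquiv.eq_symm_apply]; rfl
    change ((homS (M.twist j) k) (h1 k (Ext.addEquiv₀ (Ext.mk₀ g)))).1 = _
    rw [this]
    rfl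
  refine ⟨⟨φ, fun k i hi x => ?_, fun k l f hf x => ?_⟩⟩
  · obtain ⟨i, rfl⟩ := Nat.exists_eq_succ_of_ne_zero hi
    have := Ext.subsingleton_of_projective (K q e ∅ k) Y i
    exact Subsingleton.elim (α := Ext (K q e ∅ k) Y (i + 1)) _ _
  · obtain ⟨g, rfl⟩ := (Ext.mk₀_bijective _ _).2 x
    rw [Ext.mk₀_comp_mk₀]
    refine (hφ k _).trans (Eq.trans ?_ (congrArg (f • ·) (hφ l g)).symm)
    have h2 : (mulHom (quotPows q e ∅) f k l hf).lin ((powIdeal e ∅).mkQ 1) =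
        f • ((powIdeal e ∅).mkQ 1 : (quotPows q e ∅).carrier) := rfl
    change α.hom.lin (g.lin ((mulHom (quotPows q e ∅) f k l hf).lin ((powIdeal e ∅).mkQ 1))) = _
    rw [h2]
    exact (congrArg α.hom.lin (map_smul g.lin f _)).trans (map_smul α.hom.lin f _)

/-- One more variable: dividing `C` and `M` by the same non-zero-divisor `xᵢ ^ eᵢ`. -/
theorem ExtModel.exists_insert {Y : GrMod q} {e : Fin n → ℕ} {A R : Finset (Fin n)} {c : ℤ} {s : ℕ}
    (D : ExtModel Y (quotPows q e A) (quotPows q e R) c s) (i : Fin n) (hA : i ∉ A) (hR : i ∉ R) :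
    Nonempty (ExtModel Y (quotPows q e (insert i A)) (quotPows q e (insert i R))
      (c + e i * q i) (s + 1)) := by
  have hX := fun k => isWeightedHomogeneous_X_pow (q := q) i (e i) k
  -- multiplication by `xᵢ ^ eᵢ` is injective on `Extˢ`
  have hinj : ∀ k (z : Ext (K q e A k) Y s),
      (Ext.mk₀ (mulHom (quotPows q e A) (MvPolynomial.X i ^ e i) _ k (hX k))).comp z
        (zero_add s) = 0 → z = 0 := by
    intro k z hz
    have h1 := D.compat _ k _ (hX k) z
    rw [hz, map_zero] at h1
    rw [← (D.φ k).map_eq_zero_iff, Subtype.ext_iff]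
    obtain ⟨m, hm⟩ := (powIdeal e R).mkQ_surjective (D.φ k z).1
    rw [← hm] at h1 ⊢
    have h2 : MvPolynomial.X i ^ e i * m ∈ powIdeal e R :=
      (Submodule.Quotient.mk_eq_zero (powIdeal e R)).1 h1.symm
    exact (Submodule.Quotient.mk_eq_zero (powIdeal e R)).2 ((mul_mem_powIdeal_iff hR _ _).1 h2)
  choose w hS using fun k => K_shortExact (q := q) e A i hA k
  have hvan : ∀ (k : ℤ) (j : ℕ), j ≠ s + 1 → ∀ x : Ext (K q e (insert i A) k) Y j, x = 0 := by
    intro k j hj x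
    have h1 : (Ext.mk₀ (ShortComplex.mk _ _ (w k)).g).comp x (zero_add j) = 0 := by
      by_cases hjs : j = s
      · subst hjs
        apply hinj k
        have := Ext.mk₀_comp_mk₀_assoc (ShortComplex.mk _ _ (w k)).f
          (ShortComplex.mk _ _ (w k)).g x
        refine this.trans ?_
        rw [(ShortComplex.mk _ _ (w k)).zero, Ext.mk₀_zero, Ext.zero_comp]
      · exact D.vanish k j hjs _
    cases j with
    | zero =>
      have := (hS k).epi_g
      exact Ext.precomp_mk₀_injective_of_epi Y (ShortComplex.mk _ _ (w k)).g
        (h1.trans (Ext.comp_zero _ _ _ _ (zero_add 0)).symm)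
    | succ j =>
      obtain ⟨y, rfl⟩ := Ext.contravariant_sequence_exact₃ (hS k) Y x h1 (add_comm 1 j)
      have : y = 0 := D.vanish _ j (by omega) y
      rw [this, Ext.comp_zero]
  let δ : ∀ k, Ext (K q e A (k - e i * q i)) Y s →+ Ext (K q e (insert i A) k) Y (s + 1) :=
    fun k => AddMonoidHom.mk' (fun y => (hS k).extClass.comp y (add_comm 1 s))
      (fun y y' => Ext.comp_add _ _ _ _)
  have hδ : ∀ k, Function.Surjective (δ k) := fun k x => by
    obtain ⟨y, hy⟩ := Ext.contravariant_sequence_exact₃ (hS k) Y x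
      (D.vanish k (s + 1) (by omega) _) (add_comm 1 s)
    exact ⟨y, hy⟩
  let ψ : ∀ k, Ext (K q e A (k - e i * q i)) Y s →+
      (quotPows q e (insert i R)).gr (c + e i * q i - k) := fun k =>
    AddMonoidHom.mk' (fun y => ⟨(quotPowsMap q (A' := insert i R) (e' := e)
        (fun _ h => ⟨Finset.mem_insert_of_mem h, le_rfl⟩)).lin (D.φ _ y).1,
        (quotPowsMap q _).map_mem _ _ (by
          rw [show c + e i * q i - k = c - (k - e i * q i) by ring]; exact (D.φ _ y).2)⟩)
      (fun y y' => Subtype.ext (by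
        rw [map_add]; exact map_add (quotPowsMap q _).lin (D.φ _ y).1 (D.φ _ y').1))
  obtain ⟨w', hR'⟩ := K_shortExact (q := q) e R i hR 0
  have hψ : ∀ k, Function.Surjective (ψ k) := by
    rintro k ⟨_, m, hm, rfl⟩
    refine ⟨(D.φ _).symm ⟨(powIdeal e R).mkQ m, m, ?_, rfl⟩, Subtype.ext ?_⟩
    · rwa [show c - (k - e i * q i) = c + e i * q i - k by ring]
    · change (quotPowsMap q _).lin (D.φ _ ((D.φ _).symm _)).1 = _
      rw [AddEquiv.apply_symm_apply]
      rfl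
  have hker : ∀ k y, δ k y = 0 ↔ ψ k y = 0 := by
    intro k y
    constructor
    · intro h
      obtain ⟨z, rfl⟩ := Ext.contravariant_sequence_exact₁ (hS k) Y y (add_comm 1 s) h
      refine Subtype.ext ?_
      change (quotPowsMap q _).lin (D.φ _ _).1 = 0
      rw [D.compat _ k _ (hX k) z]
      obtain ⟨m, hm⟩ := (powIdeal e R).mkQ_surjective (D.φ k z).1
      rw [← hm]
      refine (Submodule.Quotient.mk_eq_zero (powIdeal e (insert i R))).2 ?_
      exact Ideal.mul_mem_right _ _ (Ideal.subset_span ⟨i, by simp, rfl⟩)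
    · intro h
      have h' : (quotPowsMap q (A' := insert i R) (e' := e)
        (fun _ h => ⟨Finset.mem_insert_of_mem h, le_rfl⟩)).lin (D.φ _ y).1 = 0 :=
        congrArg Subtype.val h
      obtain ⟨m, hm⟩ := exact_apply hR' (D.φ _ y).1 h'
      -- the preimage is homogeneous because multiplication by `xᵢ ^ eᵢ` is injective
      have hmem : m ∈ (quotPows q e R).gr (c - k) := by
        have := hR'.mono_f
        have h3 := mem_gr_of_injective _ (injective_of_mono (ShortComplex.mk _ _ w').f)
          (c - (k - e i * q i)) m (by
            rw [hm]
            change _ ∈ (quotPows q e R).gr _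
            rw [zero_add]
            exact (D.φ _ y).2)
        change m ∈ (quotPows q e R).gr _ at h3
        rwa [show 0 - (e i : ℤ) * q i + (c - (k - e i * q i)) = c - k by ring] at h3
      have hy : y = (Ext.mk₀ (mulHom (quotPows q e A) (MvPolynomial.X i ^ e i) _ k (hX k))).comp
          ((D.φ k).symm ⟨m, hmem⟩) (zero_add s) := by
        apply (D.φ _).injective
        refine Subtype.ext ?_
        rw [D.compat _ k _ (hX k), AddEquiv.apply_symm_apply]
        exact hm.symm
      rw [hy]
      exact (hS k).extClass_comp_assoc _ (h := add_comm 1 s)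
  choose φ hφ using fun k => exists_addEquiv_of_ker_eq (δ k) (ψ k) (hδ k) (hψ k) (hker k)
  refine ⟨⟨φ, hvan, fun k l f hf x => ?_⟩⟩
  obtain ⟨y, rfl⟩ := hδ l x
  have hf' : MvPolynomial.IsWeightedHomogeneous q f (l - e i * q i - (k - e i * q i)) := by
    rwa [sub_sub_sub_cancel_right]
  let τ : ShortComplex.mk _ _ (w k) ⟶ ShortComplex.mk _ _ (w l) :=
    { τ₁ := mulHom (quotPows q e A) f _ _ hf'
      τ₂ := mulHom (quotPows q e A) f _ _ hf
      τ₃ := mulHom (quotPows q e (insert i A)) f _ _ hf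
      comm₁₂ := by
        ext m
        exact smul_comm ((MvPolynomial.X i : PolyRing n) ^ e i) f (m : (quotPows q e A).carrier)
      comm₂₃ := mulHom_naturality _ _ _ _ _ }
  have h1 : (Ext.mk₀ (mulHom (quotPows q e (insert i A)) f k l hf)).comp (δ l y)
      (zero_add (s + 1)) =
      δ k ((Ext.mk₀ (mulHom (quotPows q e A) f _ _ hf')).comp y (zero_add s)) := by
    have h2 := ShortComplex.ShortExact.extClass_naturality (hS k) (hS l) τ
    change (Ext.mk₀ τ.τ₃).comp ((hS l).extClass.comp y (add_comm 1 s)) (zero_add (s + 1)) =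
      (hS k).extClass.comp ((Ext.mk₀ τ.τ₁).comp y (zero_add s)) (add_comm 1 s)
    rw [← Ext.comp_assoc _ _ _ (zero_add 1) (add_comm 1 s) (by omega),
      ← Ext.comp_assoc _ _ _ (add_zero 1) (zero_add s) (by omega), h2]
  refine (congrArg (fun z => (φ k z : (quotPows q e (insert i R)).carrier)) h1).trans ?_
  rw [hφ, hφ]
  change (quotPowsMap q _).lin (D.φ _ _).1 = f • (quotPowsMap q _).lin (D.φ _ y).1
  rw [D.compat _ _ f hf' y]
  exact map_smul (quotPowsMap q _).lin f _

/-- `RHom(S/(xᵢ ^ eᵢ : i ∈ A), S/(xᵢ ^ eᵢ : i ∈ R))` for disjoint `A` and `R`: the Koszul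
computation, with a single nonzero cohomology module. -/
theorem exists_extModel (e : Fin n → ℕ) (A R : Finset (Fin n)) (hAR : Disjoint A R) {Y : GrMod q}
    {j : ℤ} (α : Y ≅ K q e R j) : Nonempty (ExtModel Y (quotPows q e A) (quotPows q e (A ∪ R))
      (j + ∑ i ∈ A, e i * q i) A.card) := by
  classical
  induction A using Finset.induction_on with
  | empty =>
    rw [Finset.empty_union, Finset.sum_empty, add_zero, Finset.card_empty]
    exact exists_extModel_empty e α
  | insert i A hi ih =>
    rw [Finset.disjoint_insert_left] at hAR
    obtain ⟨D⟩ := ih hAR.2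
    rw [Finset.insert_union, Finset.card_insert_of_notMem hi, Finset.sum_insert hi,
      add_comm (e i * q i : ℤ), ← add_assoc]
    exact D.exists_insert i hi (by simp [hi, hAR.1])

/-- The vanishing criterion for all `Ext` groups. -/
theorem ext_K_eq_zero (e : Fin n → ℕ) (A R : Finset (Fin n)) (hAR : Disjoint A R) {Y : GrMod q}
    {j : ℤ} (α : Y ≅ K q e R j) (k : ℤ)
    (h : ∀ b : Fin n →₀ ℕ, Finsupp.weight q b = j + ∑ i ∈ A, e i * q i - k →
      ∃ i ∈ A ∪ R, e i ≤ b i) (i : ℕ) (x : Ext (K q e A k) Y i) : x = 0 := by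
  obtain ⟨D⟩ := exists_extModel e A R hAR α
  by_cases hi : i = A.card
  · subst hi
    rw [← (D.φ k).map_eq_zero_iff, Subtype.ext_iff]
    exact (K_gr_eq_zero_iff e _ _).2 h _ (D.φ k x).2
  · exact D.vanish k i hi x

theorem ext_K_eq_zero_of_ne (e : Fin n → ℕ) (A R : Finset (Fin n)) (hAR : Disjoint A R)
    {Y : GrMod q} {j : ℤ} (α : Y ≅ K q e R j) (k : ℤ) (i : ℕ) (hi : i ≠ A.card)
    (x : Ext (K q e A k) Y i) : x = 0 := by
  obtain ⟨D⟩ := exists_extModel e A R hAR α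
  exact D.vanish k i hi x

theorem exists_ext_K_ne_zero (e : Fin n → ℕ) (A R : Finset (Fin n)) (hAR : Disjoint A R)
    {Y : GrMod q} {j : ℤ} (α : Y ≅ K q e R j) (k : ℤ) (b : Fin n →₀ ℕ)
    (hb : Finsupp.weight q b = j + ∑ i ∈ A, e i * q i - k) (hlt : ∀ i ∈ A ∪ R, b i < e i) :
    ∃ x : Ext (K q e A k) Y A.card, x ≠ 0 := by
  obtain ⟨D⟩ := exists_extModel e A R hAR α
  by_contra! hx
  obtain ⟨i, hi, hle⟩ := (K_gr_eq_zero_iff (q := q) e (A ∪ R) _).1 (fun y hy => by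
    have h0 := hx ((D.φ k).symm ⟨y, hy⟩)
    rw [(D.φ k).symm.map_eq_zero_iff] at h0
    exact congrArg Subtype.val h0) b hb
  exact absurd (hlt i hi) (not_lt.2 hle)

end GrMod

namespace GrMod

open Abelian

variable {n : ℕ} {q : Fin n → ℤ}

/-! ### Cyclic dévissage -/

/-- The homogeneous parts of a finite generating set form a finite homogeneous generating set. -/
theorem exists_homogeneous_generators (M : GrMod q) : ∃ s : Finset M.carrier,
    (∀ x ∈ s, ∃ k, x ∈ M.gr k) ∧ Submodule.span (PolyRing n) (s : Set M.carrier) = ⊤ := by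
  classical
  obtain ⟨s, hs⟩ := M.finite.fg_top
  choose t ht using M.exists_sum_proj
  refine ⟨s.biUnion fun x => (t x).image fun k => M.proj k x, fun x hx => ?_, ?_⟩
  · simp only [Finset.mem_biUnion, Finset.mem_image] at hx
    obtain ⟨y, -, k, -, rfl⟩ := hx
    exact ⟨k, M.proj_mem k y⟩
  · rw [eq_top_iff, ← hs, Submodule.span_le]
    intro x hx
    rw [ht x (t x) (Finset.Subset.refl _)]
    refine Submodule.sum_mem _ fun k hk => Submodule.subset_span ?_
    simp only [Finset.coe_biUnion, Set.mem_iUnion, Finset.coe_image]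
    exact ⟨x, hx, k, hk, rfl⟩

/-- The cokernel sequence of an injection. -/
theorem shortExact_coker {M N : GrMod q} (f : M ⟶ N) (hf : Function.Injective f.lin) :
    (ShortComplex.mk f (cokerπ f) (comp_cokerπ f)).ShortExact :=
  shortExact_of _ _ _ hf (LinearMap.range f.lin).mkQ_surjective
    fun _ hb => (Submodule.Quotient.mk_eq_zero _).1 hb

/-- The kernel sequence of a surjection. -/
theorem shortExact_ker {M N : GrMod q} (f : M ⟶ N) (hf : Function.Surjective f.lin) :
    (ShortComplex.mk (kerι f) f (kerι_comp f)).ShortExact :=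
  shortExact_of _ _ _ Subtype.val_injective hf fun b hb => ⟨⟨b, hb⟩, rfl⟩

/-- A property of finitely generated graded modules which holds for cyclic modules and is stable
under extensions holds for all modules. -/
theorem cyclic_induction (P : GrMod q → Prop)
    (hcyc : ∀ (M : GrMod q) (k : ℤ) (f : S q k ⟶ M), Function.Surjective f.lin → P M)
    (hext : ∀ X : ShortComplex (GrMod q), X.ShortExact → P X.X₁ → P X.X₃ → P X.X₂)
    (M : GrMod q) : P M := by
  classical
  have key : ∀ (r : ℕ) (M : GrMod q) (s : Finset M.carrier), s.card ≤ r →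
      (∀ x ∈ s, ∃ k, x ∈ M.gr k) →
      Submodule.span (PolyRing n) (s : Set M.carrier) = ⊤ → P M := by
    intro r
    induction r with
    | zero =>
      intro M s hs _ htop
      rw [Nat.le_zero, Finset.card_eq_zero] at hs
      subst hs
      rw [Finset.coe_empty, Submodule.span_empty] at htop
      refine hcyc M 0 0 fun x => ⟨0, ?_⟩
      have : x ∈ (⊥ : Submodule (PolyRing n) M.carrier) := htop ▸ Submodule.mem_top
      rw [(Submodule.mem_bot _).1 this]
      rfl
    | succ r ih =>
      intro M s hs hhom htop
      by_cases hr : s.card ≤ r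
      · exact ih M s hr hhom htop
      obtain ⟨x, hx⟩ : s.Nonempty := Finset.card_pos.1 (by omega)
      obtain ⟨k, hk⟩ := hhom x hx
      let f : S q (-k) ⟶ M := ofMem M (-k) x (by rwa [neg_neg])
      let N := sub M (LinearMap.range f.lin) (range_homogeneous f)
      let ι : N ⟶ M := ⟨(LinearMap.range f.lin).subtype, fun _ _ h => h⟩
      refine hext _ (shortExact_coker ι Subtype.val_injective)
        (hcyc N (-k) ⟨f.lin.rangeRestrict, fun j m hm => f.map_mem j m hm⟩
          f.lin.surjective_rangeRestrict) ?_
      refine ih _ ((s.erase x).image (cokerπ ι).lin) ?_ ?_ ?_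
      · refine Finset.card_image_le.trans ?_
        rw [Finset.card_erase_of_mem hx]
        omega
      · intro y hy
        simp only [Finset.mem_image, Finset.mem_erase] at hy
        obtain ⟨z, ⟨-, hz⟩, rfl⟩ := hy
        obtain ⟨j, hj⟩ := hhom z hz
        exact ⟨j, (cokerπ ι).map_mem j z hj⟩
      · have hsurj : Function.Surjective (cokerπ ι).lin :=
          (LinearMap.range ι.lin).mkQ_surjective
        refine eq_top_iff.2 fun y _ => ?_
        obtain ⟨y, rfl⟩ := hsurj y
        have hy : (cokerπ ι).lin y ∈ (Submodule.span (PolyRing n) (s : Set M.carrier)).map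
            (cokerπ ι).lin := ⟨y, htop ▸ Submodule.mem_top, rfl⟩
        rw [Submodule.map_span] at hy
        refine Submodule.span_le.2 ?_ hy
        rintro _ ⟨z, hz, rfl⟩
        by_cases hzx : z = x
        · subst hzx
          have h0 : (cokerπ ι).lin z = 0 := by
            refine (Submodule.Quotient.mk_eq_zero _).2 ⟨⟨z, ?_⟩, rfl⟩
            exact ⟨(1 : PolyRing n), one_smul (PolyRing n) z⟩
          rw [h0]
          exact Submodule.zero_mem _
        · refine Submodule.subset_span ?_
          simp only [Finset.coe_image, Finset.coe_erase]
          exact ⟨z, ⟨hz, hzx⟩, rfl⟩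
  obtain ⟨s, h1, h2⟩ := M.exists_homogeneous_generators
  exact key s.card M s le_rfl h1 h2

/-! ### The grade of torsion modules -/

/-- `M` is annihilated by the ideal `I`. -/
def Killed (I : Ideal (PolyRing n)) (M : GrMod q) : Prop := ∀ s ∈ I, ∀ x : M.carrier, s • x = 0

theorem Killed.of_injective {I : Ideal (PolyRing n)} {M N : GrMod q} (h : Killed I N)
    (f : M ⟶ N) (hf : Function.Injective f.lin) : Killed I M := fun s hs x =>
  hf (by rw [map_smul, h s hs, map_zero])

theorem Killed.of_surjective {I : Ideal (PolyRing n)} {M N : GrMod q} (h : Killed I M)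
    (f : M ⟶ N) (hf : Function.Surjective f.lin) : Killed I N := fun s hs y => by
  obtain ⟨x, rfl⟩ := hf y
  rw [← map_smul, h s hs, map_zero]

theorem killed_K (e : Fin n → ℕ) (A : Finset (Fin n)) (k : ℤ) :
    Killed (powIdeal e A) (K q e A k) := by
  intro s hs x
  obtain ⟨x, rfl⟩ := (powIdeal e A).mkQ_surjective x
  exact (Submodule.Quotient.mk_eq_zero (powIdeal e A)).2 (Ideal.mul_mem_right x _ hs)

/-- A cyclic module killed by powers of the variables is a quotient of `K`. -/
theorem exists_surjective_K {e : Fin n → ℕ} {A : Finset (Fin n)} {M : GrMod q} {k : ℤ}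
    (f : S q k ⟶ M) (hf : Function.Surjective f.lin) (h : Killed (powIdeal e A) M) :
    ∃ g : K q e A k ⟶ M, Function.Surjective g.lin := by
  have hk : powIdeal e A ≤ LinearMap.ker f.lin := fun s hs => by
    change f.lin s = 0
    have h1 : f.lin s = s • f.lin (1 : PolyRing n) :=
      (congrArg f.lin (mul_one s).symm).trans (map_smul f.lin s (1 : PolyRing n))
    rw [h1, h s hs]
  refine ⟨⟨(powIdeal e A).liftQ f.lin hk, ?_⟩, fun y => ?_⟩
  · rintro j _ ⟨s, hs, rfl⟩
    exact f.map_mem j s hs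
  · obtain ⟨x, rfl⟩ := hf y
    exact ⟨(powIdeal e A).mkQ x, rfl⟩

/-- Modules killed by powers of the `xᵢ`, `i ∈ A`, have grade at least `|A|`. -/
theorem ext_eq_zero_of_killed (e : Fin n → ℕ) (A : Finset (Fin n)) (j : ℤ) (i : ℕ)
    (hi : i < A.card) (M : GrMod q) (hM : Killed (powIdeal e A) M) :
    ∀ x : Ext M (S q j) i, x = 0 := by
  induction i using Nat.strong_induction_on generalizing M with
  | _ i ih =>
  have hK : ∀ (k : ℤ) (x : Ext (K q e A k) (S q j) i), x = 0 := fun k x =>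
    ext_K_eq_zero_of_ne e A ∅ (Finset.disjoint_empty_right A) (KEmptyIso e j) k i (by omega) x
  refine cyclic_induction (fun M => Killed (powIdeal e A) M → ∀ x : Ext M (S q j) i, x = 0)
    ?_ ?_ M hM
  · intro M k f hf hM x
    obtain ⟨g, hg⟩ := exists_surjective_K f hf hM
    have hS := shortExact_ker g hg
    have h0 : (Ext.mk₀ g).comp x (zero_add i) = 0 := hK k _
    cases i with
    | zero =>
      have := epi_of_surjective g hg
      exact Ext.precomp_mk₀_injective_of_epi _ g (h0.trans (Ext.comp_zero _ _ _ _ (zero_add 0)).symm)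
    | succ i =>
      obtain ⟨y, rfl⟩ := Ext.contravariant_sequence_exact₃ hS _ x h0 (add_comm 1 i)
      have : y = 0 := ih i (by omega) (by omega) _
        ((killed_K e A k).of_injective (kerι g) Subtype.val_injective) y
      rw [this, Ext.comp_zero]
  · intro X hX h1 h3 h2 x
    have := hX.mono_f
    have := hX.epi_g
    have hx : (Ext.mk₀ X.f).comp x (zero_add i) = 0 :=
      h1 (h2.of_injective _ (injective_of_mono X.f)) _
    obtain ⟨y, rfl⟩ := Ext.contravariant_sequence_exact₂ hX _ x hx
    rw [h3 (h2.of_surjective _ (surjective_of_epi X.g)) y, Ext.comp_zero]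

/-- In degree `|A|`, pulling back along a surjection of such modules is injective. -/
theorem ext_precomp_injective (e : Fin n → ℕ) (A : Finset (Fin n)) (hA : A.Nonempty) (j : ℤ)
    {M N : GrMod q} (hM : Killed (powIdeal e A) M) (g : M ⟶ N) (hg : Function.Surjective g.lin)
    (x : Ext N (S q j) A.card) (hx : (Ext.mk₀ g).comp x (zero_add _) = 0) : x = 0 := by
  obtain ⟨i, hi⟩ : ∃ i, 1 + i = A.card := ⟨A.card - 1, by have := hA.card_pos; omega⟩
  obtain ⟨y, rfl⟩ := Ext.contravariant_sequence_exact₃ (shortExact_ker g hg) _ x hx hi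
  have : y = 0 := ext_eq_zero_of_killed e A j i (by omega) _
    (hM.of_injective (kerι g) Subtype.val_injective) y
  rw [this, Ext.comp_zero]

end GrMod

/-! ### Acyclic degrees -/

section Acyclic

open GrMod Abelian

variable {n : ℕ} {q : Fin n → ℤ} {p : Finset (Fin n)} {Sig : Set (Finset (Fin n))}

/-- A sequential colimit of abelian groups vanishes only if every element dies at a later stage. -/
theorem exists_map_eq_zero_of_isZero_colimit (F : ℕ ⥤ AddCommGrpCat.{1})
    (h : IsZero (colimit F)) (m : ℕ) (x : F.obj m) :
    ∃ (m' : ℕ) (f : m ⟶ m'), (F.map f).hom x = 0 := by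
  have : PreservesFilteredColimitsOfSize.{0, 0} (forget AddCommGrpCat.{1}) :=
    preservesFilteredColimitsOfSize_shrink.{0, 1, 0, 1} _
  have h1 : (colimit.ι F m).hom x = (colimit.ι F m).hom 0 := by
    rw [h.eq_zero_of_tgt (colimit.ι F m)]
    rfl
  obtain ⟨k, f, g, hfg⟩ := (Concrete.colimit_rep_eq_iff_exists F x 0).1 h1
  refine ⟨k, f, ?_⟩
  have h2 : (F.map f).hom x = (F.map g).hom 0 := hfg
  rw [h2, map_zero]

theorem isZero_colimit_of_map_eq_zero (F : ℕ ⥤ AddCommGrpCat.{1})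
    (h : ∀ m, ∃ (m' : ℕ) (f : m ⟶ m'), F.map f = 0) : IsZero (colimit F) := by
  rw [IsZero.iff_id_eq_zero]
  refine colimit.hom_ext fun m => ?_
  obtain ⟨m', f, hf⟩ := h m
  rw [← colimit.w F f, hf, zero_comp, zero_comp, zero_comp]

theorem powIdeal_le_pow (hB : coxIdeal Sig = Ideal.span (MvPolynomial.X '' (p : Set (Fin n))))
    (m : ℕ) : powIdeal (fun _ => m) p ≤ coxIdeal Sig ^ m := by
  refine Ideal.span_le.2 ?_
  rintro _ ⟨i, hi, rfl⟩
  refine Ideal.pow_mem_pow ?_ m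
  rw [hB]
  exact Ideal.subset_span ⟨i, hi, rfl⟩

theorem exists_pow_le_powIdeal
    (hB : coxIdeal Sig = Ideal.span (MvPolynomial.X '' (p : Set (Fin n)))) (e : Fin n → ℕ) :
    ∃ m, coxIdeal Sig ^ m ≤ powIdeal e p := by
  refine Ideal.exists_pow_le_of_le_radical_of_fg ?_ (IsNoetherian.noetherian _)
  rw [hB]
  refine Ideal.span_le.2 ?_
  rintro _ ⟨i, hi, rfl⟩
  exact ⟨e i, Ideal.subset_span ⟨i, hi, rfl⟩⟩

theorem killed_quotPow (m : ℕ) : Killed (coxIdeal Sig ^ m) (quotPow q Sig m) := by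
  intro s hs x
  obtain ⟨x, rfl⟩ := (coxIdeal Sig ^ m).mkQ_surjective x
  exact (Submodule.Quotient.mk_eq_zero (coxIdeal Sig ^ m)).2 (Ideal.mul_mem_right x _ hs)

/-- `δ` is acyclic exactly when no Laurent monomial with negative exponents on `p` and nonnegative
exponents off `p` has degree `δ`: the powers of the Cox ideal are cofinal with the ideals
`(xᵢ ^ eᵢ : i ∈ p)`, and `Ext` of the quotients by the latter is known. -/
theorem isAcyclic_iff (hB : coxIdeal Sig = Ideal.span (MvPolynomial.X '' (p : Set (Fin n))))
    (hp : p.Nonempty) (δ : ℤ) : IsAcyclic q Sig δ ↔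
      ∀ b : Fin n → ℕ, δ ≠ ∑ i ∈ pᶜ, b i * q i - ∑ i ∈ p, (b i + 1) * q i := by
  classical
  have hweight : ∀ b : Fin n →₀ ℕ, Finsupp.weight q b = ∑ i ∈ pᶜ, b i * q i + ∑ i ∈ p, b i * q i :=
    fun b => by
      rw [Finsupp.weight_apply, Finsupp.sum_fintype _ _ (by simp), Finset.sum_compl_add_sum]
      exact Finset.sum_congr rfl fun i _ => nsmul_eq_mul _ _
  -- the projections `S/B^m' → S/(xᵢ^m) → S/B^m`
  let α : ∀ (e : Fin n → ℕ) (m : ℕ), coxIdeal Sig ^ m ≤ powIdeal e p →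
      (quotPow q Sig m ⟶ K q e p 0) := fun e m h => ⟨Submodule.factor h, by
    rintro k _ ⟨s, hs, rfl⟩
    refine ⟨s, ?_, rfl⟩
    rw [zero_add]
    exact hs⟩
  constructor
  · rintro h b rfl
    -- the Laurent monomial gives a nonzero class in `Ext` of `S/(xᵢ ^ (bᵢ + 1))`
    let e : Fin n → ℕ := fun i => b i + 1
    obtain ⟨x, hx⟩ := exists_ext_K_ne_zero (q := q) e p ∅ (Finset.disjoint_empty_right p)
      (KEmptyIso e (∑ i ∈ pᶜ, b i * q i - ∑ i ∈ p, (b i + 1) * q i)) 0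
      (Finsupp.equivFunOnFinite.symm fun i => if i ∈ p then 0 else b i) (by
        rw [hweight]
        have h1 : ∑ i ∈ p, (((Finsupp.equivFunOnFinite.symm fun i => if i ∈ p then 0 else b i)
            i : ℕ) : ℤ) * q i = 0 := Finset.sum_eq_zero fun i hi => by simp [hi]
        have h2 : ∑ i ∈ pᶜ, (((Finsupp.equivFunOnFinite.symm fun i => if i ∈ p then 0 else b i)
            i : ℕ) : ℤ) * q i = ∑ i ∈ pᶜ, b i * q i := Finset.sum_congr rfl fun i hi => by
          simp [Finset.mem_compl.1 hi]
        rw [h1, h2]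
        simp [e]) (by
        intro i hi
        rw [Finset.union_empty] at hi
        simp [hi, e])
    obtain ⟨m, hm⟩ := exists_pow_le_powIdeal hB e
    obtain ⟨m', f, hf⟩ := exists_map_eq_zero_of_isZero_colimit _ (h p.card) m
      ((Ext.mk₀ (α e m hm)).comp x (zero_add _))
    let π : quotPow q Sig m' ⟶ quotPow q Sig m := (quotPowSystem q Sig).map f.op
    have hπ : (Ext.mk₀ (π ≫ α e m hm)).comp x (zero_add _) = 0 := by
      rw [← Ext.mk₀_comp_mk₀_assoc]
      exact hf
    refine hx (ext_precomp_injective (fun _ => m') p hp _ (fun s hs => killed_quotPow m' s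
      (powIdeal_le_pow hB m' hs)) (π ≫ α e m hm) ?_ x hπ)
    intro y
    obtain ⟨y, rfl⟩ := (powIdeal e p).mkQ_surjective y
    exact ⟨(coxIdeal Sig ^ m').mkQ y, rfl⟩
  · intro h i
    refine isZero_colimit_of_map_eq_zero _ fun m => ?_
    obtain ⟨m₀, hm₀⟩ := exists_pow_le_powIdeal hB (fun _ => m)
    have hle : coxIdeal Sig ^ max m m₀ ≤ powIdeal (fun _ => m) p :=
      (Ideal.pow_le_pow_right (le_max_right _ _)).trans hm₀
    let β : K q (fun _ => m) p 0 ⟶ quotPow q Sig m :=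
      ⟨Submodule.factor (powIdeal_le_pow hB m), by
        rintro k _ ⟨s, hs, rfl⟩
        refine ⟨s, ?_, rfl⟩
        rw [zero_add] at hs
        exact hs⟩
    let f : m ⟶ max m m₀ := homOfLE (le_max_left _ _)
    refine ⟨max m m₀, f, ?_⟩
    ext x
    have hfac : (quotPowSystem q Sig).map f.op = α _ _ hle ≫ β := by
      ext s
      obtain ⟨s, rfl⟩ := Submodule.mkQ_surjective _ s
      rfl
    change (Ext.mk₀ ((quotPowSystem q Sig).map f.op)).comp x (zero_add i) = 0
    let x' : Ext (quotPow q Sig m) (S q δ) i := x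
    have h0 : (Ext.mk₀ β).comp x' (zero_add i) = 0 :=
      ext_K_eq_zero _ p ∅ (Finset.disjoint_empty_right p) (KEmptyIso _ δ) 0 (by
        intro b hb
        by_contra! hlt
        rw [Finset.union_empty] at hlt
        refine h (fun i => if i ∈ p then m - 1 - b i else b i) ?_
        have h1 : ∑ i ∈ p, (((if i ∈ p then m - 1 - b i else b i : ℕ) : ℤ) + 1) * q i
            = ∑ i ∈ p, (m : ℤ) * q i - ∑ i ∈ p, b i * q i := by
          rw [← Finset.sum_sub_distrib]
          refine Finset.sum_congr rfl fun i hi => ?_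
          have := hlt i hi
          rw [if_pos hi, Nat.cast_sub (by omega), Nat.cast_sub (by omega)]
          push_cast
          ring
        have h2 : ∑ i ∈ pᶜ, ((if i ∈ p then m - 1 - b i else b i : ℕ) : ℤ) * q i
            = ∑ i ∈ pᶜ, b i * q i := Finset.sum_congr rfl fun i hi => by
          rw [if_neg (Finset.mem_compl.1 hi)]
        rw [h1, h2]
        rw [hweight] at hb
        linarith) i _
    have h1 : (Ext.mk₀ (α _ _ hle ≫ β)).comp x' (zero_add i) = 0 := by
      rw [← Ext.mk₀_comp_mk₀_assoc, h0, Ext.comp_zero]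
    rw [hfac]
    exact h1

end Acyclic

/-! ### Acyclic degrees in corank one -/

section Side

variable {n : ℕ} {v : Fin n → ℤ} {p : Finset (Fin n)} {ε : ℤ} {N : ℕ}

variable (v p ε N) in
/-- `p` is the positive (`ε = 1`) or the negative (`ε = -1`) support of a primitive vector `v`, and
the entries of `v` on `p` have absolute values with sum `N`. Both phases are treated at once in
terms of this structure; primitivity is recorded by a Bézout relation. -/
structure IsSide : Prop where
  unit : ε = 1 ∨ ε = -1
  mem : ∀ i, i ∈ p ↔ 0 < ε * v i
  sum_mem : ∑ i ∈ p, ε * v i = N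
  nonempty : p.Nonempty
  primitive : ∃ c : Fin n → ℤ, ∑ i, c i * v i = 1

theorem IsSide.abs_eq (h : IsSide v p ε N) (i : Fin n) :
    |v i| = if i ∈ p then ε * v i else -(ε * v i) := by
  have h1 : |v i| = |ε * v i| := by
    rcases h.unit with rfl | rfl <;> simp
  rw [h1]
  split_ifs with hi
  · exact abs_of_pos ((h.mem i).1 hi)
  · exact abs_of_nonpos (not_lt.1 fun hc => hi ((h.mem i).2 hc))

theorem IsSide.mul_self (h : IsSide v p ε N) : ε * ε = 1 := by
  rcases h.unit with rfl | rfl <;> rfl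

theorem IsSide.abs_mul (h : IsSide v p ε N) (x : ℤ) : |ε * x| = |x| := by
  rcases h.unit with rfl | rfl <;> simp

/-- Since the signs of the `vᵢ` on and off `p` are opposite, acyclicity is a matter of the numerical
semigroup generated by the `|vᵢ|`. -/
theorem IsSide.isAcyclic_iff (h : IsSide v p ε N) (δ : ℤ) :
    IsAcyclic v (complexOfNonface p) δ ↔ ∀ b : Fin n → ℕ, -(ε * δ) - N ≠ ∑ i, b i * |v i| := by
  classical
  rw [ToricPhases.isAcyclic_iff (coxIdeal_complexOfNonface p) h.nonempty δ]
  refine forall_congr' fun b => not_congr ?_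
  have h1 : ∑ i, (b i : ℤ) * |v i| = -(ε * (∑ i ∈ pᶜ, b i * v i - ∑ i ∈ p, (b i + 1) * v i)) - N := by
    rw [← h.sum_mem, ← Finset.sum_compl_add_sum p, mul_sub, Finset.mul_sum, Finset.mul_sum]
    have h2 : ∑ i ∈ pᶜ, (b i : ℤ) * |v i| = -∑ i ∈ pᶜ, ε * (b i * v i) := by
      rw [← Finset.sum_neg_distrib]
      refine Finset.sum_congr rfl fun i hi => ?_
      rw [h.abs_eq, if_neg (Finset.mem_compl.1 hi)]
      ring
    have h3 : ∑ i ∈ p, (b i : ℤ) * |v i| =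
        ∑ i ∈ p, ε * ((b i + 1) * v i) - ∑ i ∈ p, ε * v i := by
      rw [← Finset.sum_sub_distrib]
      refine Finset.sum_congr rfl fun i hi => ?_
      rw [h.abs_eq, if_pos hi]
      ring
    rw [h2, h3]
    ring
  rw [h1]
  constructor
  · intro h; rw [h]
  · intro h'
    have h4 : ε * δ = ε * (∑ i ∈ pᶜ, b i * v i - ∑ i ∈ p, (b i + 1) * v i) := by linarith
    exact mul_left_cancel₀ (by rcases h.unit with rfl | rfl <;> decide) h4

theorem IsSide.isAcyclic_of_abs_lt (h : IsSide v p ε N) (δ : ℤ) (hδ : |δ| < N) :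
    IsAcyclic v (complexOfNonface p) δ := by
  rw [h.isAcyclic_iff]
  intro b hb
  have h1 : 0 ≤ ∑ i, (b i : ℤ) * |v i| := Finset.sum_nonneg fun i _ => by positivity
  have h2 := neg_le_abs (ε * δ)
  rw [h.abs_mul] at h2
  omega

theorem IsSide.exists_weight (h : IsSide v p ε N) : ∃ i ∈ p, 0 < |v i| ∧ |v i| ≤ N := by
  obtain ⟨i, hi⟩ := h.nonempty
  have h1 := (h.mem i).1 hi
  refine ⟨i, hi, abs_pos.2 (right_ne_zero_of_mul h1.ne'), ?_⟩
  rw [h.abs_eq, if_pos hi, ← h.sum_mem]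
  exact Finset.single_le_sum (f := fun i => ε * v i) (fun j hj => ((h.mem j).1 hj).le) hi

theorem sum_single_mul {w : Fin n → ℤ} (i : Fin n) (y : ℕ) :
    ∑ j, (Pi.single (M := fun _ => ℕ) i y j : ℤ) * w j = y * w i := by
  rw [Finset.sum_eq_single i]
  · simp
  · intro j _ hj; simp [hj]
  · simp

/-- Among `N` consecutive integers ending in a nonnegative one, some integer lies in the semigroup
generated by the `|v i|`. -/
theorem IsSide.exists_semigroup_mem (h : IsSide v p ε N) (z : ℤ) (hz : 0 ≤ z) :
    ∃ y : ℤ, z - N < y ∧ y ≤ z ∧ ∃ b : Fin n → ℕ, y = ∑ i, b i * |v i| := by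
  obtain ⟨i, -, h1, h2⟩ := h.exists_weight
  refine ⟨z - z % |v i|, by have := Int.emod_lt_of_pos z h1; omega,
    by have := Int.emod_nonneg z h1.ne'; omega, Pi.single i (z / |v i|).toNat, ?_⟩
  rw [sum_single_mul, Int.toNat_of_nonneg (Int.ediv_nonneg hz h1.le)]
  linarith [Int.mul_ediv_add_emod z |v i|, mul_comm |v i| (z / |v i|)]

theorem IsSide.maximal (h : IsSide v p ε N) :
    Maximal (IsAcyclicSet v (complexOfNonface p)) (Set.Ico (0 : ℤ) N) := by
  refine ⟨fun i hi j hj => h.isAcyclic_of_abs_lt _ ?_, fun t ht hle x hx => ?_⟩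
  · rw [Set.mem_Ico] at hi hj
    rw [abs_lt]
    omega
  · by_contra hxN
    have hmem : ∀ i : ℤ, 0 ≤ i → i < N → i ∈ t := fun i h0 h1 => hle ⟨h0, h1⟩
    -- both `x - i` and `i - x` are acyclic, so the sign `ε` plays no role
    have key : ∀ i : ℤ, 0 ≤ i → i < N → ∀ b : Fin n → ℕ, |x - i| - N ≠ ∑ i, b i * |v i| := by
      intro i h0 h1
      have h2 := (h.isAcyclic_iff _).1 (ht x hx i (hmem i h0 h1))
      have h3 := (h.isAcyclic_iff _).1 (ht i (hmem i h0 h1) x hx)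
      rcases h.unit with rfl | rfl <;> rcases abs_choice (x - i) with h4 | h4 <;> rw [h4] <;>
        intro b hb
      · exact h3 b (by rw [← hb]; ring)
      · exact h2 b (by rw [← hb]; ring)
      · exact h2 b (by rw [← hb]; ring)
      · exact h3 b (by rw [← hb]; ring)
    rw [Set.mem_Ico, not_and_or, not_le, not_lt] at hxN
    rcases hxN with hx0 | hx0
    · obtain ⟨y, hy1, hy2, b, hb⟩ := h.exists_semigroup_mem (-x - 1) (by omega)
      refine key (y + N + x) (by omega) (by omega) b ?_
      rw [← hb, abs_of_nonpos (by omega)]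
      omega
    · obtain ⟨y, hy1, hy2, b, hb⟩ := h.exists_semigroup_mem (x - N) (by omega)
      refine key (x - N - y) (by omega) (by omega) b ?_
      rw [← hb, abs_of_nonneg (by omega)]
      omega

/-- The numerical semigroup generated by coprime integers contains all large integers. -/
theorem exists_sum_mul_of_ge {w : Fin n → ℤ} (hw : ∀ i, 0 ≤ w i) {i₀ : Fin n} (hi₀ : 0 < w i₀)
    {c : Fin n → ℤ} (hc : ∑ i, c i * w i = 1) :
    ∃ T : ℤ, ∀ z, T ≤ z → ∃ b : Fin n → ℕ, z = ∑ i, b i * w i := by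
  classical
  refine ⟨w i₀ * ∑ i, w i, fun z hz => ?_⟩
  let r : Fin n → ℤ := fun i => (z * c i) % w i₀
  have hr0 : ∀ i, 0 ≤ r i := fun i => Int.emod_nonneg _ hi₀.ne'
  have hr1 : ∀ i, r i ≤ w i₀ := fun i => (Int.emod_lt_of_pos _ hi₀).le
  have hle : ∑ i, r i * w i ≤ w i₀ * ∑ i, w i := by
    rw [Finset.mul_sum]
    exact Finset.sum_le_sum fun i _ => mul_le_mul_of_nonneg_right (hr1 i) (hw i)
  have hdvd : w i₀ ∣ z - ∑ i, r i * w i := by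
    have h1 : z - ∑ i, r i * w i = ∑ i, (z * c i - r i) * w i := by
      simp only [sub_mul, Finset.sum_sub_distrib, mul_assoc, ← Finset.mul_sum, hc, mul_one]
    rw [h1]
    refine Finset.dvd_sum fun i _ => Dvd.dvd.mul_right ?_ _
    exact Int.dvd_self_sub_emod
  obtain ⟨y, hy⟩ := hdvd
  have hy0 : 0 ≤ y := by
    by_contra hneg
    have : w i₀ * y < 0 := mul_neg_of_pos_of_neg hi₀ (not_le.1 hneg)
    linarith
  refine ⟨fun i => (r i).toNat + Pi.single (M := fun _ => ℕ) i₀ y.toNat i, ?_⟩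
  push_cast
  simp only [add_mul, Finset.sum_add_distrib]
  rw [sum_single_mul, Int.toNat_of_nonneg hy0]
  have h2 : ∑ i, ((r i).toNat : ℤ) * w i = ∑ i, r i * w i :=
    Finset.sum_congr rfl fun i _ => by rw [Int.toNat_of_nonneg (hr0 i)]
  rw [h2]
  linarith

theorem IsSide.finite (h : IsSide v p ε N) :
    {δ : ℤ | IsAcyclic v (complexOfNonface p) δ ∧
      IsAcyclic v (complexOfNonface p) (-δ)}.Finite := by
  obtain ⟨c, hc⟩ := h.primitive
  obtain ⟨i₀, -, h1, -⟩ := h.exists_weight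
  obtain ⟨T, hT⟩ := exists_sum_mul_of_ge (w := fun i => |v i|) (c := fun i => c i * (v i).sign)
    (fun i => abs_nonneg _) h1 (by
      rw [← hc]
      exact Finset.sum_congr rfl fun i _ => by rw [mul_assoc, Int.sign_mul_abs])
  refine (Set.finite_Icc (-(N + T)) (N + T)).subset fun δ hδ => ?_
  obtain ⟨h2, h3⟩ := hδ
  rw [h.isAcyclic_iff] at h2 h3
  rw [Set.mem_Icc, ← abs_le]
  by_contra hlt
  obtain ⟨b, hb⟩ := hT (|δ| - N) (by omega)
  rcases h.unit with rfl | rfl <;> rcases abs_choice δ with h4 | h4 <;> rw [h4] at hb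
  · exact h3 b (by rw [← hb]; ring)
  · exact h2 b (by rw [← hb]; ring)
  · exact h2 b (by rw [← hb]; ring)
  · exact h3 b (by rw [← hb]; ring)

end Side

section Configuration

variable {n d : ℕ} {a : Fin n → Fin d → ℤ} {v : Fin n → ℤ}
  {β : Fin d → Fin n → ℤ} {c : Fin n → ℤ}

theorem IsSplit.isSide_posSupport (h : IsSplit a v β c) :
    IsSide v (posSupport v) 1 (posSum v) := by
  have h1 : ∑ i ∈ posSupport v, 1 * v i = posSum v := by
    rw [posSum_eq]; simp
  refine ⟨Or.inl rfl, fun i => by simp [posSupport], h1, ?_, ⟨c, h.sum_mul_eq_one⟩⟩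
  · obtain ⟨i, hi⟩ := h.exists_pos
    exact ⟨i, by simpa [posSupport] using hi⟩

theorem IsSplit.isSide_negSupport (h : IsSplit a v β c) :
    IsSide v (negSupport v) (-1) (posSum v) := by
  have h1 : ∑ i ∈ negSupport v, -1 * v i = posSum v := by
    rw [h.posSum_eq_neg]; simp
  refine ⟨Or.inr rfl, fun i => by simp [negSupport], h1, ?_, ⟨c, h.sum_mul_eq_one⟩⟩
  · obtain ⟨i, hi⟩ := h.exists_neg
    exact ⟨i, by simpa [negSupport] using hi⟩

end Configuration

namespace GrMod

/-! ### Adjoining a variable -/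

section Poly

variable {n : ℕ} {q : Fin (n + 1) → ℤ}

/-- A polynomial ring in `n + 1` variables acts on polynomials with coefficients in a module over
the polynomial ring in the last `n` variables. -/
instance polyModule {A : Type} [AddCommGroup A] [Module (PolyRing n) A] :
    Module (PolyRing (n + 1)) (PolynomialModule (PolyRing n) A) :=
  Module.compHom _ (MvPolynomial.finSuccEquiv ℂ n).toRingEquiv.toRingHom

section Coeff

variable {A : Type} [AddCommGroup A] [Module (PolyRing n) A]

theorem poly_smul_def (s : PolyRing (n + 1)) (x : PolynomialModule (PolyRing n) A) :
    s • x = MvPolynomial.finSuccEquiv ℂ n s • x := rfl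

theorem poly_C_smul (a : ℂ) (x : PolynomialModule (PolyRing n) A) (c : ℕ) :
    ((MvPolynomial.C a : PolyRing (n + 1)) • x).coeff c =
      (MvPolynomial.C a : PolyRing n) • x.coeff c := by
  have h : MvPolynomial.finSuccEquiv ℂ n (MvPolynomial.C a) =
      Polynomial.monomial 0 (MvPolynomial.C a) := by
    rw [MvPolynomial.finSuccEquiv_apply, MvPolynomial.eval₂Hom_C]
    rfl
  rw [poly_smul_def, h, PolynomialModule.monomial_smul_apply]
  simp

theorem poly_X_succ_smul (j : Fin n) (x : PolynomialModule (PolyRing n) A) (c : ℕ) :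
    ((MvPolynomial.X j.succ : PolyRing (n + 1)) • x).coeff c =
      (MvPolynomial.X j : PolyRing n) • x.coeff c := by
  rw [poly_smul_def, MvPolynomial.finSuccEquiv_X_succ, ← Polynomial.monomial_zero_left,
    PolynomialModule.monomial_smul_apply]
  simp

theorem poly_X_zero_smul (x : PolynomialModule (PolyRing n) A) (c : ℕ) :
    ((MvPolynomial.X 0 : PolyRing (n + 1)) • x).coeff c = if 1 ≤ c then x.coeff (c - 1) else 0 := by
  rw [poly_smul_def, MvPolynomial.finSuccEquiv_X_zero, ← Polynomial.monomial_one_one_eq_X,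
    PolynomialModule.monomial_smul_apply]
  simp

/-- Linearity may be tested on the constants and the variables. -/
def linOfX {m : ℕ} {A B : Type} [AddCommGroup A] [AddCommGroup B] [Module (PolyRing m) A]
    [Module (PolyRing m) B] (f : A →+ B)
    (hC : ∀ (c : ℂ) a, f ((MvPolynomial.C c : PolyRing m) • a) =
      (MvPolynomial.C c : PolyRing m) • f a)
    (hX : ∀ i a, f ((MvPolynomial.X i : PolyRing m) • a) = (MvPolynomial.X i : PolyRing m) • f a) :
    A →ₗ[PolyRing m] B where
  toFun := f
  map_add' := map_add f
  map_smul' s a := by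
    rw [RingHom.id_apply]
    induction s using MvPolynomial.induction_on generalizing a with
    | C c => exact hC c a
    | add s t hs ht => rw [add_smul, map_add, hs, ht, add_smul]
    | mul_X s i hs => rw [mul_smul, hs, hX, mul_smul]

/-- The map of polynomial modules induced by a map of coefficients. -/
def polyLin {B : Type} [AddCommGroup B] [Module (PolyRing n) B] (f : A →ₗ[PolyRing n] B) :
    PolynomialModule (PolyRing n) A →ₗ[PolyRing (n + 1)] PolynomialModule (PolyRing n) B :=
  linOfX (PolynomialModule.map (R := PolyRing n) (PolyRing n) f).toAddMonoidHom
    (fun c a => by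
      ext k
      rw [poly_C_smul]
      change f (((MvPolynomial.C c : PolyRing (n + 1)) • a).coeff k) = _
      rw [poly_C_smul, map_smul]
      rfl)
    (fun i a => by
      ext k
      induction i using Fin.cases with
      | zero =>
        rw [poly_X_zero_smul]
        change f (((MvPolynomial.X 0 : PolyRing (n + 1)) • a).coeff k) = _
        rw [poly_X_zero_smul]
        split_ifs
        · rfl
        · exact map_zero f
      | succ i =>
        rw [poly_X_succ_smul]
        change f (((MvPolynomial.X i.succ : PolyRing (n + 1)) • a).coeff k) = _
        rw [poly_X_succ_smul, map_smul]
        rfl)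

theorem C_single_smul (a : PolyRing n) (c : ℕ) (m : A) :
    (PolynomialModule.single (PolyRing n) c (a • m)) =
      (MvPolynomial.finSuccEquiv ℂ n).symm (Polynomial.C a) •
        PolynomialModule.single (PolyRing n) c m := by
  rw [poly_smul_def, AlgEquiv.apply_symm_apply, ← Polynomial.monomial_zero_left,
    PolynomialModule.monomial_smul_single, zero_add]

theorem X_smul_single (c : ℕ) (m : A) :
    (MvPolynomial.X 0 : PolyRing (n + 1)) • PolynomialModule.single (PolyRing n) c m =
      PolynomialModule.single (PolyRing n) (c + 1) m := by
  rw [poly_smul_def, MvPolynomial.finSuccEquiv_X_zero, ← Polynomial.monomial_one_one_eq_X,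
    PolynomialModule.monomial_smul_single, one_smul, add_comm]

instance polyFinite [Module.Finite (PolyRing n) A] :
    Module.Finite (PolyRing (n + 1)) (PolynomialModule (PolyRing n) A) := by
  classical
  obtain ⟨s, hs⟩ := (inferInstance : Module.Finite (PolyRing n) A).fg_top
  refine ⟨⟨s.image (PolynomialModule.single (PolyRing n) 0), eq_top_iff.2 fun x hx => ?_⟩⟩
  clear hx
  induction x using PolynomialModule.induction_linear with
  | zero => exact Submodule.zero_mem _
  | add x y hx hy => exact Submodule.add_mem _ hx hy
  | single c m =>
    induction c with
    | zero =>
      have hm : m ∈ Submodule.span (PolyRing n) (s : Set A) := hs ▸ Submodule.mem_top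
      induction hm using Submodule.span_induction with
      | mem x hx =>
        refine Submodule.subset_span ?_
        rw [Finset.coe_image]
        exact ⟨x, hx, rfl⟩
      | zero => rw [PolynomialModule.single_zero]; exact Submodule.zero_mem _
      | add x y _ _ hx hy => rw [PolynomialModule.single_add]; exact Submodule.add_mem _ hx hy
      | smul a x _ hx => rw [C_single_smul]; exact Submodule.smul_mem _ _ hx
    | succ c ih => rw [← X_smul_single]; exact Submodule.smul_mem _ _ ih

end Coeff

/-- The projection of a polynomial to its part of degree `k`. -/
def polyProj (N : GrMod (fun i : Fin n => q i.succ)) (k : ℤ) :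
    PolynomialModule (PolyRing n) N.carrier →+ PolynomialModule (PolyRing n) N.carrier :=
  PolynomialModule.coeffAddEquiv.symm.toAddMonoidHom.comp
    ((Finsupp.liftAddHom fun c : ℕ => (Finsupp.singleAddHom c).comp (N.proj (k - c * q 0))).comp
      PolynomialModule.coeffAddEquiv.toAddMonoidHom)

theorem polyProj_coeff (N : GrMod (fun i : Fin n => q i.succ)) (k : ℤ)
    (x : PolynomialModule (PolyRing n) N.carrier) (c : ℕ) :
    (polyProj N k x).coeff c = N.proj (k - c * q 0) (x.coeff c) := by
  classical
  induction x using PolynomialModule.induction_linear with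
  | zero => simp
  | add x y hx hy =>
    rw [map_add, PolynomialModule.coeff_add, PolynomialModule.coeff_add, Finsupp.add_apply,
      Finsupp.add_apply, hx, hy, map_add]
  | single j m =>
    have h : (polyProj N k (PolynomialModule.single _ j m)).coeff =
        Finsupp.single j (N.proj (k - j * q 0) m) := by
      exact Finsupp.liftAddHom_apply_single
        (fun c : ℕ => (Finsupp.singleAddHom c).comp (N.proj (k - c * q 0))) j m
    rw [h, PolynomialModule.coeff_single]
    by_cases hj : j = c
    · subst hj; simp
    · rw [Finsupp.single_eq_of_ne (Ne.symm hj), Finsupp.single_eq_of_ne (Ne.symm hj), map_zero]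

/-- The polynomials of degree `k`. -/
def polyGr (N : GrMod (fun i : Fin n => q i.succ)) (k : ℤ) :
    AddSubgroup (PolynomialModule (PolyRing n) N.carrier) where
  carrier := {x | ∀ c : ℕ, x.coeff c ∈ N.gr (k - c * q 0)}
  zero_mem' := fun _ => AddSubgroup.zero_mem _
  add_mem' := fun hx hy c => AddSubgroup.add_mem _ (hx c) (hy c)
  neg_mem' := fun hx c => AddSubgroup.neg_mem _ (hx c)

/-- The graded module `N[x₀]` over the polynomial ring with one more variable `x₀`. -/
def poly (N : GrMod (fun i : Fin n => q i.succ)) : GrMod q where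
  carrier := PolynomialModule (PolyRing n) N.carrier
  gr := polyGr N
  isInternal := by
    refine isInternal_of_proj _ (polyProj N) ?_ ?_ ?_ ?_
    · intro k x c
      rw [polyProj_coeff]
      exact N.proj_mem _ _
    · intro k x hx
      ext c
      rw [polyProj_coeff]
      exact N.proj_same _ _ (hx c)
    · intro j k x hx hjk
      ext c
      rw [polyProj_coeff]
      exact N.proj_ne _ _ _ (hx c) (fun h => hjk (by linarith))
    · intro x
      classical
      suffices h : ∃ t : Finset ℤ, ∀ t', t ⊆ t' → x = ∑ k ∈ t', polyProj N k x by
        obtain ⟨t, ht⟩ := h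
        exact ⟨t, ht t (Finset.Subset.refl t)⟩
      induction x using PolynomialModule.induction_linear with
      | zero => exact ⟨∅, fun t' _ => by simp⟩
      | add x y hx hy =>
        obtain ⟨t, ht⟩ := hx
        obtain ⟨s, hs⟩ := hy
        refine ⟨t ∪ s, fun t' h => ?_⟩
        simp only [map_add, Finset.sum_add_distrib]
        rw [← ht t' (Finset.union_subset_left h), ← hs t' (Finset.union_subset_right h)]
      | single j m =>
        obtain ⟨t, ht⟩ := N.exists_sum_proj m
        refine ⟨t.map (addRightEmbedding (j * q 0)), fun t' h => ?_⟩
        ext c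
        rw [PolynomialModule.coeff_sum, Finsupp.finsetSum_apply]
        simp only [polyProj_coeff, PolynomialModule.coeff_single]
        by_cases hj : j = c
        · subst hj
          have h2 := ht (t'.map (addRightEmbedding (-(j * q 0)))) (by
            intro k hk
            rw [Finset.mem_map]
            refine ⟨k + j * q 0, h ?_, by simp⟩
            rw [Finset.mem_map]
            exact ⟨k, hk, rfl⟩)
          rw [Finset.sum_map] at h2
          simp only [Finsupp.single_eq_same]
          conv_lhs => rw [h2]
          rfl
        · simp [Finsupp.single_eq_of_ne (Ne.symm hj)]
  smul_mem := fun {i j s m} hs hm => by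
    refine smul_mem_of_X (q := q) (A := PolynomialModule (PolyRing n) N.carrier) (polyGr N) ?_ ?_ hs hm
    · intro a j x hx c
      rw [poly_C_smul]
      have h := N.smul_mem (MvPolynomial.isWeightedHomogeneous_C (fun i : Fin n => q i.succ) a) (hx c)
      rwa [zero_add] at h
    · intro i j x hx c
      induction i using Fin.cases with
      | zero =>
        rw [poly_X_zero_smul]
        split_ifs with hc
        · have h := hx (c - 1)
          rw [Nat.cast_sub hc] at h
          rwa [show q 0 + j - c * q 0 = j - (c - (1 : ℕ)) * q 0 by push_cast; ring]
        · exact AddSubgroup.zero_mem _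
      | succ i =>
        rw [poly_X_succ_smul]
        have h := N.smul_mem (MvPolynomial.isWeightedHomogeneous_X ℂ (fun i : Fin n => q i.succ) i)
          (hx c)
        rwa [← add_sub_assoc] at h

/-- Adjoining a variable is functorial. -/
def polyMap {N N' : GrMod (fun i : Fin n => q i.succ)} (f : N ⟶ N') :
    poly (q := q) N ⟶ poly N' :=
  ⟨polyLin f.lin, fun _ _ hx c => f.map_mem _ _ (hx c)⟩

theorem poly_shortExact {X : ShortComplex (GrMod (fun i : Fin n => q i.succ))}
    (hX : X.ShortExact) : ∃ w, (ShortComplex.mk (polyMap (q := q) X.f) (polyMap X.g) w).ShortExact := by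
  have hm := hX.mono_f
  have he := hX.epi_g
  have hinj := injective_of_mono X.f
  have hsurj := surjective_of_epi X.g
  have h0 : ∀ y, X.g.lin (X.f.lin y) = 0 := fun y =>
    congrArg (fun h : X.X₁ ⟶ X.X₃ => h.lin y) X.zero
  have w : polyMap (q := q) X.f ≫ polyMap X.g = 0 := by
    ext x
    refine PolynomialModule.ext (Finsupp.ext fun c => ?_)
    exact h0 _
  refine ⟨w, shortExact_of _ _ w ?_ ?_ ?_⟩
  · intro x y hxy
    refine PolynomialModule.ext (Finsupp.ext fun c => hinj ?_)
    exact congrArg (fun z : PolynomialModule (PolyRing n) X.X₂.carrier => z.coeff c) hxy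
  · intro y
    refine PolynomialModule.induction_linear (p := fun y => ∃ x, polyLin X.g.lin x = y) y
      ⟨0, map_zero _⟩ ?_ ?_
    · rintro _ _ ⟨x, rfl⟩ ⟨x', rfl⟩
      exact ⟨x + x', map_add _ _ _⟩
    · intro c m
      obtain ⟨m, rfl⟩ := hsurj m
      exact ⟨PolynomialModule.single _ c m, PolynomialModule.map_single _ _ _ _⟩
  · intro y
    have key : ∀ c m, X.g.lin m = 0 → ∃ x, polyLin X.f.lin x =
        PolynomialModule.single (PolyRing n) c m := fun c m hm => by
      obtain ⟨a, rfl⟩ := exact_apply hX m hm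
      exact ⟨PolynomialModule.single _ c a, PolynomialModule.map_single _ _ _ _⟩
    intro hy
    have hy' : ∀ c, X.g.lin ((y : PolynomialModule (PolyRing n) X.X₂.carrier).coeff c) = 0 :=
      fun c => congrArg (fun z : PolynomialModule (PolyRing n) X.X₃.carrier => z.coeff c) hy
    have hsum : (y : PolynomialModule (PolyRing n) X.X₂.carrier) = ∑ c ∈
        (y : PolynomialModule (PolyRing n) X.X₂.carrier).coeff.support,
        PolynomialModule.single (PolyRing n) c
          ((y : PolynomialModule (PolyRing n) X.X₂.carrier).coeff c) := by
      refine PolynomialModule.coeff_injective ?_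
      rw [PolynomialModule.coeff_sum]
      exact (Finsupp.sum_single _).symm
    choose x hx using fun c => key c _ (hy' c)
    refine ⟨∑ c ∈ (y : PolynomialModule (PolyRing n) X.X₂.carrier).coeff.support, x c, ?_⟩
    refine (map_sum (polyLin X.f.lin) _ _).trans ?_
    rw [hsum]
    refine Finset.sum_congr ?_ fun c _ => hx c
    rw [← hsum]

/-- The free module `S(k)` comes from fewer variables. -/
theorem poly_S_bijective (k : ℤ) : ∃ f : S q k ⟶ poly (S (fun i : Fin n => q i.succ) k),
    Function.Bijective f.lin := by
  let u : PolynomialModule (PolyRing n) (PolyRing n) := PolynomialModule.single (PolyRing n) 0 1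
  have hu : u ∈ (poly (q := q) (S (fun i : Fin n => q i.succ) k)).gr (-k) := by
    intro c
    rcases Nat.eq_zero_or_pos c with rfl | hc
    · have h : u.coeff 0 = 1 := Finsupp.single_eq_same
      refine Eq.mpr (congrArg (fun z : PolyRing n =>
        z ∈ (S (fun i : Fin n => q i.succ) k).gr (-k - (0 : ℕ) * q 0)) h) ?_
      rw [Nat.cast_zero, zero_mul, sub_zero]
      exact one_mem_S (fun i : Fin n => q i.succ) k
    · have h : u.coeff c = 0 := Finsupp.single_eq_of_ne hc.ne'
      exact Eq.mpr (congrArg (fun z : PolyRing n =>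
        z ∈ (S (fun i : Fin n => q i.succ) k).gr (-k - c * q 0)) h) (AddSubgroup.zero_mem _)
  refine ⟨ofMem (poly (S (fun i : Fin n => q i.succ) k)) k u hu, ?_⟩
  have h1 : ∀ s : PolyRing (n + 1), PolynomialModule.equivPolynomialSelf (s • u) =
      MvPolynomial.finSuccEquiv ℂ n s := fun s => by
    have h2 : PolynomialModule.equivPolynomialSelf u = 1 := rfl
    rw [poly_smul_def, map_smul, h2, smul_eq_mul, mul_one]
  have h3 : (fun s : PolyRing (n + 1) => s • u) = PolynomialModule.equivPolynomialSelf.symm ∘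
      MvPolynomial.finSuccEquiv ℂ n := funext fun s => by
    rw [Function.comp_apply, ← h1, LinearEquiv.symm_apply_apply]
  change Function.Bijective (fun s : PolyRing (n + 1) => s • u)
  rw [h3]
  exact (LinearEquiv.bijective _).comp (AlgEquiv.bijective _)

end Poly

end GrMod

/-! ### Filtering a module over a polynomial ring by degree in one variable -/

section Filtration

variable {R A : Type*} [CommRing R] [AddCommGroup A] [Module R A]

/-- The elements `g₀ + x g₁ + ⋯ + xʲ gⱼ` with all `gᵢ` in `P`. -/
def filtration (x : A →ₗ[R] A) (P : Submodule R A) : ℕ → Submodule R A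
  | 0 => P
  | j + 1 => P ⊔ (filtration x P j).map x

variable (x : A →ₗ[R] A) (P : Submodule R A)

theorem le_filtration (j : ℕ) : P ≤ filtration x P j := by
  cases j with
  | zero => exact le_rfl
  | succ j => exact le_sup_left

theorem map_filtration_le (j : ℕ) : (filtration x P j).map x ≤ filtration x P (j + 1) :=
  le_sup_right

theorem filtration_le_succ (j : ℕ) : filtration x P j ≤ filtration x P (j + 1) := by
  induction j with
  | zero => exact le_filtration x P 1
  | succ j ih => exact sup_le_sup_left (Submodule.map_mono ih) P

theorem filtration_mono : Monotone (filtration x P) :=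
  monotone_nat_of_le_succ (filtration_le_succ x P)

theorem filtration_fg (hP : P.FG) (j : ℕ) : (filtration x P j).FG := by
  induction j with
  | zero => exact hP
  | succ j ih => exact hP.sup (ih.map x)

/-- Each step of the filtration adds leading terms only. -/
theorem filtration_succ_le (j : ℕ) :
    filtration x P (j + 1) ≤ filtration x P j ⊔ P.map (x ^ (j + 1)) := by
  induction j with
  | zero => rw [zero_add, pow_one]; exact le_rfl
  | succ j ih =>
    refine sup_le ((le_filtration x P _).trans le_sup_left) ?_
    refine (Submodule.map_mono ih).trans ?_
    rw [Submodule.map_sup, ← Submodule.map_comp, pow_succ' x (j + 1)]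
    exact sup_le_sup_right (map_filtration_le x P j) _

theorem pow_apply_mem_filtration (d : ℕ) {j : ℕ} {a : A} (ha : a ∈ filtration x P j) :
    (x ^ d) a ∈ filtration x P (j + d) := by
  induction d with
  | zero => exact ha
  | succ d ih =>
    rw [pow_succ']
    exact map_filtration_le x P _ ⟨_, ih, rfl⟩

/-- By Noetherianity of `P`, from some step on an element of the filtration lies one step lower
as soon as one of its multiples `x^(d+1) a` does. -/
theorem exists_filtration_stable [IsNoetherianRing R] (hP : P.FG) : ∃ j, ∀ (d : ℕ) (a : A),
    a ∈ filtration x P (j + 1) → (x ^ (d + 1)) a ∈ filtration x P (j + 1 + d) →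
    a ∈ filtration x P j := by
  have hN : IsNoetherian R P := isNoetherian_of_fg_of_noetherian P hP
  -- the leading coefficients of the elements of lower degree
  let L : ℕ →o Submodule R P := ⟨fun j => (filtration x P j).comap ((x ^ (j + 1)).comp P.subtype),
    monotone_nat_of_le_succ fun j g hg => by
      change (x ^ (j + 1 + 1)) g.1 ∈ filtration x P (j + 1)
      rw [pow_succ']
      exact map_filtration_le x P _ ⟨_, hg, rfl⟩⟩
  obtain ⟨j, hj⟩ := monotone_stabilizes_iff_noetherian.2 hN L
  refine ⟨j, fun d a (ha : a ∈ filtration x P (j + 1)) hda => ?_⟩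
  obtain ⟨b, hb, _, ⟨g, hg, rfl⟩, rfl⟩ := Submodule.mem_sup.1 (filtration_succ_le x P j ha)
  refine Submodule.add_mem _ hb ?_
  have h1 : (⟨g, hg⟩ : P) ∈ L (j + 1 + d) := by
    change (x ^ (j + 1 + d + 1)) g ∈ filtration x P (j + 1 + d)
    have h2 : (x ^ (d + 1)) b ∈ filtration x P (j + 1 + d) := by
      rw [show j + 1 + d = j + (d + 1) by ring]
      exact pow_apply_mem_filtration x P _ hb
    rw [map_add] at hda
    have h3 := (Submodule.add_mem_iff_right _ h2).1 hda
    rw [← Module.End.mul_apply, ← pow_add] at h3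
    rwa [show j + 1 + d + 1 = d + 1 + (j + 1) by ring]
  rw [← hj _ (by omega)] at h1
  exact h1

end Filtration

namespace GrMod

/-! ### Homogeneous submodules over fewer variables -/

section Res

variable {n : ℕ} {q : Fin (n + 1) → ℤ}

theorem proj_smul {m : ℕ} {w : Fin m → ℤ} (M : GrMod w) {s : PolyRing m} {d : ℤ}
    (hs : MvPolynomial.IsWeightedHomogeneous w s d) (k : ℤ) (x : M.carrier) :
    M.proj k (s • x) = s • M.proj (k - d) x := by
  obtain ⟨t, ht⟩ := M.exists_sum_proj x
  have h1 : s • x = ∑ j ∈ insert (k - d) t, s • M.proj j x := by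
    conv_lhs => rw [ht _ (Finset.subset_insert (k - d) t), Finset.smul_sum]
  rw [h1, map_sum, Finset.sum_eq_single (k - d)]
  · refine M.proj_same k _ ?_
    have := M.smul_mem hs (M.proj_mem (k - d) x)
    rwa [add_sub_cancel] at this
  · intro j _ hj
    exact M.proj_ne (d + j) k _ (M.smul_mem hs (M.proj_mem j x)) (fun h => hj (by omega))
  · intro h
    exact absurd (Finset.mem_insert_self _ t) h

/-- The underlying group of `M`, as a module over the polynomials in the last `n` variables. -/
def Res (M : GrMod q) : Type := M.carrier

instance (M : GrMod q) : AddCommGroup (Res M) := inferInstanceAs (AddCommGroup M.carrier)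

instance (M : GrMod q) : Module (PolyRing (n + 1)) (Res M) :=
  inferInstanceAs (Module (PolyRing (n + 1)) M.carrier)

instance (M : GrMod q) : Module (PolyRing n) (Res M) :=
  Module.compHom M.carrier (MvPolynomial.rename (R := ℂ) (Fin.succ (n := n))).toRingHom

theorem res_C_smul (M : GrMod q) (c : ℂ) (x : Res M) :
    (MvPolynomial.C c : PolyRing n) • x =
      (MvPolynomial.C c : PolyRing (n + 1)) • x := by
  change (MvPolynomial.rename Fin.succ (MvPolynomial.C c : PolyRing n) : PolyRing (n + 1)) • x = _
  rw [MvPolynomial.rename_C]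

theorem res_X_smul (M : GrMod q) (i : Fin n) (x : Res M) :
    (MvPolynomial.X i : PolyRing n) • x =
      (MvPolynomial.X i.succ : PolyRing (n + 1)) • x := by
  change (MvPolynomial.rename Fin.succ (MvPolynomial.X i : PolyRing n) : PolyRing (n + 1)) • x = _
  rw [MvPolynomial.rename_X]

theorem proj_smul_res (M : GrMod q) {s : PolyRing (n + 1)} {d : ℤ}
    (hs : MvPolynomial.IsWeightedHomogeneous q s d) (k : ℤ) (x : Res M) :
    (M.proj k (s • x) : Res M) = s • (M.proj (k - d) x : Res M) :=
  proj_smul M hs k x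

/-- `P` contains the homogeneous parts of its elements. -/
def ResHomogeneous (M : GrMod q) (P : Submodule (PolyRing n) (Res M)) : Prop :=
  ∀ m ∈ P, ∀ k, (M.proj k m : Res M) ∈ P

/-- A finitely generated homogeneous submodule over fewer variables, as a graded module. -/
def resSub (M : GrMod q) (P : Submodule (PolyRing n) (Res M)) (hP : ResHomogeneous M P)
    (hfg : P.FG) : GrMod (fun i : Fin n => q i.succ) :=
  have : Module.Finite (PolyRing n) P := Module.Finite.iff_fg.2 hfg
  { carrier := P
    gr := fun k => AddSubgroup.comap (G := P) (N := M.carrier) P.subtype.toAddMonoidHom (M.gr k)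
    isInternal := by
      refine isInternal_of_proj _
        (fun k => AddMonoidHom.mk' (fun m => (⟨M.proj k m.1, hP m.1 m.2 k⟩ : P))
          (fun a b => Subtype.ext (map_add (M.proj k) a.1 b.1))) ?_ ?_ ?_ ?_
      · intro k m; exact M.proj_mem k m.1
      · intro k m hm; exact Subtype.ext (M.proj_same k m.1 hm)
      · intro j k m hm hjk; exact Subtype.ext (M.proj_ne j k m.1 hm hjk)
      · intro m
        obtain ⟨t, ht⟩ := M.exists_sum_proj m.1
        refine ⟨t, Subtype.ext ?_⟩
        rw [AddSubmonoidClass.coe_finsetSum]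
        exact ht t (Finset.Subset.refl t)
    smul_mem := fun {i j s m} hs hm => by
      refine smul_mem_of_X (q := fun i : Fin n => q i.succ) (A := P)
        (fun k => AddSubgroup.comap (G := P) (N := M.carrier) P.subtype.toAddMonoidHom (M.gr k))
        ?_ ?_ hs hm
      · intro c j m hm
        have h := M.smul_mem (MvPolynomial.isWeightedHomogeneous_C q c) hm
        rw [zero_add] at h
        change ((MvPolynomial.C c : PolyRing n) • m.1 : Res M) ∈ M.gr j
        rw [res_C_smul]
        exact h
      · intro i j m hm
        have h := M.smul_mem (MvPolynomial.isWeightedHomogeneous_X ℂ q i.succ) hm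
        change ((MvPolynomial.X i : PolyRing n) • m.1 : Res M) ∈ M.gr (q i.succ + j)
        rw [res_X_smul]
        exact h }

theorem resHomogeneous_span (M : GrMod q) (s : Set (Res M)) (hs : ∀ x ∈ s, ∃ k, x ∈ M.gr k) :
    ResHomogeneous M (Submodule.span (PolyRing n) s) := by
  intro m hm
  induction hm using Submodule.span_induction with
  | mem x hx =>
    intro k
    obtain ⟨j, hj⟩ := hs x hx
    by_cases hjk : j = k
    · subst hjk
      rw [M.proj_same j x hj]
      exact Submodule.subset_span hx
    · rw [M.proj_ne j k x hj hjk]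
      exact Submodule.zero_mem _
  | zero =>
    intro k
    rw [show M.proj k (0 : Res M) = (0 : Res M) from map_zero (M.proj k)]
    exact Submodule.zero_mem _
  | add x y _ _ hx hy =>
    intro k
    rw [show M.proj k (x + y : Res M) = (M.proj k x + M.proj k y : Res M) from
      map_add (M.proj k) x y]
    exact Submodule.add_mem _ (hx k) (hy k)
  | smul a x _ hx =>
    induction a using MvPolynomial.induction_on generalizing x with
    | C c =>
      intro k
      rw [res_C_smul, proj_smul_res M (MvPolynomial.isWeightedHomogeneous_C q c), sub_zero]
      exact (congrArg (· ∈ Submodule.span (PolyRing n) s) (res_C_smul M c (M.proj k x))).mp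
        (Submodule.smul_mem _ (MvPolynomial.C c : PolyRing n) (hx k))
    | add a b ha hb =>
      intro k
      rw [add_smul, show M.proj k (a • x + b • x : Res M) =
        (M.proj k (a • x : Res M) + M.proj k (b • x : Res M) : Res M) from
        map_add (M.proj k) (a • x : Res M) (b • x : Res M)]
      exact Submodule.add_mem _ (ha x ‹_› hx k) (hb x ‹_› hx k)
    | mul_X a i ha =>
      intro k
      rw [mul_smul]
      refine ha _ (Submodule.smul_mem _ _ ‹_›) (fun k => ?_) k
      rw [res_X_smul, proj_smul_res M (MvPolynomial.isWeightedHomogeneous_X ℂ q i.succ)]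
      exact (congrArg (· ∈ Submodule.span (PolyRing n) s)
        (res_X_smul M i (M.proj (k - q i.succ) x))).mp
        (Submodule.smul_mem _ (MvPolynomial.X i : PolyRing n) (hx (k - q i.succ)))

/-- Multiplication by the first variable. -/
def resX (M : GrMod q) : Res M →ₗ[PolyRing n] Res M where
  toFun x := (MvPolynomial.X 0 : PolyRing (n + 1)) • x
  map_add' x y := smul_add (MvPolynomial.X 0 : PolyRing (n + 1)) x y
  map_smul' a x := smul_comm (MvPolynomial.X 0 : PolyRing (n + 1))
    (MvPolynomial.rename Fin.succ a : PolyRing (n + 1)) (x : M.carrier)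

theorem resHomogeneous_filtration (M : GrMod q) {P : Submodule (PolyRing n) (Res M)}
    (hP : ResHomogeneous M P) (j : ℕ) : ResHomogeneous M (filtration (resX M) P j) := by
  induction j with
  | zero => exact hP
  | succ j ih =>
    intro m hm k
    obtain ⟨a, ha, _, ⟨b, hb, rfl⟩, rfl⟩ := Submodule.mem_sup.1 hm
    have h : (M.proj k (a + resX M b : Res M) : Res M) =
        (show Res M from M.proj k a) + resX M (M.proj (k - q 0) b) :=
      (map_add (M.proj k) a _).trans (congrArg ((M.proj k a : M.carrier) + ·)
        (proj_smul M (MvPolynomial.isWeightedHomogeneous_X ℂ q 0) k b))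
    rw [h]
    exact Submodule.add_mem_sup (M := Res M) (R := PolyRing n) (hP a ha k)
      ⟨(show Res M from M.proj (k - q 0) b), ih b hb _, rfl⟩

theorem poly_coeff_sub {A : Type} [AddCommGroup A] [Module (PolyRing n) A]
    (x y : PolynomialModule (PolyRing n) A) : (x - y).coeff = x.coeff - y.coeff :=
  map_sub PolynomialModule.coeffAddEquiv x y

theorem exists_coeff_eq_zero {A : Type} [AddCommGroup A] [Module (PolyRing n) A]
    (x : PolynomialModule (PolyRing n) A) : ∃ B, ∀ c, B ≤ c → x.coeff c = 0 := by
  refine ⟨x.coeff.support.sup id + 1, fun c hc => ?_⟩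
  by_contra h
  have := Finset.le_sup (f := id) (Finsupp.mem_support_iff.2 h)
  simp only [id] at this
  omega

theorem poly_eq_sum {A : Type} [AddCommGroup A] [Module (PolyRing n) A]
    (x : PolynomialModule (PolyRing n) A) (B : ℕ) (hB : ∀ c, B ≤ c → x.coeff c = 0) :
    x = ∑ c ∈ Finset.range B, PolynomialModule.single (PolyRing n) c (x.coeff c) := by
  refine PolynomialModule.coeff_injective ?_
  rw [PolynomialModule.coeff_sum]
  refine (Finsupp.sum_single x.coeff).symm.trans (Finsupp.sum_of_support_subset _ ?_ _ ?_)
  · intro c hc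
    rw [Finset.mem_range]
    by_contra h
    exact (Finsupp.mem_support_iff.1 hc) (hB c (by omega))
  · intro c _
    exact Finsupp.single_zero c

/-- Evaluation of polynomials with coefficients in a submodule at the first variable. -/
def resEval (M : GrMod q) (P : Submodule (PolyRing n) (Res M)) :
    PolynomialModule (PolyRing n) P →ₗ[PolyRing (n + 1)] Res M :=
  let ev : PolynomialModule (PolyRing n) P →+ Res M :=
    (Finsupp.liftAddHom fun c : ℕ => ((((resX M) ^ c).comp P.subtype :
      P →ₗ[PolyRing n] Res M).toAddMonoidHom :
      P →+ Res M)).comp PolynomialModule.coeffAddEquiv.toAddMonoidHom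
  have hs : ∀ c m, ev (PolynomialModule.single _ c m) = ((resX M) ^ c) m.1 := fun c m =>
    Finsupp.liftAddHom_apply_single _ c m
  linOfX (B := Res M) ev
    (fun a p => by
      induction p using PolynomialModule.induction_linear with
      | zero => rw [smul_zero, map_zero, smul_zero]
      | add x y hx hy => rw [smul_add, map_add, hx, hy, map_add, smul_add]
      | single c m =>
        have h : (MvPolynomial.C a : PolyRing (n + 1)) • PolynomialModule.single (PolyRing n) c m =
            PolynomialModule.single (PolyRing n) c ((MvPolynomial.C a : PolyRing n) • m) := by
          rw [C_single_smul, (AlgEquiv.symm_apply_eq _).2]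
          rw [MvPolynomial.finSuccEquiv_apply, MvPolynomial.eval₂Hom_C]
          rfl
        rw [h, hs, hs]
        refine (map_smul ((resX M) ^ c) (MvPolynomial.C a : PolyRing n) m.1).trans ?_
        rw [res_C_smul])
    (fun i p => by
      induction p using PolynomialModule.induction_linear with
      | zero => rw [smul_zero, map_zero, smul_zero]
      | add x y hx hy => rw [smul_add, map_add, hx, hy, map_add, smul_add]
      | single c m =>
        induction i using Fin.cases with
        | zero =>
          rw [X_smul_single, hs, hs, pow_succ', Module.End.mul_apply]
          rfl
        | succ i =>
          have h : (MvPolynomial.X i.succ : PolyRing (n + 1)) •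
              PolynomialModule.single (PolyRing n) c m =
              PolynomialModule.single (PolyRing n) c ((MvPolynomial.X i : PolyRing n) • m) := by
            rw [C_single_smul, (AlgEquiv.symm_apply_eq _).2]
            exact (MvPolynomial.finSuccEquiv_X_succ).symm
          rw [h, hs, hs]
          refine (map_smul ((resX M) ^ c) (MvPolynomial.X i : PolyRing n) m.1).trans ?_
          rw [res_X_smul])

theorem resEval_single (M : GrMod q) (P : Submodule (PolyRing n) (Res M)) (c : ℕ) (m : P) :
    resEval M P (PolynomialModule.single _ c m) = ((resX M) ^ c) m.1 :=
  Finsupp.liftAddHom_apply_single _ c m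

theorem resEval_eq_sum (M : GrMod q) (P : Submodule (PolyRing n) (Res M))
    (x : PolynomialModule (PolyRing n) P) (B : ℕ) (hB : ∀ c, B ≤ c → x.coeff c = 0) :
    resEval M P x = ∑ c ∈ Finset.range B, ((resX M) ^ c) (x.coeff c).1 := by
  conv_lhs => rw [poly_eq_sum x B hB]
  rw [map_sum]
  exact Finset.sum_congr rfl fun c _ => resEval_single M P c _

theorem resX_pow_mem (M : GrMod q) (c : ℕ) {k : ℤ} {x : Res M} (hx : x ∈ M.gr k) :
    ((resX M) ^ c) x ∈ M.gr (c * q 0 + k) := by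
  induction c with
  | zero => rwa [Nat.cast_zero, zero_mul, zero_add]
  | succ c ih =>
    rw [pow_succ', Nat.cast_succ, add_mul, one_mul, add_comm _ (q 0), add_assoc]
    exact M.smul_mem (MvPolynomial.isWeightedHomogeneous_X ℂ q 0) ih

end Res

/-! ### Classes of modules determined by free resolutions -/

/-- A sequence of classes of graded modules, `Q c` playing the role of the modules which have a
resolution of length `c` by objects of a given kind. -/
structure ResClass {n : ℕ} {q : Fin n → ℤ} (Q : ℕ → GrMod q → Prop) : Prop where
  zero : ∀ c (M : GrMod q), Subsingleton M.carrier → Q c M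
  ext : ∀ c (X : ShortComplex (GrMod q)), X.ShortExact → Q c X.X₁ → Q c X.X₃ → Q c X.X₂
  coker : ∀ c (X : ShortComplex (GrMod q)), X.ShortExact → Q c X.X₁ → Q (c + 1) X.X₂ →
    Q (c + 1) X.X₃
  succ : ∀ c M, Q c M → Q (c + 1) M

theorem ResClass.mono {n : ℕ} {q : Fin n → ℤ} {Q : ℕ → GrMod q → Prop} (h : ResClass Q)
    {c c' : ℕ} (hc : c ≤ c') {M : GrMod q} (hM : Q c M) : Q c' M := by
  induction c', hc using Nat.le_induction with
  | base => exact hM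
  | succ c' _ ih => exact h.succ _ _ ih

theorem ResClass.of_bijective {n : ℕ} {q : Fin n → ℤ} {Q : ℕ → GrMod q → Prop} (h : ResClass Q)
    {c : ℕ} {M N : GrMod q} (f : M ⟶ N) (hf : Function.Bijective f.lin) (hN : Q c N) : Q c M := by
  have hX : (ShortComplex.mk (0 : (zeroMod : GrMod q) ⟶ M) f (zero_comp)).ShortExact :=
    shortExact_of _ _ _ (fun _ _ _ => Subsingleton.elim (α := PUnit) _ _) hf.2
      fun b hb => ⟨PUnit.unit, (hf.1 (hb.trans (map_zero f.lin).symm)).symm⟩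
  exact h.ext c _ hX (h.zero c _ (inferInstanceAs (Subsingleton PUnit))) hN

theorem ResClass.poly {n : ℕ} {q : Fin (n + 1) → ℤ} {Q : ℕ → GrMod q → Prop} (h : ResClass Q) :
    ResClass (fun c N => Q c (poly N)) where
  zero c N hN := h.zero c _ ⟨fun x y => PolynomialModule.ext (Finsupp.ext fun _ =>
    Subsingleton.elim (α := N.carrier) _ _)⟩
  ext c X hX h1 h3 := by
    obtain ⟨w, hw⟩ := poly_shortExact (q := q) hX
    exact h.ext c _ hw h1 h3
  coker c X hX h1 h2 := by
    obtain ⟨w, hw⟩ := poly_shortExact (q := q) hX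
    exact h.coker c _ hw h1 h2
  succ c N hN := h.succ c _ hN

/-- The resolution of a module over `S` by polynomials in the first variable with coefficients in
modules over the polynomials in the other variables: the two coefficient modules are consecutive
steps `F j ⊆ F (j + 1)` of the filtration by the degree in the first variable, far enough out. The
map `F j[x₀] → F (j + 1)[x₀]` is the difference between multiplication by the polynomial variable
and multiplication by `x₀` inside `M`, and the cokernel is `M` by evaluation. -/
theorem exists_poly_resolution {n : ℕ} {q : Fin (n + 1) → ℤ} (M : GrMod q) :
    ∃ (N N' : GrMod fun i : Fin n => q i.succ) (f : poly (q := q) N ⟶ poly N') (g : poly N' ⟶ M)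
      (w : f ≫ g = 0), (ShortComplex.mk f g w).ShortExact := by
  obtain ⟨s, hs, hspan⟩ := exists_homogeneous_generators M
  let P : Submodule (PolyRing n) (Res M) := Submodule.span (PolyRing n) (s : Set M.carrier)
  have hP : ResHomogeneous M P := resHomogeneous_span M _ fun x hx => hs x hx
  have hfg : P.FG := Submodule.fg_span s.finite_toSet
  obtain ⟨j, hj⟩ := exists_filtration_stable (resX M) P hfg
  let F : ℕ → Submodule (PolyRing n) (Res M) := filtration (resX M) P
  let N := resSub M (F j) (resHomogeneous_filtration M hP j) (filtration_fg _ P hfg j)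
  let N' := resSub M (F (j + 1)) (resHomogeneous_filtration M hP (j + 1))
    (filtration_fg _ P hfg (j + 1))
  let ι : F j →ₗ[PolyRing n] F (j + 1) := Submodule.inclusion (filtration_le_succ (resX M) P j)
  let ξ : F j →ₗ[PolyRing n] F (j + 1) := (resX M).restrict fun x hx =>
    map_filtration_le (resX M) P j ⟨x, hx, rfl⟩
  let fl : PolynomialModule (PolyRing n) (F j) →ₗ[PolyRing (n + 1)]
      PolynomialModule (PolyRing n) (F (j + 1)) :=
    (MvPolynomial.X 0 : PolyRing (n + 1)) • polyLin ι - polyLin ξ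
  have hfl : ∀ p c, (fl p).coeff c = (if 1 ≤ c then ι (p.coeff (c - 1)) else 0) - ξ (p.coeff c) := by
    intro p c
    have h1 : fl p = (MvPolynomial.X 0 : PolyRing (n + 1)) • polyLin ι p - polyLin ξ p := rfl
    rw [h1, poly_coeff_sub, Finsupp.sub_apply, poly_X_zero_smul]
    rfl
  let ev := resEval M (F (j + 1))
  have hev : ∀ p, ev (fl p) = 0 := by
    intro p
    induction p using PolynomialModule.induction_linear with
    | zero => rw [map_zero, map_zero]
    | add x y hx hy => rw [map_add, map_add, hx, hy, add_zero]
    | single c m =>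
      have h1 : fl (PolynomialModule.single _ c m) = PolynomialModule.single _ (c + 1) (ι m) -
          PolynomialModule.single _ c (ξ m) := by
        change (MvPolynomial.X 0 : PolyRing (n + 1)) •
          (PolynomialModule.map (R := PolyRing n) (PolyRing n) ι) (PolynomialModule.single _ c m) -
          (PolynomialModule.map (R := PolyRing n) (PolyRing n) ξ) (PolynomialModule.single _ c m) = _
        rw [PolynomialModule.map_single, PolynomialModule.map_single, X_smul_single]
      rw [h1, map_sub, resEval_single, resEval_single, pow_succ]
      exact sub_self _
  let N₁ : GrMod fun i : Fin n => q i.succ := N.twist (-q 0)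
  let f : poly (q := q) N₁ ⟶ poly N' := ⟨fl, fun k p hp c => by
    have h1 := hfl p c
    refine Eq.mpr (congrArg (fun z : F (j + 1) => z ∈ N'.gr (k - c * q 0)) h1) ?_
    refine AddSubgroup.sub_mem _ ?_ ?_
    · split_ifs with hc
      · have h2 := hp (c - 1)
        rw [Nat.cast_sub hc] at h2
        have h3 : (N₁.gr (k - ((c : ℤ) - (1 : ℕ)) * q 0)) = N.gr (k - c * q 0) := by
          change N.gr _ = _
          congr 1
          push_cast
          ring
        rw [h3] at h2
        exact h2
      · exact AddSubgroup.zero_mem _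
    · have h2 : _ ∈ M.gr (-q 0 + (k - c * q 0)) := hp c
      have h3 := M.smul_mem (MvPolynomial.isWeightedHomogeneous_X ℂ q 0) h2
      rw [add_neg_cancel_left] at h3
      exact h3⟩
  let g : poly N' ⟶ M := ⟨ev, fun k (p : PolynomialModule (PolyRing n) (F (j + 1))) hp => by
    obtain ⟨B, hB⟩ := exists_coeff_eq_zero p
    change resEval M (F (j + 1)) p ∈ M.gr k
    rw [resEval_eq_sum M _ p B hB]
    refine AddSubgroup.sum_mem (M.gr k) fun c _ => ?_
    have h1 := resX_pow_mem M c (hp c)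
    rwa [add_sub_cancel] at h1⟩
  have w : f ≫ g = 0 := by ext p; exact hev p
  refine ⟨N₁, N', f, g, w, shortExact_of f g w ?_ ?_ ?_⟩
  · change Function.Injective fl
    rw [injective_iff_map_eq_zero]
    intro p hp
    obtain ⟨B, hB⟩ := exists_coeff_eq_zero p
    -- the coefficient of `x₀ ^ (c + 1)` in the image determines that of `x₀ ^ c`, from the top down
    have key : ∀ m c, B ≤ c + m → p.coeff c = 0 := by
      intro m
      induction m with
      | zero => exact hB
      | succ m ih =>
        intro c hc
        have h1 := hfl p (c + 1)
        rw [hp, if_pos (by omega), ih (c + 1) (by omega), map_zero, sub_zero] at h1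
        exact Submodule.inclusion_injective _ (h1.symm.trans (map_zero ι).symm)
    exact PolynomialModule.ext (Finsupp.ext fun c => key B c (by omega))
  · change Function.Surjective ev
    have hle : (⊤ : Submodule (PolyRing (n + 1)) M.carrier) ≤ LinearMap.range ev := by
      refine hspan.symm.le.trans (Submodule.span_le.2 ?_)
      intro x hx
      refine ⟨PolynomialModule.single _ 0 ⟨x, le_filtration _ P _ (Submodule.subset_span hx)⟩, ?_⟩
      rw [resEval_single]
      rfl
    exact fun x => hle (Submodule.mem_top (x := x))
  · have key : ∀ (D : ℕ) (p : PolynomialModule (PolyRing n) (F (j + 1))),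
        (∀ c, D ≤ c → p.coeff c = 0) → ev p = 0 → ∃ r, fl r = p := by
      intro D
      induction D with
      | zero =>
        intro p hp _
        exact ⟨0, (map_zero fl).trans (PolynomialModule.ext (Finsupp.ext fun c =>
          (hp c (Nat.zero_le c)).symm))⟩
      | succ D ih =>
        intro p hp hp0
        have h1 := resEval_eq_sum M _ p (D + 1) hp
        rw [show resEval M (F (j + 1)) p = 0 from hp0, Finset.sum_range_succ] at h1
        obtain rfl | ⟨d, rfl⟩ : D = 0 ∨ ∃ d, D = d + 1 :=
          D.eq_zero_or_eq_succ_pred.imp id fun h => ⟨_, h⟩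
        · rw [Finset.sum_range_zero, zero_add] at h1
          refine ih p (fun c _ => ?_) hp0
          rcases Nat.eq_zero_or_pos c with rfl | hc
          · exact Subtype.ext h1.symm
          · exact hp c hc
        -- the leading coefficient lies in the lower step of the filtration
        have h2 : (p.coeff (d + 1)).1 ∈ F j := by
          refine hj d _ (p.coeff (d + 1)).2 ?_
          rw [eq_neg_of_add_eq_zero_right h1.symm]
          refine Submodule.neg_mem _ (Submodule.sum_mem _ fun c hc => ?_)
          exact filtration_mono _ P (by have := Finset.mem_range.1 hc; omega)
            (pow_apply_mem_filtration _ P c (p.coeff c).2)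
        obtain ⟨r, hr⟩ := ih (p - fl (PolynomialModule.single _ d ⟨_, h2⟩)) (fun c hc => by
          rw [poly_coeff_sub, Finsupp.sub_apply, hfl, if_pos (by omega),
            PolynomialModule.coeff_single, Finsupp.single_eq_of_ne (by omega : c ≠ d), map_zero,
            sub_zero]
          rcases eq_or_ne c (d + 1) with rfl | hne
          · rw [Nat.add_sub_cancel, Finsupp.single_eq_same]
            exact sub_self _
          · rw [Finsupp.single_eq_of_ne (by omega : c - 1 ≠ d), map_zero, sub_zero]
            exact hp c (by omega)) (by rw [map_sub, hp0, hev, sub_zero])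
        exact ⟨r + PolynomialModule.single _ d ⟨_, h2⟩, by rw [map_add, hr, sub_add_cancel]⟩
    intro (p : PolynomialModule (PolyRing n) (F (j + 1))) hp
    obtain ⟨D, hD⟩ := exists_coeff_eq_zero p
    exact key D p hD hp

/-- Hilbert's syzygy theorem, in the form of an induction principle. -/
theorem ResClass.hilbert {n : ℕ} {q : Fin n → ℤ} {Q : ℕ → GrMod q → Prop} (h : ResClass Q)
    (hS : ∀ k, Q 0 (S q k)) (M : GrMod q) : Q n M := by
  induction n with
  | zero =>
    refine cyclic_induction (Q 0) (fun M k f hf => ?_) (fun X hX h1 h3 => h.ext 0 X hX h1 h3) M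
    have key : ∀ s : PolyRing 0, f.lin s = s • f.lin (1 : PolyRing 0) := fun s =>
      (congrArg f.lin (mul_one s).symm).trans (map_smul f.lin s (1 : PolyRing 0))
    -- the polynomial ring without variables is a field
    by_cases h1 : f.lin (1 : PolyRing 0) = 0
    · refine h.zero 0 M ⟨fun x y => ?_⟩
      obtain ⟨x, rfl⟩ := hf x
      obtain ⟨y, rfl⟩ := hf y
      rw [key x, key y, h1]
      exact (smul_zero (M := PolyRing 0) x).trans (smul_zero (M := PolyRing 0) y).symm
    · have hinj : Function.Injective f.lin := by
        rw [injective_iff_map_eq_zero]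
        intro (s : PolyRing 0) hs
        obtain ⟨c, rfl⟩ := MvPolynomial.C_surjective (Fin 0) s
        by_contra hc
        have hc' : c ≠ 0 := fun h0 => hc (by rw [h0]; exact map_zero MvPolynomial.C)
        refine h1 ?_
        have h2 : (MvPolynomial.C c⁻¹ : PolyRing 0) • f.lin (MvPolynomial.C c : PolyRing 0) = 0 := by
          rw [hs, smul_zero]
        rw [key, smul_smul, ← MvPolynomial.C_mul, inv_mul_cancel₀ hc', MvPolynomial.C_1,
          one_smul] at h2
        exact h2
      have := isIso_of_bijective f ⟨hinj, hf⟩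
      refine h.of_bijective (inv f) ?_ (hS k)
      refine ⟨injective_of_mono _, surjective_of_epi _⟩
  | succ n ih =>
    obtain ⟨N, N', f, g, w, hX⟩ := exists_poly_resolution M
    have key := fun N => ih h.poly (fun k => by
      obtain ⟨f, hf⟩ := poly_S_bijective (q := q) k
      have := isIso_of_bijective f hf
      exact h.of_bijective (inv f) ⟨injective_of_mono _, surjective_of_epi _⟩ (hS k)) N
    exact h.coker n _ hX (key N) (h.succ _ _ (key N'))

end GrMod

namespace GrMod

/-! ### Resolving monomial ideals inside a window of degrees -/

section Window

variable {n : ℕ} (q : Fin n → ℤ)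

/-- The ideal spanned by the monomials `x^b` with `∑_{i ∈ A} bᵢ |qᵢ| ≥ t`. -/
def weightIdeal (A : Finset (Fin n)) (t : ℤ) : Ideal (PolyRing n) :=
  Ideal.span ((fun b => MvPolynomial.monomial b (1 : ℂ)) ''
    {b : Fin n →₀ ℕ | t ≤ ∑ i ∈ A, b i * |q i|})

variable {q}

theorem mem_weightIdeal {A : Finset (Fin n)} {t : ℤ} {f : PolyRing n} :
    f ∈ weightIdeal q A t ↔ ∀ b ∈ f.support, t ≤ ∑ i ∈ A, b i * |q i| := by
  rw [weightIdeal, MvPolynomial.mem_ideal_span_monomial_image]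
  refine forall₂_congr fun b _ => ⟨?_, fun h => ⟨b, h, le_rfl⟩⟩
  rintro ⟨c, hc, hcb⟩
  refine le_trans hc (Finset.sum_le_sum fun i _ => ?_)
  exact mul_le_mul_of_nonneg_right (by exact_mod_cast hcb i) (abs_nonneg _)

theorem weightIdeal_eq_top {A : Finset (Fin n)} {t : ℤ} (ht : t ≤ 0) : weightIdeal q A t = ⊤ :=
  eq_top_iff.2 fun f _ => mem_weightIdeal.2 fun b _ => ht.trans
    (Finset.sum_nonneg fun i _ => by positivity)

theorem weightIdeal_mono {A A' : Finset (Fin n)} (hA : A ⊆ A') {t t' : ℤ} (ht : t' ≤ t) :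
    weightIdeal q A t ≤ weightIdeal q A' t' := fun f hf => mem_weightIdeal.2 fun b hb =>
  ht.trans ((mem_weightIdeal.1 hf b hb).trans
    (Finset.sum_le_sum_of_subset_of_nonneg hA fun i _ _ => by positivity))

theorem mem_support_X_mul {i : Fin n} {f : PolyRing n} {b : Fin n →₀ ℕ} :
    b ∈ (MvPolynomial.X i * f).support ↔ ∃ c ∈ f.support, b = c + Finsupp.single i 1 := by
  rw [mul_comm, MvPolynomial.support_mul_X, Finset.mem_map]
  exact exists_congr fun c => and_congr_right fun _ => eq_comm

theorem sum_add_single_of_notMem {A : Finset (Fin n)} {i : Fin n} (hi : i ∉ A)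
    (b : Fin n →₀ ℕ) : ∑ j ∈ A, (((b + Finsupp.single i 1 : Fin n →₀ ℕ) j : ℕ) : ℤ) * |q j| = ∑ j ∈ A, b j * |q j| :=
  Finset.sum_congr rfl fun j hj => by
    rw [Finsupp.add_apply, Finsupp.single_eq_of_ne (fun h : j = i => hi (h ▸ hj)), add_zero]

theorem sum_insert_add_single {A : Finset (Fin n)} {i : Fin n} (hi : i ∉ A) (b : Fin n →₀ ℕ) :
    ∑ j ∈ insert i A, (((b + Finsupp.single i 1 : Fin n →₀ ℕ) j : ℕ) : ℤ) * |q j| =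
      ∑ j ∈ insert i A, b j * |q j| + |q i| := by
  rw [Finset.sum_insert hi, Finset.sum_insert hi, sum_add_single_of_notMem hi, Finsupp.add_apply,
    Finsupp.single_eq_same]
  push_cast
  ring

theorem X_mul_mem_weightIdeal_iff {A : Finset (Fin n)} {i : Fin n} (hi : i ∉ A) {t : ℤ}
    {f : PolyRing n} : MvPolynomial.X i * f ∈ weightIdeal q A t ↔ f ∈ weightIdeal q A t := by
  refine ⟨fun h => mem_weightIdeal.2 fun b hb => ?_, fun h => Ideal.mul_mem_left _ _ h⟩
  rw [← sum_add_single_of_notMem hi b]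
  exact mem_weightIdeal.1 h _ (mem_support_X_mul.2 ⟨b, hb, rfl⟩)

theorem X_mul_mem_weightIdeal_insert {A : Finset (Fin n)} {i : Fin n} (hi : i ∉ A) {t : ℤ}
    {f : PolyRing n} (hf : f ∈ weightIdeal q (insert i A) (t - |q i|)) :
    MvPolynomial.X i * f ∈ weightIdeal q (insert i A) t := by
  refine mem_weightIdeal.2 fun b hb => ?_
  obtain ⟨c, hc, rfl⟩ := mem_support_X_mul.1 hb
  rw [sum_insert_add_single hi]
  have := mem_weightIdeal.1 hf c hc
  omega

/-- A polynomial in the ideal splits according to divisibility by `xᵢ`. -/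
theorem exists_of_mem_weightIdeal_insert {A : Finset (Fin n)} {i : Fin n} (hi : i ∉ A) {t : ℤ}
    {f : PolyRing n} (hf : f ∈ weightIdeal q (insert i A) t) :
    ∃ a ∈ weightIdeal q A t, ∃ b ∈ weightIdeal q (insert i A) (t - |q i|),
      f = a - MvPolynomial.X i * b := by
  refine Submodule.span_induction (p := fun f _ => ∃ a ∈ weightIdeal q A t,
    ∃ b ∈ weightIdeal q (insert i A) (t - |q i|), f = a - MvPolynomial.X i * b) ?_ ?_ ?_ ?_ hf
  · rintro _ ⟨b, hb, rfl⟩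
    rcases Nat.eq_zero_or_pos (b i) with h0 | h0
    · refine ⟨_, Ideal.subset_span ⟨b, ?_, rfl⟩, 0, Ideal.zero_mem _, by simp⟩
      have h1 : t ≤ ∑ j ∈ insert i A, (b j : ℤ) * |q j| := hb
      rwa [Finset.sum_insert hi, h0, Nat.cast_zero, zero_mul, zero_add] at h1
    · obtain ⟨c, rfl⟩ : ∃ c, b = c + Finsupp.single i 1 :=
        ⟨b - Finsupp.single i 1, (tsub_add_cancel_of_le (Finsupp.single_le_iff.2 h0)).symm⟩
      refine ⟨0, Ideal.zero_mem _, -MvPolynomial.monomial c 1,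
        Ideal.neg_mem_iff _ |>.2 (Ideal.subset_span ⟨c, ?_, rfl⟩), ?_⟩
      · have h1 : t ≤ ∑ j ∈ insert i A, (((c + Finsupp.single i 1 : Fin n →₀ ℕ) j : ℕ) : ℤ) * |q j| := hb
        rw [sum_insert_add_single hi] at h1
        exact sub_le_iff_le_add.2 h1
      · beta_reduce
        rw [MvPolynomial.monomial_add_single, pow_one]
        ring
  · exact ⟨0, Ideal.zero_mem _, 0, Ideal.zero_mem _, by simp⟩
  · rintro _ _ _ _ ⟨a, ha, b, hb, rfl⟩ ⟨a', ha', b', hb', rfl⟩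
    exact ⟨a + a', Ideal.add_mem _ ha ha', b + b', Ideal.add_mem _ hb hb', by ring⟩
  · rintro s _ _ ⟨a, ha, b, hb, rfl⟩
    exact ⟨s * a, Ideal.mul_mem_left _ _ ha, s * b, Ideal.mul_mem_left _ _ hb, by
      rw [smul_eq_mul]; ring⟩

theorem weightIdeal_homogeneous (A : Finset (Fin n)) (t : ℤ) :
    ∀ f ∈ weightIdeal q A t, ∀ k, (GrMod.free q).proj k f ∈ weightIdeal q A t := by
  intro f hf k
  rw [mem_weightIdeal] at hf
  rw [GrMod.free_proj]
  refine mem_weightIdeal.2 fun b hb => hf b ?_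
  rw [MvPolynomial.mem_support_iff, MvPolynomial.coeff_weightedHomogeneousComponent] at hb
  rw [MvPolynomial.mem_support_iff]
  exact fun h => hb (by rw [h, ite_self])

variable (q) in
/-- The graded module `𝔞(-d)` for the ideal `𝔞` spanned by the monomials of large weight. -/
def weightMod (A : Finset (Fin n)) (t d : ℤ) : GrMod q :=
  ((free q).sub (weightIdeal q A t) (weightIdeal_homogeneous A t)).twist (-d)

/-- The inclusion `𝔞(-d) ⊆ S(-d)`. -/
def weightι (A : Finset (Fin n)) (t d : ℤ) : weightMod q A t d ⟶ S q (-d) :=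
  ⟨(weightIdeal q A t).subtype, fun _ _ h => h⟩

theorem exists_weight_maps {A : Finset (Fin n)} {i : Fin n} (hi : i ∉ A) (t : ℤ) :
    ∃ (f : weightIdeal q A t →ₗ[PolyRing n]
        (weightIdeal q A t × weightIdeal q (insert i A) (t - |q i|)))
      (g : (weightIdeal q A t × weightIdeal q (insert i A) (t - |q i|)) →ₗ[PolyRing n]
        weightIdeal q (insert i A) t),
      (∀ s, (f s).1.1 = MvPolynomial.X i * s.1) ∧ (∀ s, (f s).2.1 = s.1) ∧
      (∀ x, (g x).1 = x.1.1 - MvPolynomial.X i * x.2.1) := by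
  refine ⟨LinearMap.prod (LinearMap.lsmul (PolyRing n) _ (MvPolynomial.X i))
    (Submodule.inclusion (weightIdeal_mono (Finset.subset_insert i A)
      (sub_le_self t (abs_nonneg (q i))))),
    LinearMap.coprod (Submodule.inclusion (weightIdeal_mono (Finset.subset_insert i A) le_rfl))
      (-((LinearMap.lsmul (PolyRing n) (PolyRing n) (MvPolynomial.X i)).restrict
        fun s hs => X_mul_mem_weightIdeal_insert hi hs)), fun s => rfl, fun s => rfl, fun x => ?_⟩
  rw [LinearMap.coprod_apply, LinearMap.neg_apply, ← sub_eq_add_neg, AddSubgroupClass.coe_sub]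
  rfl

/-- Dividing monomials by `xᵢ`, the sequence
`0 → 𝔞_A(t) → 𝔞_A(t) ⊕ 𝔞_{A ∪ i}(t - |qᵢ|) → 𝔞_{A ∪ i}(t) → 0` with first map `s ↦ (xᵢ s, s)` and
second map `(a, b) ↦ a - xᵢ b`, where `𝔞_A(t)` is the ideal `weightIdeal q A t`. -/
theorem weight_shortExact {A : Finset (Fin n)} {i : Fin n} (hi : i ∉ A) (t d : ℤ) :
    ∃ (f : weightMod q A t (d + q i) ⟶
        prod (weightMod q A t d) (weightMod q (insert i A) (t - |q i|) (d + q i)))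
      (g : prod (weightMod q A t d) (weightMod q (insert i A) (t - |q i|) (d + q i)) ⟶
        weightMod q (insert i A) t d) (w : f ≫ g = 0), (ShortComplex.mk f g w).ShortExact := by
  have hX : ∀ {k : ℤ} {s : PolyRing n}, s ∈ (free q).gr (-(d + q i) + k) →
      MvPolynomial.X i * s ∈ (free q).gr (-d + k) := fun {k s} hs => by
    have h := (free q).smul_mem (MvPolynomial.isWeightedHomogeneous_X ℂ q i) hs
    rwa [show q i + (-(d + q i) + k) = -d + k by ring] at h
  obtain ⟨fl, gl, h1, h2, hgl⟩ := exists_weight_maps (q := q) hi t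
  have hfg : ∀ s, gl (fl s) = 0 := fun s => Subtype.ext (by
    rw [hgl, h1, h2, sub_self]; rfl)
  have hfl : Function.Injective fl := fun s s' h => Subtype.ext (by rw [← h2, ← h2, h])
  have hgs : Function.Surjective gl := fun s => by
    obtain ⟨a, ha, b, hb, h⟩ := exists_of_mem_weightIdeal_insert hi s.2
    exact ⟨(⟨a, ha⟩, ⟨b, hb⟩), Subtype.ext ((hgl _).trans h.symm)⟩
  have hex : ∀ x, gl x = 0 → ∃ s, fl s = x := fun x hx => by
    have h3 : x.1.1 = MvPolynomial.X i * x.2.1 :=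
      sub_eq_zero.1 ((hgl x).symm.trans (congrArg Subtype.val hx))
    exact ⟨⟨x.2.1, (X_mul_mem_weightIdeal_iff hi).1 (h3 ▸ x.1.2)⟩,
      Prod.ext (Subtype.ext ((h1 _).trans h3.symm)) (Subtype.ext (h2 _))⟩
  let f : weightMod q A t (d + q i) ⟶
      prod (weightMod q A t d) (weightMod q (insert i A) (t - |q i|) (d + q i)) :=
    ⟨fl, fun k s hs =>
      ⟨Eq.mpr (congrArg (fun s : PolyRing n => s ∈ (free q).gr (-d + k)) (h1 s)) (hX hs),
       Eq.mpr (congrArg (fun s : PolyRing n => s ∈ (free q).gr (-(d + q i) + k)) (h2 s)) hs⟩⟩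
  let g : prod (weightMod q A t d) (weightMod q (insert i A) (t - |q i|) (d + q i)) ⟶
      weightMod q (insert i A) t d := ⟨gl, fun k x hx =>
    Eq.mpr (congrArg (fun s : PolyRing n => s ∈ (free q).gr (-d + k)) (hgl x))
      (AddSubgroup.sub_mem _ hx.1 (hX hx.2))⟩
  have w : f ≫ g = 0 := hom_ext hfg
  exact ⟨f, g, w, shortExact_of f g w hfl hgs hex⟩

theorem ResClass.prod {Q : ℕ → GrMod q → Prop} (h : ResClass Q) {c : ℕ} {M N : GrMod q}
    (hM : Q c M) (hN : Q c N) : Q c (GrMod.prod M N) := by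
  let f : M ⟶ GrMod.prod M N := ⟨LinearMap.inl _ _ _, fun k _ h => ⟨h, (N.gr k).zero_mem⟩⟩
  let g : GrMod.prod M N ⟶ N := ⟨LinearMap.snd _ _ _, fun _ _ h => h.2⟩
  have w : f ≫ g = 0 := by ext m; rfl
  refine h.ext c _ (shortExact_of f g w LinearMap.inl_injective Prod.snd_surjective ?_) hM hN
  intro x hx
  exact ⟨x.1, Prod.ext rfl hx.symm⟩

/-- The ideals of monomials of large weight are resolved by free modules `S(-d)` with `d` in any
window containing the degrees of the generators and `∑_{i ∈ A} |qᵢ|` consecutive degrees. -/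
theorem ResClass.weightMod {Q : ℕ → GrMod q → Prop} (h : ResClass Q) {win : ℤ → Prop}
    (hS : ∀ d, win d → Q 0 (S q (-d))) {ε : ℤ} (A : Finset (Fin n))
    (hA : ∀ i ∈ A, 0 < |q i| ∧ q i = ε * |q i|) (t d : ℤ)
    (hwin : ∀ z, max t 0 ≤ z → z ≤ max (t + ∑ i ∈ A, |q i| - 1) 0 → win (d + ε * z)) :
    Q A.card (weightMod q A t d) := by
  have base : ∀ (A : Finset (Fin n)) (t d : ℤ), t ≤ 0 → win d →
      Q A.card (GrMod.weightMod q A t d) := by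
    intro A t d ht hd
    have hs : ∀ s : PolyRing n, s ∈ weightIdeal q A t := fun s => by
      rw [weightIdeal_eq_top ht]
      exact Submodule.mem_top
    exact h.mono (Nat.zero_le _) (h.of_bijective (weightι A t d)
      ⟨Subtype.val_injective, fun s => ⟨⟨s, hs s⟩, rfl⟩⟩ (hS d hd))
  have hbase : ∀ (A : Finset (Fin n)) (t d : ℤ), t ≤ 0 →
      (∀ z, max t 0 ≤ z → z ≤ max (t + ∑ i ∈ A, |q i| - 1) 0 → win (d + ε * z)) →
      Q A.card (GrMod.weightMod q A t d) := by
    intro A t d ht hw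
    refine base A t d ht ?_
    have := hw 0 (by omega) (by omega)
    rwa [mul_zero, add_zero] at this
  induction A using Finset.induction_on generalizing t d with
  | empty =>
    rcases le_or_gt t 0 with ht | ht
    · exact hbase ∅ t d ht hwin
    · refine h.zero _ _ ⟨fun x y => ?_⟩
      have key : ∀ x : weightIdeal q (∅ : Finset (Fin n)) t, x = 0 := fun x => by
        refine Subtype.ext (MvPolynomial.support_eq_empty.1 (Finset.eq_empty_iff_forall_notMem.2
          fun b hb => ?_))
        have h1 := mem_weightIdeal.1 x.2 b hb
        rw [Finset.sum_empty] at h1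
        omega
      exact (key x).trans (key y).symm
  | insert i A hi ih =>
    have hi1 := hA i (Finset.mem_insert_self i A)
    have hN : 0 ≤ ∑ j ∈ A, |q j| := Finset.sum_nonneg fun j _ => abs_nonneg _
    obtain ⟨m, hm⟩ : ∃ m : ℕ, t ≤ m := ⟨t.toNat, Int.self_le_toNat t⟩
    induction m generalizing t d with
    | zero => exact hbase _ t d (by exact_mod_cast hm) hwin
    | succ m ihm =>
      rcases le_or_gt t 0 with ht | ht
      · exact hbase _ t d ht hwin
      rw [Finset.sum_insert hi] at hwin
      obtain ⟨f, g, w, hX⟩ := weight_shortExact (q := q) hi t d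
      have hw : ∀ z, d + q i + ε * z = d + ε * (z + |q i|) := fun z => by
        rw [mul_add, ← hi1.2]; ring
      rw [Finset.card_insert_of_notMem hi]
      refine h.coker _ _ hX ?_ (h.prod (h.succ _ _ ?_) ?_)
      · refine ih (fun j hj => hA j (Finset.mem_insert_of_mem hj)) _ _ fun z h1 h2 => ?_
        rw [hw]
        exact hwin _ (by omega) (by omega)
      · exact ih (fun j hj => hA j (Finset.mem_insert_of_mem hj)) _ _ fun z h1 h2 =>
          hwin _ (by omega) (by omega)
      · have := ihm (t - |q i|) (d + q i) (fun z h1 h2 => by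
          rw [Finset.sum_insert hi] at h2
          rw [hw]
          exact hwin _ (by omega) (by omega)) (by push_cast at hm; omega)
        rwa [Finset.card_insert_of_notMem hi] at this

end Window

end GrMod

/-! ### Auslander's criterion for the global dimension -/

section Auslander

universe u

variable {A : Type u} [Ring A]

/-- Baer's criterion in terms of extensions. -/
theorem injective_of_ext_eq_zero (N : ModuleCat.{u} A)
    (h : ∀ (I : Submodule A A) (e : Abelian.Ext (ModuleCat.of A (A ⧸ I)) N 1), e = 0) :
    Injective N := by
  have hB : Module.Baer A N := by
    intro I g
    let X : ShortComplex (ModuleCat.{u} A) := ShortComplex.mk (ModuleCat.ofHom I.subtype)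
      (ModuleCat.ofHom I.mkQ) (by ext x; exact (Submodule.Quotient.mk_eq_zero I).2 x.2)
    have hX : X.ShortExact :=
      { exact := (ShortComplex.moduleCat_exact_iff _).2 fun x hx =>
          ⟨⟨x, (Submodule.Quotient.mk_eq_zero I).1 hx⟩, rfl⟩
        mono_f := (ModuleCat.mono_iff_injective _).2 Subtype.val_injective
        epi_g := (ModuleCat.epi_iff_surjective _).2 I.mkQ_surjective }
    obtain ⟨y, hy⟩ := Abelian.Ext.contravariant_sequence_exact₁ hX N
      (Abelian.Ext.mk₀ (ModuleCat.ofHom g)) (n₁ := 1) (by norm_num) (h I _)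
    obtain ⟨f, rfl⟩ := (Abelian.Ext.mk₀_bijective _ _).2 y
    rw [Abelian.Ext.mk₀_comp_mk₀] at hy
    have hf := (Abelian.Ext.mk₀_bijective _ _).1 hy
    exact ⟨f.hom, fun x hx => congrArg (fun l : X.X₁ ⟶ N => l.hom ⟨x, hx⟩) hf⟩
  have := hB.injective
  exact Module.injective_object_of_injective_module A N

/-- Vanishing of `Ext` of cyclic modules in one degree bounds the injective dimension, by shifting
dimensions down to Baer's criterion. -/
theorem hasInjectiveDimensionLT_of_cyclic (g : ℕ) (N : ModuleCat.{u} A)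
    (h : ∀ (I : Submodule A A) (e : Abelian.Ext (ModuleCat.of A (A ⧸ I)) N (g + 1)), e = 0) :
    HasInjectiveDimensionLT N (g + 1) := by
  induction g generalizing N with
  | zero =>
    have := injective_of_ext_eq_zero N h
    infer_instance
  | succ g ih =>
    obtain ⟨J, _, f, _⟩ := EnoughInjectives.presentation N
    have hX : (ShortComplex.mk f (cokernel.π f) (cokernel.condition f)).ShortExact :=
      { exact := ShortComplex.exact_cokernel f }
    refine hX.hasInjectiveDimensionLT_X₁ (g + 1) (ih _ fun I e => ?_)
      (hasInjectiveDimensionLT_of_ge J 1 _ (by omega))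
    obtain ⟨y, hy⟩ := Abelian.Ext.covariant_sequence_exact₃ _ hX e rfl (h I _)
    rw [← hy, y.eq_zero_of_hasInjectiveDimensionLT 1 (by omega), Abelian.Ext.zero_comp]

/-- Auslander's criterion: the global dimension is detected by the cyclic modules. -/
theorem hasFiniteGlobalDimension_of_cyclic (g : ℕ)
    (h : ∀ I : Submodule A A, HasProjectiveDimensionLE (ModuleCat.of A (A ⧸ I)) g) :
    HasFiniteGlobalDimension A := by
  refine ⟨g, fun M => HasProjectiveDimensionLT.mk fun i hi N e => ?_⟩
  have := hasInjectiveDimensionLT_of_cyclic g N fun I e =>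
    have := h I
    e.eq_zero_of_hasProjectiveDimensionLT (g + 1) le_rfl
  exact e.eq_zero_of_hasInjectiveDimensionLT (g + 1) hi

end Auslander

namespace GrMod

/-! ### Graded modules restricted to a window of degrees -/

section Proj

variable {n : ℕ} {q : Fin n → ℤ}

theorem twist_proj (M : GrMod q) (a k : ℤ) (m : M.carrier) :
    (M.twist a).proj k m = M.proj (a + k) m := by
  obtain ⟨t, ht⟩ := M.exists_sum_proj m
  have h1 : m = ∑ j ∈ insert (a + k) t, M.proj j m := ht _ (Finset.subset_insert _ _)
  have h2 : (M.twist a).proj k m = ∑ j ∈ insert (a + k) t, (M.twist a).proj k (M.proj j m) :=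
    (congrArg _ h1).trans (map_sum ((M.twist a).proj k) _ _)
  have h3 : ∀ j, M.proj j m ∈ (M.twist a).gr (j - a) := fun j => by
    change _ ∈ M.gr (a + (j - a))
    rw [add_sub_cancel]
    exact M.proj_mem j m
  rw [h2, Finset.sum_eq_single (a + k)]
  · have h4 := h3 (a + k)
    rw [add_sub_cancel_left] at h4
    exact (M.twist a).proj_same k _ h4
  · intro j _ hj
    exact (M.twist a).proj_ne _ k _ (h3 j) (fun h => hj (by omega))
  · intro h
    exact absurd (Finset.mem_insert_self _ t) h

/-- The homogeneous parts of a multiple of a homogeneous element. -/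
theorem proj_smul_of_mem (M : GrMod q) {k : ℤ} {x : M.carrier} (hx : x ∈ M.gr k) (j : ℤ)
    (s : PolyRing n) :
    M.proj j (s • x) = MvPolynomial.weightedHomogeneousComponent q (j - k) s • x := by
  have h := lin_proj (ofMem M (-k) x (by rwa [neg_neg])) j s
  have h1 : (S q (-k)).proj j s = MvPolynomial.weightedHomogeneousComponent q (j - k) s := by
    refine (twist_proj (free q) (-k) j s).trans ?_
    rw [free_proj, neg_add_eq_sub]
  refine h.symm.trans ?_
  change (show PolyRing n from (S q (-k)).proj j s) • x = _
  rw [h1]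

theorem span_homogeneous (M : GrMod q) (s : Set M.carrier) (hs : ∀ x ∈ s, ∃ k, x ∈ M.gr k) :
    ∀ m ∈ Submodule.span (PolyRing n) s, ∀ k, M.proj k m ∈ Submodule.span (PolyRing n) s := by
  intro m hm k
  induction hm using Submodule.closure_induction with
  | zero => rw [map_zero]; exact Submodule.zero_mem _
  | add x y _ _ hx hy => rw [map_add]; exact Submodule.add_mem _ hx hy
  | smul_mem r x hx =>
    obtain ⟨j, hj⟩ := hs x hx
    rw [proj_smul_of_mem M hj]
    exact Submodule.smul_mem _ _ (Submodule.subset_span hx)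

end Proj

end GrMod

/-- A ring of `N × N` matrices over `S`, whose entry in row `j` and column `i` runs through the
homogeneous polynomials of degree `j - i`. -/
structure IsGradedMatrixRing {n : ℕ} (q : Fin n → ℤ) {N : ℕ} {A : Type*} [Ring A]
    (m : A →+* Matrix (Fin N) (Fin N) (PolyRing n)) : Prop where
  injective : Function.Injective m
  mem_range : ∀ B, (∃ f, m f = B) ↔
    ∀ i j, MvPolynomial.IsWeightedHomogeneous q (B j i) ((j : ℤ) - i)

namespace IsGradedMatrixRing

section Window

open GrMod

variable {n : ℕ} {q : Fin n → ℤ} {N : ℕ} {A : Type 1} [Ring A]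
  {m : A →+* Matrix (Fin N) (Fin N) (PolyRing n)}

theorem homogeneous (h : IsGradedMatrixRing q m) (f : A) (i j : Fin N) :
    MvPolynomial.IsWeightedHomogeneous q (m f j i) ((j : ℤ) - i) :=
  (h.mem_range _).1 ⟨f, rfl⟩ i j

/-- The sum of the homogeneous parts of degrees `0, …, N - 1` of a graded module. -/
def Window (_ : IsGradedMatrixRing q m) (G : GrMod q) : Type :=
  AddSubgroup.pi (Set.univ : Set (Fin N)) fun i => G.gr (i : ℕ)

variable (h : IsGradedMatrixRing q m)

instance (G : GrMod q) : AddCommGroup (h.Window G) :=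
  inferInstanceAs (AddCommGroup (AddSubgroup.pi (Set.univ : Set (Fin N)) fun i => G.gr (i : ℕ)))

variable {h} in
@[ext]
theorem Window.ext {G : GrMod q} {x y : h.Window G} (hxy : ∀ i, x.1 i = y.1 i) : x = y :=
  Subtype.ext (funext hxy)

theorem Window.mem {G : GrMod q} (x : h.Window G) (i : Fin N) : x.1 i ∈ G.gr (i : ℕ) :=
  x.2 i trivial

instance (G : GrMod q) : Module A (h.Window G) where
  smul f x := ⟨fun j => ∑ i, m f j i • x.1 i, fun j _ => AddSubgroup.sum_mem _ fun i _ => by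
    have := G.smul_mem (h.homogeneous f i j) (Window.mem h x i)
    rwa [sub_add_cancel] at this⟩
  one_smul x := by
    ext j
    change ∑ i, m 1 j i • x.1 i = x.1 j
    simp [Matrix.one_apply]
  mul_smul f g x := by
    ext j
    change ∑ i, m (f * g) j i • x.1 i = ∑ k, m f j k • ∑ i, m g k i • x.1 i
    simp_rw [map_mul, Matrix.mul_apply, Finset.smul_sum, Finset.sum_smul, mul_smul]
    exact Finset.sum_comm
  smul_zero f := by
    ext j
    change ∑ i, m f j i • (0 : G.carrier) = 0
    simp
  smul_add f x y := by
    ext j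
    change ∑ i, m f j i • (x.1 i + y.1 i) = ∑ i, m f j i • x.1 i + ∑ i, m f j i • y.1 i
    simp_rw [smul_add, Finset.sum_add_distrib]
  add_smul f g x := by
    ext j
    change ∑ i, m (f + g) j i • x.1 i = ∑ i, m f j i • x.1 i + ∑ i, m g j i • x.1 i
    simp_rw [map_add, Matrix.add_apply, add_smul, Finset.sum_add_distrib]
  zero_smul x := by
    ext j
    change ∑ i, m 0 j i • x.1 i = 0
    simp

/-- The map of windows induced by a map of graded modules. -/
def Window.map {G G' : GrMod q} (f : G ⟶ G') : h.Window G →ₗ[A] h.Window G' where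
  toFun x := ⟨fun i => f.lin (x.1 i), fun i _ => f.map_mem _ _ (Window.mem h x i)⟩
  map_add' x y := by
    ext i
    exact map_add f.lin _ _
  map_smul' a x := by
    ext j
    change f.lin (∑ i, m a j i • x.1 i) = ∑ i, m a j i • f.lin (x.1 i)
    rw [map_sum]
    exact Finset.sum_congr rfl fun i _ => map_smul f.lin _ _

/-- The window as an object of the category of modules. -/
def windowObj (G : GrMod q) : ModuleCat.{1} A := ModuleCat.of A (ULift.{1} (h.Window G))

/-- The window of a morphism. -/
def windowMap {G G' : GrMod q} (f : G ⟶ G') : h.windowObj G ⟶ h.windowObj G' :=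
  ModuleCat.ofHom (ULift.moduleEquiv.symm.toLinearMap ∘ₗ Window.map h f ∘ₗ
    ULift.moduleEquiv.toLinearMap)

theorem window_shortExact {X : ShortComplex (GrMod q)} (hX : X.ShortExact) :
    ∃ w, (ShortComplex.mk (h.windowMap X.f) (h.windowMap X.g) w).ShortExact := by
  have hm := hX.mono_f
  have he := hX.epi_g
  have hinj := injective_of_mono X.f
  have hsurj := surjective_of_epi X.g
  have w : h.windowMap X.f ≫ h.windowMap X.g = 0 := by
    ext x
    refine ULift.down_injective (Window.ext fun i => ?_)
    exact congrArg (fun l : X.X₁ ⟶ X.X₃ => l.lin (x.down.1 i)) X.zero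
  refine ⟨w, { exact := ?_, mono_f := ?_, epi_g := ?_ }⟩
  · rw [ShortComplex.moduleCat_exact_iff]
    intro x hx
    have hx' : ∀ i, X.g.lin (x.down.1 i) = 0 := fun i =>
      congrArg (fun z : ULift.{1} (h.Window X.X₃) => z.down.1 i) hx
    choose a ha using fun i => exact_apply hX _ (hx' i)
    refine ⟨ULift.up ⟨a, fun i _ => mem_gr_of_injective X.f hinj _ _ ?_⟩, ?_⟩
    · rw [ha]
      exact Window.mem h _ i
    · exact ULift.down_injective (Window.ext ha)
  · rw [ModuleCat.mono_iff_injective]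
    intro x y hxy
    refine ULift.down_injective (Window.ext fun i => hinj ?_)
    exact congrArg (fun z : ULift.{1} (h.Window X.X₂) => z.down.1 i) hxy
  · rw [ModuleCat.epi_iff_surjective]
    intro y
    choose a ha using fun i => hsurj (y.down.1 i)
    refine ⟨ULift.up ⟨fun i => X.X₂.proj (i : ℕ) (a i), fun i _ => X.X₂.proj_mem _ _⟩, ?_⟩
    refine ULift.down_injective (Window.ext fun i => ?_)
    change X.g.lin (X.X₂.proj (i : ℕ) (a i)) = _
    rw [lin_proj, ha]
    exact X.X₃.proj_same _ _ (Window.mem h _ i)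

theorem isZero_windowObj {G : GrMod q} (hG : ∀ (i : Fin N), ∀ x ∈ G.gr (i : ℕ), x = 0) :
    IsZero (h.windowObj G) := by
  have : Subsingleton (h.windowObj G) := ⟨fun x y => ULift.down_injective (Window.ext fun i =>
    (hG i _ (Window.mem h _ i)).trans (hG i _ (Window.mem h _ i)).symm)⟩
  exact ModuleCat.isZero_of_subsingleton _

/-- Bounded projective dimension of the window, shifted by a constant. -/
theorem resClass (b : ℕ) :
    ResClass (fun c G => HasProjectiveDimensionLT (h.windowObj (q := q) G) (b + c + 1)) where
  zero c G hG := by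
    have := (h.isZero_windowObj (G := G) fun i x _ => Subsingleton.elim _ _).hasProjectiveDimensionLT_zero
    exact hasProjectiveDimensionLT_of_ge _ 0 _ (Nat.zero_le _)
  ext c X hX h1 h3 := by
    obtain ⟨w, hw⟩ := h.window_shortExact hX
    exact hw.hasProjectiveDimensionLT_X₂ _ h1 h3
  coker c X hX h1 h2 := by
    obtain ⟨w, hw⟩ := h.window_shortExact hX
    exact hw.hasProjectiveDimensionLT_X₃ _ h1 h2
  succ c G hG := hasProjectiveDimensionLT_of_ge _ _ _ (Nat.le_succ _)

/-- For `d` in the window, the window of `S(-d)` is the column `d` of the matrix ring, a direct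
summand of `A`. -/
theorem windowObj_S_projective (d : ℕ) (hd : d < N) :
    HasProjectiveDimensionLT (h.windowObj (S q (-(d : ℤ)))) 1 := by
  let d' : Fin N := ⟨d, hd⟩
  -- the element with a prescribed column `d`
  have hcol : ∀ x : h.Window (S q (-(d : ℤ))), ∃ f, m f =
      Matrix.of fun j i => if i = d' then (x.1 j : PolyRing n) else 0 := fun x => by
    refine (h.mem_range _).2 fun i j => ?_
    rw [Matrix.of_apply]
    split_ifs with hi
    · subst hi
      have := Window.mem h x j
      change MvPolynomial.IsWeightedHomogeneous q _ (-(d : ℤ) + (j : ℕ)) at this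
      rwa [neg_add_eq_sub] at this
    · exact MvPolynomial.isWeightedHomogeneous_zero ℂ q _
  choose c hc using hcol
  have hc' : ∀ x j i, m (c x) j i = if i = d' then (x.1 j : PolyRing n) else 0 := fun x j i => by
    rw [hc]; rfl
  let s : h.Window (S q (-(d : ℤ))) →ₗ[A] A :=
    { toFun := c
      map_add' := fun x y => h.injective (Matrix.ext fun j i => by
        rw [map_add, Matrix.add_apply, hc', hc', hc']
        split_ifs
        · rfl
        · exact (add_zero _).symm)
      map_smul' := fun f x => h.injective (Matrix.ext fun j i => by
        rw [RingHom.id_apply, smul_eq_mul, map_mul, Matrix.mul_apply, hc']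
        simp only [hc']
        split_ifs
        · rfl
        · exact (Finset.sum_eq_zero fun _ _ => mul_zero _).symm) }
  let p : A →ₗ[A] h.Window (S q (-(d : ℤ))) :=
    { toFun := fun f => ⟨fun j => m f j d', fun j _ => by
        change MvPolynomial.IsWeightedHomogeneous q _ (-(d : ℤ) + (j : ℕ))
        rw [neg_add_eq_sub]
        exact h.homogeneous f d' j⟩
      map_add' := fun f g => Window.ext fun j => by
        change m (f + g) j d' = m f j d' + m g j d'
        rw [map_add, Matrix.add_apply]
      map_smul' := fun f g => Window.ext fun j => by
        change m (f * g) j d' = ∑ i, m f j i * m g i d'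
        rw [map_mul, Matrix.mul_apply] }
  have hps : p ∘ₗ s = LinearMap.id := by
    ext x j
    change m (c x) j d' = x.1 j
    rw [hc', if_pos rfl]
  have h1 : Module.Projective A (h.Window (S q (-(d : ℤ)))) := Module.Projective.of_split s p hps
  have h2 : Module.Projective A (ULift.{1} (h.Window (S q (-(d : ℤ))))) :=
    Module.Projective.of_equiv ULift.moduleEquiv.symm
  have h3 : Projective (h.windowObj (S q (-(d : ℤ)))) := (IsProjective.iff_projective _).1 h2
  infer_instance

/-- All free modules have windows of bounded projective dimension: outside the window one replaces
`S(-d)` by the submodule spanned by the monomials of large weight in the variables of one sign,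
which has the same window. -/
theorem windowObj_S {p p' : Finset (Fin n)} (hp : IsSide q p 1 N) (hp' : IsSide q p' (-1) N)
    (d : ℤ) : HasProjectiveDimensionLT (h.windowObj (S q (-d))) (n + 0 + 1) := by
  have key : ∀ (ε : ℤ) (p : Finset (Fin n)) (t : ℤ), IsSide q p ε N → 0 < t →
      (∀ j : ℤ, 0 ≤ j → j < N → t ≤ ε * (j - d)) →
      (∀ z : ℤ, t ≤ z → z ≤ t + N - 1 → 0 ≤ d + ε * z ∧ d + ε * z < N) →
      HasProjectiveDimensionLT (h.windowObj (S q (-d))) (n + 0 + 1) := by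
    intro ε p t hside ht h1 h2
    have hmem : ∀ i ∈ p, |q i| = ε * q i := fun i hi => by rw [hside.abs_eq, if_pos hi]
    have hN : ∑ i ∈ p, |q i| = N := (Finset.sum_congr rfl hmem).trans hside.sum_mem
    have hw : HasProjectiveDimensionLT (h.windowObj (weightMod q p t d)) (0 + p.card + 1) := by
      refine (h.resClass 0).weightMod (win := fun d => 0 ≤ d ∧ d < N) (ε := ε) ?_ p ?_ t d ?_
      · rintro d ⟨hd, hd'⟩
        obtain ⟨d, rfl⟩ := Int.eq_ofNat_of_zero_le hd
        exact h.windowObj_S_projective d (by exact_mod_cast hd')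
      · intro i hi
        have := (hside.mem i).1 hi
        rw [hmem i hi, ← mul_assoc, hside.mul_self, one_mul]
        exact ⟨this, rfl⟩
      · intro z hz1 hz2
        rw [hN] at hz2
        have := hside.nonempty
        have hN0 : (0 : ℤ) < N := by
          rw [← hN]
          obtain ⟨i, hi⟩ := this
          refine lt_of_lt_of_le ?_ (Finset.single_le_sum (f := fun i => |q i|)
            (fun i _ => abs_nonneg _) hi)
          rw [hmem i hi]
          exact (hside.mem i).1 hi
        exact h2 z (by omega) (by omega)
    have hinj : Function.Injective (weightι (q := q) p t d).lin := Subtype.val_injective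
    obtain ⟨w, hX⟩ := h.window_shortExact (shortExact_coker _ hinj)
    have hz : IsZero (h.windowObj (quot (S q (-d)) (LinearMap.range (weightι (q := q) p t d).lin)
        (range_homogeneous _))) := by
      refine h.isZero_windowObj fun j x hx => ?_
      obtain ⟨s, hs, rfl⟩ := hx
      refine (Submodule.Quotient.mk_eq_zero _).2 ⟨⟨s, mem_weightIdeal.2 fun b hb => ?_⟩, rfl⟩
      have hb1 := hs (MvPolynomial.mem_support_iff.1 hb)
      have hb2 : ∑ i, (b i : ℤ) * q i = (j : ℤ) - d := by
        rw [Finsupp.weight_apply, Finsupp.sum_fintype _ _ (fun i => zero_nsmul (q i))] at hb1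
        simp only [nsmul_eq_mul] at hb1
        rw [hb1]
        ring
      refine (h1 j (by omega) (by have := j.2; omega)).trans ?_
      rw [← hb2, Finset.mul_sum, ← Finset.sum_add_sum_compl p]
      have h3 : ∀ i, ε * (b i * q i) = b i * (ε * q i) := fun i => by ring
      have h4 : ∑ i ∈ pᶜ, ε * (b i * q i) ≤ 0 := Finset.sum_nonpos fun i hi => by
        rw [h3]
        exact mul_nonpos_of_nonneg_of_nonpos (by positivity)
          (not_lt.1 fun hc => Finset.mem_compl.1 hi ((hside.mem i).2 hc))
      have h5 : ∑ i ∈ p, ε * (b i * q i) = ∑ i ∈ p, (b i : ℤ) * |q i| :=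
        Finset.sum_congr rfl fun i hi => by rw [h3, hmem i hi]
      omega
    have hz' := hz.hasProjectiveDimensionLT_zero
    have hc := Finset.card_le_univ p
    rw [Fintype.card_fin] at hc
    exact hX.hasProjectiveDimensionLT_X₂ _
      (hasProjectiveDimensionLT_of_ge _ (0 + p.card + 1) _ (by omega))
      (hasProjectiveDimensionLT_of_ge _ 0 _ (Nat.zero_le _))
  rcases lt_or_ge d 0 with hd | hd
  · exact key 1 p (-d) hp (by omega) (fun j _ _ => by omega) (fun z _ _ => by omega)
  rcases lt_or_ge d N with hd' | hd'
  · obtain ⟨d, rfl⟩ := Int.eq_ofNat_of_zero_le hd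
    have := h.windowObj_S_projective d (by exact_mod_cast hd')
    exact hasProjectiveDimensionLT_of_ge _ 1 _ (by omega)
  · exact key (-1) p' (d - N + 1) hp' (by omega) (fun j _ _ => by omega) (fun z _ _ => by omega)

theorem windowObj_bounded {p p' : Finset (Fin n)} (hp : IsSide q p 1 N) (hp' : IsSide q p' (-1) N)
    (G : GrMod q) : HasProjectiveDimensionLT (h.windowObj G) (n + n + 1) :=
  (h.resClass n).hilbert (fun k => by
    have := h.windowObj_S hp hp' (-k)
    rwa [neg_neg] at this) G

/-- The graded module `S(0) ⊕ S(-1) ⊕ ⋯ ⊕ S(1 - N)`. -/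
def freeSum (q : Fin n → ℤ) (N : ℕ) : GrMod q where
  carrier := Fin N → PolyRing n
  gr k := AddSubgroup.pi (Set.univ : Set (Fin N)) fun i => (free q).gr (k - (i : ℕ))
  isInternal := by
    refine isInternal_of_proj _
      (fun k => AddMonoidHom.mk' (fun x i => (free q).proj (k - (i : ℕ)) (x i))
        (fun x y => funext fun i => map_add ((free q).proj (k - (i : ℕ))) (x i) (y i))) ?_ ?_ ?_ ?_
    · exact fun k x i _ => (free q).proj_mem _ (x i)
    · exact fun k x hx => funext fun i => (free q).proj_same _ (x i) (hx i trivial)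
    · exact fun j k x hx hjk => funext fun i => (free q).proj_ne _ _ (x i) (hx i trivial)
        (fun h => hjk (by omega))
    · intro x
      choose t ht using fun i => (free q).exists_sum_proj (x i)
      refine ⟨Finset.univ.biUnion fun i : Fin N => (t i).map (addRightEmbedding ((i : ℕ) : ℤ)), ?_⟩
      refine funext fun i => ?_
      rw [Finset.sum_apply]
      have h1 := ht i ((Finset.univ.biUnion fun i : Fin N =>
        (t i).map (addRightEmbedding ((i : ℕ) : ℤ))).map (addRightEmbedding (-((i : ℕ) : ℤ)))) (by
          intro k hk
          rw [Finset.mem_map]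
          exact ⟨k + (i : ℕ), Finset.mem_biUnion.2 ⟨i, Finset.mem_univ i,
            Finset.mem_map.2 ⟨k, hk, rfl⟩⟩, by simp⟩)
      rw [Finset.sum_map] at h1
      refine h1.trans (Finset.sum_congr rfl fun k _ => ?_)
      simp only [addRightEmbedding_apply, ← sub_eq_add_neg]
      rfl
  smul_mem hs hx i _ := by
    have := (free q).smul_mem hs (hx i trivial)
    rwa [← add_sub_assoc] at this

/-- A cyclic module is the window of a graded module: the quotient of the free module whose
window is `A` by the submodule generated by the rows of the elements of the ideal. -/
theorem exists_cyclic_equiv (I : Submodule A A) :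
    ∃ G : GrMod q, Nonempty ((A ⧸ I) ≃ₗ[A] h.Window G) := by
  let F := freeSum q N
  have hrow : ∀ (f : A) (j : Fin N), (m f j : Fin N → PolyRing n) ∈ F.gr (j : ℕ) := fun f j i _ =>
    h.homogeneous f i j
  let s : Set F.carrier := {x | ∃ f ∈ I, ∃ j, x = m f j}
  have hs : ∀ x ∈ s, ∃ k, x ∈ F.gr k := by
    rintro _ ⟨f, -, j, rfl⟩
    exact ⟨_, hrow f j⟩
  let P := Submodule.span (PolyRing n) s
  let G := F.quot P (span_homogeneous F s hs)
  let φ : A →ₗ[A] h.Window G :=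
    { toFun := fun f => ⟨fun j => P.mkQ (m f j), fun j _ => ⟨_, hrow f j, rfl⟩⟩
      map_add' := fun f g => Window.ext fun j => by
        change P.mkQ (m (f + g) j) = P.mkQ (m f j) + P.mkQ (m g j)
        rw [map_add]
        rfl
      map_smul' := fun f g => Window.ext fun j => by
        change P.mkQ (m (f * g) j) = ∑ i, m f j i • P.mkQ (m g i)
        refine Eq.trans (congrArg P.mkQ (funext fun k => ?_))
          (map_sum P.mkQ (fun i => m f j i • (m g i : F.carrier)) Finset.univ)
        rw [map_mul, Matrix.mul_apply]
        exact (Finset.sum_apply k Finset.univ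
          fun i => m f j i • (m g i : Fin N → PolyRing n)).symm }
  refine ⟨G, ⟨(Submodule.quotEquivOfEq _ _ ?_).trans (φ.quotKerEquivOfSurjective ?_)⟩⟩
  · -- every row of degree `j` in the span is the `j`-th row of an element of the ideal
    have key : ∀ x ∈ P, ∀ j : Fin N, ∃ f ∈ I, ∀ k,
        m f k = if k = j then (F.proj (j : ℕ) x : Fin N → PolyRing n) else 0 := by
      intro x hx j
      induction hx using Submodule.closure_induction with
      | zero =>
        refine ⟨0, I.zero_mem, fun k => ?_⟩
        rw [map_zero, map_zero]
        exact (ite_self _).symm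
      | add x y _ _ hx hy =>
        obtain ⟨f, hf, hf'⟩ := hx
        obtain ⟨g, hg, hg'⟩ := hy
        refine ⟨f + g, I.add_mem hf hg, fun k => ?_⟩
        rw [map_add, map_add]
        change m f k + m g k = _
        rw [hf', hg']
        split_ifs
        · rfl
        · exact add_zero _
      | smul_mem r x hx =>
        obtain ⟨f, hf, l, rfl⟩ := hx
        obtain ⟨g, hg⟩ := (h.mem_range (Matrix.single j l
          (MvPolynomial.weightedHomogeneousComponent q ((j : ℤ) - l) r))).2 fun i k => by
            rw [Matrix.single_apply]
            split_ifs with hjk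
            · obtain ⟨rfl, rfl⟩ := hjk
              exact MvPolynomial.weightedHomogeneousComponent_mem q r _
            · exact MvPolynomial.isWeightedHomogeneous_zero ℂ q _
        refine ⟨g * f, I.smul_mem g hf, fun k => ?_⟩
        rw [proj_smul_of_mem F (hrow f l), map_mul, hg]
        ext1 i
        split_ifs with hk
        · subst hk
          rw [Matrix.single_mul_apply_same]
          rfl
        · rw [Matrix.single_mul_apply_of_ne _ _ _ _ _ hk]
          rfl
    ext f
    rw [LinearMap.mem_ker]
    constructor
    · intro hf
      exact Window.ext fun j => (Submodule.Quotient.mk_eq_zero P).2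
        (Submodule.subset_span ⟨f, hf, j, rfl⟩)
    · intro hf
      have h1 : ∀ j, (m f j : Fin N → PolyRing n) ∈ P := fun j =>
        (Submodule.Quotient.mk_eq_zero P).1 (congrArg (fun x : h.Window G => x.1 j) hf)
      choose g hg hg' using fun j => key _ (h1 j) j
      have h2 : f = ∑ j, g j := h.injective (by
        rw [map_sum]
        ext1 k i
        rw [Matrix.sum_apply, Finset.sum_eq_single k]
        · rw [hg', if_pos rfl, F.proj_same _ _ (hrow f k)]
        · intro j _ hj
          rw [hg', if_neg (Ne.symm hj)]
          rfl
        · exact fun hk => absurd (Finset.mem_univ k) hk)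
      rw [h2]
      exact I.sum_mem fun j _ => hg j
  · intro x
    choose y hy hy' using fun j => Window.mem h x j
    obtain ⟨f, hf⟩ := (h.mem_range (Matrix.of y)).2 fun i j => hy j i trivial
    exact ⟨f, Window.ext fun j => by
      change P.mkQ (m f j) = _
      rw [hf]
      exact hy' j⟩

end Window

/-- By Auslander's criterion it suffices to bound the projective dimension of cyclic modules. They are
windows of graded modules, which Hilbert's syzygy theorem resolves by free modules. -/
theorem hasFiniteGlobalDimension {n : ℕ} {q : Fin n → ℤ} {N : ℕ} {A : Type 1} [Ring A]
    {m : A →+* Matrix (Fin N) (Fin N) (PolyRing n)} (h : IsGradedMatrixRing q m)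
    {p p' : Finset (Fin n)} (hp : IsSide q p 1 N)
    (hp' : IsSide q p' (-1) N) : HasFiniteGlobalDimension A := by
  refine hasFiniteGlobalDimension_of_cyclic (n + n) fun I => ?_
  obtain ⟨G, ⟨e⟩⟩ := h.exists_cyclic_equiv I
  let i : h.windowObj G ≅ ModuleCat.of A (A ⧸ I) :=
    (e.trans ULift.moduleEquiv.symm).toModuleIso.symm
  exact @hasProjectiveDimensionLT_of_iso _ _ _ _ _ i _ (h.windowObj_bounded hp hp' G)

end IsGradedMatrixRing

/-! ### Graded modules inside the bounded derived category -/

section Embedding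

open Pretriangulated DerivedCategory

variable {n : ℕ} (q : Fin n → ℤ)

/-- The fully faithful embedding of graded modules into `D(gr-S)`, in degree `0`. -/
def toD : GrMod q ⥤ DGr q :=
  ObjectProperty.lift _ (singleFunctor (GrMod q) 0) fun M => (toDGr q M).property

instance : (toD q).Full := ObjectProperty.instFullFullSubcategoryLift _ _ _
instance : (toD q).Faithful :=  ObjectProperty.instFaithfulFullSubcategoryLift _ _ _
instance : (toD q).Additive where
  map_add {_ _ f g} := ObjectProperty.hom_ext _ ((singleFunctor (GrMod q) 0).map_add (f := f) (g := g))

variable {q}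

/-- A distinguished triangle of the unbounded derived category with bounded vertices is
distinguished in `D(gr-S)`. -/
theorem bounded_distinguished {X Y Z : DGr q} (f : X.obj ⟶ Y.obj) (g : Y.obj ⟶ Z.obj)
    (h : Z.obj ⟶ X.obj⟦(1 : ℤ)⟧) (hT : Triangle.mk f g h ∈ distTriang (DerivedCategory (GrMod q))) :
    Triangle.mk (ObjectProperty.homMk f : X ⟶ Y) (ObjectProperty.homMk g)
      (ObjectProperty.homMk (h ≫ ((ObjectProperty.ι _).commShiftIso (1 : ℤ)).inv.app X)) ∈
        distTriang (DGr q) := by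
  refine isomorphic_distinguished _ hT _
    (Triangle.isoMk _ _ (Iso.refl _) (Iso.refl _) (Iso.refl _) ?_ ?_ ?_)
  · exact (Category.comp_id _).trans (Category.id_comp _).symm
  · exact (Category.comp_id _).trans (Category.id_comp _).symm
  · change ((h ≫ ((ObjectProperty.ι _).commShiftIso (1 : ℤ)).inv.app X) ≫
      ((ObjectProperty.ι _).commShiftIso (1 : ℤ)).hom.app X) ≫
        (𝟙 X.obj)⟦(1 : ℤ)⟧' = 𝟙 _ ≫ h
    have h' := Iso.inv_hom_id_app ((ObjectProperty.ι
      (TStructure.t (C := GrMod q)).bounded).commShiftIso (1 : ℤ)) X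
    refine (congrArg₂ (· ≫ ·) (Category.assoc _ _ _) (CategoryTheory.Functor.map_id _ _)).trans ?_
    refine (Category.comp_id _).trans (Eq.trans ?_ (Category.id_comp _).symm)
    exact (congrArg (h ≫ ·) h').trans (Category.comp_id _)

/-- The connecting map of a short exact sequence of graded modules, in `D(gr-S)`. -/
def connecting {X : ShortComplex (GrMod q)} (hX : X.ShortExact) :
    (toD q).obj X.X₃ ⟶ ((toD q).obj X.X₁)⟦(1 : ℤ)⟧ :=
  ObjectProperty.homMk (hX.singleδ ≫
    ((ObjectProperty.ι _).commShiftIso (1 : ℤ)).inv.app ((toD q).obj X.X₁))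

theorem connecting_distinguished {X : ShortComplex (GrMod q)} (hX : X.ShortExact) :
    Triangle.mk ((toD q).map X.f) ((toD q).map X.g) (connecting hX) ∈ distTriang (DGr q) :=
  bounded_distinguished (X := (toD q).obj X.X₁) (Y := (toD q).obj X.X₂) (Z := (toD q).obj X.X₃)
    _ _ _ hX.singleTriangle_distinguished

theorem connecting_naturality {X Y : ShortComplex (GrMod q)} (hX : X.ShortExact)
    (hY : Y.ShortExact) (f : X ⟶ Y) :
    (toD q).map f.τ₃ ≫ connecting hY = connecting hX ≫ ((toD q).map f.τ₁)⟦(1 : ℤ)⟧' := by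
  apply ObjectProperty.hom_ext
  have h := (ShortComplex.ShortExact.singleTriangle.map hX hY f).comm₃
  have h' := ((ObjectProperty.ι (TStructure.t (C := GrMod q)).bounded).commShiftIso
    (1 : ℤ)).inv.naturality ((toD q).map f.τ₁)
  change (singleFunctor (GrMod q) 0).map f.τ₃ ≫ hY.singleδ ≫ _ = (hX.singleδ ≫ _) ≫
    (ObjectProperty.ι _).map (((toD q).map f.τ₁)⟦(1 : ℤ)⟧')
  change hX.singleδ ≫ ((singleFunctor (GrMod q) 0).map f.τ₁)⟦(1 : ℤ)⟧' =
    (singleFunctor (GrMod q) 0).map f.τ₃ ≫ hY.singleδ at h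
  refine (Category.assoc _ _ _).symm.trans ((congrArg (· ≫ _) h.symm).trans ?_)
  refine (Category.assoc _ _ _).trans (Eq.trans ?_ (Category.assoc _ _ _).symm)
  exact congrArg (hX.singleδ ≫ ·) h'

/-- Morphisms between modules placed in degrees `0` and `-k` of `D(gr-S)` are computed in the
unbounded derived category. -/
theorem hom_toD_shift_eq_zero (M N : GrMod q) (k : ℤ)
    (h : ∀ f : (singleFunctor (GrMod q) 0).obj M ⟶ ((singleFunctor (GrMod q) 0).obj N)⟦k⟧, f = 0)
    (f : (toD q).obj M ⟶ ((toD q).obj N)⟦k⟧) : f = 0 := by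
  apply ObjectProperty.hom_ext
  have h1 := h (f.hom ≫ ((ObjectProperty.ι _).commShiftIso k).hom.app ((toD q).obj N))
  exact (cancel_mono (((ObjectProperty.ι _).commShiftIso k).hom.app ((toD q).obj N))).1
    (h1.trans zero_comp.symm)

theorem hom_toD_shift_eq_zero_of_neg (M N : GrMod q) {k : ℤ} (hk : k < 0)
    (f : (toD q).obj M ⟶ ((toD q).obj N)⟦k⟧) : f = 0 := by
  refine hom_toD_shift_eq_zero M N k (fun g => ?_) f
  have : (((singleFunctor (GrMod q) 0).obj N)⟦k⟧).IsGE (-k) :=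
    TStructure.t.isGE_shift _ 0 k (-k) (by lia)
  exact TStructure.t.zero g 0 (-k) (by lia)

theorem hom_toD_shift_eq_zero_of_ext (M N : GrMod q) (k : ℕ)
    (h : ∀ x : Abelian.Ext M N k, x = 0)
    (f : (toD q).obj M ⟶ ((toD q).obj N)⟦(k : ℤ)⟧) : f = 0 := by
  refine hom_toD_shift_eq_zero M N k (fun g => ?_) f
  have : Subsingleton (Abelian.Ext M N k) := ⟨fun x y => (h x).trans (h y).symm⟩
  have := (Abelian.Ext.homEquiv (X := M) (Y := N) (n := k)).symm.subsingleton
  exact Subsingleton.elim (α := ShiftedHom _ _ _) g 0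

/-- Vanishing of all morphisms into all shifts, from vanishing of all `Ext`-groups. -/
theorem hom_toD_shift_eq_zero_of_forall_ext (M N : GrMod q)
    (h : ∀ (k : ℕ) (x : Abelian.Ext M N k), x = 0) (k : ℤ)
    (f : (toD q).obj M ⟶ ((toD q).obj N)⟦k⟧) : f = 0 := by
  obtain hk | hk := lt_or_ge k 0
  · exact hom_toD_shift_eq_zero_of_neg M N hk f
  · lift k to ℕ using hk
    exact hom_toD_shift_eq_zero_of_ext M N k (h k) f

theorem hom_toD_shift_eq_zero_of_projective (M N : GrMod q) [Projective M] {k : ℤ} (hk : k ≠ 0)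
    (f : (toD q).obj M ⟶ ((toD q).obj N)⟦k⟧) : f = 0 := by
  obtain hk' | hk' := lt_or_ge k 0
  · exact hom_toD_shift_eq_zero_of_neg M N hk' f
  · obtain ⟨m, rfl⟩ : ∃ m : ℕ, k = (m + 1 : ℕ) := ⟨(k - 1).toNat, by lia⟩
    exact hom_toD_shift_eq_zero_of_ext M N _ (fun x => x.eq_zero_of_projective) f

/-! ### Generation of `D(gr-S)` -/

/-- In a short exact sequence, a triangulated subcategory containing two of the modules contains
the third. -/
theorem hull_of_shortExact {H : ObjectProperty (DGr q)} [H.IsTriangulated]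
    [H.IsClosedUnderIsomorphisms] {X : ShortComplex (GrMod q)} (hX : X.ShortExact) :
    (H ((toD q).obj X.X₁) → H ((toD q).obj X.X₂) → H ((toD q).obj X.X₃)) ∧
    (H ((toD q).obj X.X₁) → H ((toD q).obj X.X₃) → H ((toD q).obj X.X₂)) ∧
    (H ((toD q).obj X.X₂) → H ((toD q).obj X.X₃) → H ((toD q).obj X.X₁)) :=
  ⟨fun h h' => H.ext_of_isTriangulatedClosed₃ _ (connecting_distinguished hX) h h',
    fun h h' => H.ext_of_isTriangulatedClosed₂ _ (connecting_distinguished hX) h h',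
    fun h h' => H.ext_of_isTriangulatedClosed₁ _ (connecting_distinguished hX) h h'⟩

/-- The modules lying in a triangulated subcategory form a class to which Hilbert's syzygy theorem
applies, the length of resolutions being ignored. -/
theorem resClass_hull (H : ObjectProperty (DGr q)) [H.IsTriangulated]
    [H.IsClosedUnderIsomorphisms] : GrMod.ResClass fun _ M => H ((toD q).obj M) where
  zero _ M _ := by
    have := (toD q).map_isZero (GrMod.isZero_of_subsingleton M)
    exact H.prop_of_isZero this
  ext _ X hX := (hull_of_shortExact hX).2.1
  coker _ X hX := (hull_of_shortExact hX).1
  succ _ _ h := h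

/-- Every triangulated subcategory of `D(gr-S)` containing all `S(k)` is the whole category. -/
theorem hull_toDGr_S {H : ObjectProperty (DGr q)} [H.IsTriangulated]
    [H.IsClosedUnderIsomorphisms] (hS : ∀ k, H (toDGr q (GrMod.S q k))) (X : DGr q) : H X := by
  -- induction on the length of the interval in which the cohomology lives
  suffices key : ∀ (l : ℕ) (a b : ℤ), b - a < l → ∀ X : DGr q, X.obj.IsGE a → X.obj.IsLE b → H X by
    obtain ⟨⟨a, ha⟩, ⟨b, hb⟩⟩ := X.property
    exact key ((b - a + 1).toNat) a b (by lia) X ha hb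
  intro l
  induction l with
  | zero =>
    intro a b hab X ha hb
    have h0 : IsZero X.obj := TStructure.t.isZero X.obj b a (by lia)
    refine H.prop_of_isZero ?_
    rw [IsZero.iff_id_eq_zero]
    exact ObjectProperty.hom_ext _ (h0.eq_of_src _ _)
  | succ l ih =>
    intro a b hab X ha hb
    by_cases hl : b - a < l
    · exact ih a b hl X ha hb
    obtain ⟨Y, Z, hY, hZ, f, g, h, hT⟩ := TStructure.t.exists_triangle X.obj a (a + 1) rfl
    have hY' : Y.IsLE a := ⟨hY⟩
    have hZ' : Z.IsGE (a + 1) := ⟨hZ⟩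
    have hYa : Y.IsGE a := by
      have h1 : (Z⟦(-1 : ℤ)⟧).IsGE (a + 2) := TStructure.t.isGE_shift Z (a + 1) (-1) (a + 2) (by lia)
      have h2 : (Z⟦(-1 : ℤ)⟧).IsGE a := TStructure.t.isGE_of_ge _ a (a + 2) (by lia)
      exact TStructure.t.isGE₂ _ (inv_rot_of_distTriang _ hT) a h2 ha
    have hZb : Z.IsLE b := by
      have h1 : (Y⟦(1 : ℤ)⟧).IsLE (a - 1) := TStructure.t.isLE_shift Y a 1 (a - 1) (by lia)
      have h2 : (Y⟦(1 : ℤ)⟧).IsLE b := TStructure.t.isLE_of_le _ (a - 1) b (by lia)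
      exact TStructure.t.isLE₂ _ (rot_of_distTriang _ hT) b hb h2
    let Y' : DGr q := ⟨Y, ⟨a, hYa⟩, ⟨a, hY'⟩⟩
    let Z' : DGr q := ⟨Z, ⟨a + 1, hZ'⟩, ⟨b, hZb⟩⟩
    refine H.ext_of_isTriangulatedClosed₂ _
      (bounded_distinguished (X := Y') (Y := X) (Z := Z') f g h hT) ?_
      (ih (a + 1) b (by lia) Z' hZ' hZb)
    -- the lowest truncation is a module, up to a shift
    obtain ⟨M, ⟨e⟩⟩ := exists_iso_singleFunctor_obj_of_isGE_of_isLE Y a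
    have e' : Y' ≅ ((toD q).obj M)⟦-a⟧ := ObjectProperty.isoMk _
      (e ≪≫ (((singleFunctors (GrMod q)).shiftIso (-a) a 0 (by lia)).app M).symm ≪≫
        (((ObjectProperty.ι _).commShiftIso (-a)).app ((toD q).obj M)).symm)
    exact H.prop_of_iso e'.symm (H.le_shift (-a) _ ((resClass_hull H).hilbert hS M))

end Embedding

/-! ### Generation of `D(X_Σ)` by line bundles -/

section Generation

open Pretriangulated

variable {n : ℕ} {q : Fin n → ℤ} {Sig : Set (Finset (Fin n))} {p : Finset (Fin n)}

theorem torsion_of_killed (M : GrMod q) (m : ℕ) (hM : GrMod.Killed (coxIdeal Sig ^ m) M) :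
    torsion q Sig (toDGr q M) :=
  fun _ _ _ hP => hP _ ⟨M, ⟨m, hM⟩, rfl⟩

theorem torsion_K (hB : coxIdeal Sig = Ideal.span (MvPolynomial.X '' (p : Set (Fin n))))
    (e : Fin n → ℕ) (k : ℤ) : torsion q Sig (toDGr q (GrMod.K q e p k)) := by
  obtain ⟨m, hm⟩ := exists_pow_le_powIdeal hB e
  exact torsion_of_killed _ m fun s hs => GrMod.killed_K e p k s (hm hs)

/-- Torsion objects become zero in the quotient. -/
theorem isZero_of_torsion {X : DGr q} (hX : torsion q Sig X) :
    IsZero ((torsion q Sig).trW.Q.obj X) := by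
  have h : (torsion q Sig).trW (0 : (0 : DGr q) ⟶ X) :=
    ObjectProperty.trW.mk _ (contractible_distinguished₁ X) hX
  have := Localization.inverts (torsion q Sig).trW.Q _ _ h
  exact ((torsion q Sig).trW.Q.map_isZero (isZero_zero _)).of_iso
    (asIso ((torsion q Sig).trW.Q.map (0 : (0 : DGr q) ⟶ X))).symm

theorem hull_of_torsion (H : ObjectProperty (DX q Sig)) [H.IsTriangulated]
    [H.IsClosedUnderIsomorphisms] {X : DGr q} (hX : torsion q Sig X) :
    H ((torsion q Sig).trW.Q.obj X) :=
  H.prop_of_isZero (isZero_of_torsion hX)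

/-- All line bundles together generate `D(X_Σ)`. -/
theorem hull_lineBundle {H : ObjectProperty (DX q Sig)} [H.IsTriangulated]
    [H.IsClosedUnderIsomorphisms] (hS : ∀ k, H (lineBundle q Sig k)) (X : DX q Sig) : H X := by
  have h : H ((torsion q Sig).trW.Q.obj ((torsion q Sig).trW.Q.objPreimage X)) :=
    hull_toDGr_S (H := H.inverseImage (torsion q Sig).trW.Q) hS _
  exact H.prop_of_iso ((torsion q Sig).trW.Q.objObjPreimageIso X) h

section Koszul

open GrMod

variable {H : ObjectProperty (DGr q)} [H.IsTriangulated] [H.IsClosedUnderIsomorphisms]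

/-- `S/(xᵢ : i ∈ A)` is built from the terms of its Koszul complex. -/
theorem hull_K (A : Finset (Fin n)) (k : ℤ)
    (h : ∀ I ⊆ A, H (toDGr q (S q (k - ∑ i ∈ I, q i)))) :
    H (toDGr q (K q (fun _ => 1) A k)) := by
  induction A using Finset.induction generalizing k with
  | empty =>
    have := h ∅ le_rfl
    rw [Finset.sum_empty, sub_zero] at this
    exact H.prop_of_iso ((toD q).mapIso (KEmptyIso _ k)) this
  | insert i A hi ih =>
    obtain ⟨w, hX⟩ := K_shortExact (q := q) (fun _ => 1) A i hi k
    refine (hull_of_shortExact hX).1 (ih _ fun I hI => ?_)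
      (ih k fun I hI => h I (hI.trans (Finset.subset_insert i A)))
    have := h (insert i I) (Finset.insert_subset_insert i hI)
    rw [Finset.sum_insert fun hc => hi (hI hc), ← sub_sub] at this
    simpa using this

/-- If `S/(xᵢ : i ∈ p)` vanishes, then the first term of the Koszul complex is built from the
others. -/
theorem hull_koszul_first (k : ℤ) (hK : H (toDGr q (K q (fun _ => 1) p k)))
    (h : ∀ I ⊆ p, I.Nonempty → H (toDGr q (S q (k - ∑ i ∈ I, q i)))) :
    H (toDGr q (S q k)) := by
  -- remove the elements of `p` one by one
  have key : ∀ B ⊆ p, H (toDGr q (K q (fun _ => 1) (p \ B) k)) := by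
    intro B
    induction B using Finset.induction with
    | empty => intro _; rwa [Finset.sdiff_empty]
    | insert i B hi ih =>
      intro hB
      have hip := hB (Finset.mem_insert_self i B)
      obtain ⟨w, hX⟩ := K_shortExact (q := q) (fun _ => 1) (p \ insert i B) i (by simp) k
      have hins : insert i (p \ insert i B) = p \ B := by
        ext j
        by_cases hj : j = i
        · subst hj; simp [hi, hip]
        · simp [hj]
      refine (hull_of_shortExact hX).2.1 (hull_K _ _ fun I hI => ?_) ?_
      · have hiI : i ∉ I := fun hc => by simpa using hI hc
        have := h (insert i I) (Finset.insert_subset hip (hI.trans Finset.sdiff_subset))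
          (Finset.insert_nonempty i I)
        rw [Finset.sum_insert hiI, ← sub_sub] at this
        simpa using this
      · have := ih ((Finset.subset_insert i B).trans hB)
        rw [← hins] at this
        exact this
  have := key p le_rfl
  rw [Finset.sdiff_self] at this
  exact H.prop_of_iso ((toD q).mapIso (KEmptyIso _ k)).symm this

/-- If `S/(xᵢ : i ∈ p)` vanishes, then the last term of the Koszul complex is built from the
others. -/
theorem hull_koszul_last (k : ℤ) (hK : H (toDGr q (K q (fun _ => 1) p k)))
    (h : ∀ I ⊂ p, H (toDGr q (S q (k - ∑ i ∈ I, q i)))) :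
    H (toDGr q (S q (k - ∑ i ∈ p, q i))) := by
  have key : ∀ B ⊆ p, H (toDGr q (K q (fun _ => 1) (p \ B) (k - ∑ i ∈ B, q i))) := by
    intro B
    induction B using Finset.induction with
    | empty => intro _; rwa [Finset.sdiff_empty, Finset.sum_empty, sub_zero]
    | insert i B hi ih =>
      intro hB
      have hip := hB (Finset.mem_insert_self i B)
      obtain ⟨w, hX⟩ := K_shortExact (q := q) (fun _ => 1) (p \ insert i B) i (by simp)
        (k - ∑ i ∈ B, q i)
      have hins : insert i (p \ insert i B) = p \ B := by
        ext j
        by_cases hj : j = i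
        · subst hj; simp [hi, hip]
        · simp [hj]
      have h3 := ih ((Finset.subset_insert i B).trans hB)
      rw [← hins] at h3
      have h2 : H (toDGr q (K q (fun _ => 1) (p \ insert i B) (k - ∑ i ∈ B, q i))) := by
        refine hull_K _ _ fun I hI => ?_
        have hd : Disjoint B I := Finset.disjoint_left.2 fun j hj hc => by
          have := hI hc
          simp [hj] at this
        have := h (B ∪ I) ⟨Finset.union_subset ((Finset.subset_insert i B).trans hB)
          (hI.trans Finset.sdiff_subset), fun hc => by
            rcases Finset.mem_union.1 (hc hip) with hc | hc
            · exact hi hc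
            · simpa using hI hc⟩
        rwa [Finset.sum_union hd, ← sub_sub] at this
      have h1 := (hull_of_shortExact hX).2.2 h2 h3
      rw [Finset.sum_insert hi, add_comm, ← sub_sub]
      simp only [Nat.cast_one, one_mul] at h1
      exact h1
  have := key p le_rfl
  rw [Finset.sdiff_self] at this
  exact H.prop_of_iso ((toD q).mapIso (KEmptyIso _ _)).symm this

end Koszul

section Line

variable {H : ObjectProperty (DX q Sig)} [H.IsTriangulated] [H.IsClosedUnderIsomorphisms]

theorem hull_lineBundle_first
    (hB : coxIdeal Sig = Ideal.span (MvPolynomial.X '' (p : Set (Fin n)))) (k : ℤ)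
    (h : ∀ I ⊆ p, I.Nonempty → H (lineBundle q Sig (k - ∑ i ∈ I, q i))) :
    H (lineBundle q Sig k) :=
  hull_koszul_first (H := H.inverseImage (torsion q Sig).trW.Q) (p := p) k
    (hull_of_torsion H (torsion_K hB _ k)) h

theorem hull_lineBundle_last
    (hB : coxIdeal Sig = Ideal.span (MvPolynomial.X '' (p : Set (Fin n)))) (k : ℤ)
    (h : ∀ I ⊂ p, H (lineBundle q Sig (k - ∑ i ∈ I, q i))) :
    H (lineBundle q Sig (k - ∑ i ∈ p, q i)) :=
  hull_koszul_last (H := H.inverseImage (torsion q Sig).trW.Q) (p := p) k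
    (hull_of_torsion H (torsion_K hB _ k)) h

end Line

theorem IsSide.sum_le {v : Fin n → ℤ} {ε : ℤ} {N : ℕ} (h : IsSide v p ε N) {I : Finset (Fin n)}
    (hI : I ⊆ p) : 0 ≤ ∑ i ∈ I, ε * v i ∧ ∑ i ∈ I, ε * v i ≤ N ∧
      (I.Nonempty → 0 < ∑ i ∈ I, ε * v i) ∧ (I ⊂ p → ∑ i ∈ I, ε * v i < N) := by
  have hpos : ∀ i ∈ p, 0 < ε * v i := fun i => (h.mem i).1
  refine ⟨Finset.sum_nonneg fun i hi => (hpos i (hI hi)).le, ?_, fun hn =>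
    Finset.sum_pos (fun i hi => hpos i (hI hi)) hn, fun hs => ?_⟩
  · rw [← h.sum_mem]
    exact Finset.sum_le_sum_of_subset_of_nonneg hI fun i hi _ => (hpos i hi).le
  · rw [← h.sum_mem]
    obtain ⟨i, hi, hiI⟩ := Finset.exists_of_ssubset hs
    exact Finset.sum_lt_sum_of_subset hI hi hiI (hpos i hi) fun j hj _ => (hpos j hj).le

/-- `N` consecutive line bundles generate `D(X_Σ)`: Koszul complexes allow the window to be moved
by one step in both directions. -/
theorem IsSide.hull_window {v : Fin n → ℤ} {ε : ℤ} {N : ℕ} (h : IsSide v p ε N)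
    {H : ObjectProperty (DX v (complexOfNonface p))} [H.IsTriangulated]
    [H.IsClosedUnderIsomorphisms]
    (hS : ∀ k : ℤ, 0 ≤ k → k < N → H (lineBundle v (complexOfNonface p) k))
    (X : DX v (complexOfNonface p)) : H X := by
  have hB := coxIdeal_complexOfNonface p
  have hfac : ∀ I : Finset (Fin n), ∑ i ∈ I, v i = ε * ∑ i ∈ I, ε * v i := fun I => by
    rw [← Finset.mul_sum, ← mul_assoc, h.mul_self, one_mul]
  have htot : ∑ i ∈ p, v i = ε * N := by rw [hfac, h.sum_mem]
  -- a step away from the origin in the direction of `ε`, and one in the opposite direction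
  have step1 : ∀ k, (∀ t : ℤ, 1 ≤ t → t ≤ N → H (lineBundle v (complexOfNonface p) (k - ε * t))) →
      H (lineBundle v (complexOfNonface p) k) := fun k hk =>
    hull_lineBundle_first hB k fun I hI hn => by
      rw [hfac]
      exact hk _ ((h.sum_le hI).2.2.1 hn) (h.sum_le hI).2.1
  have step2 : ∀ k, (∀ t : ℤ, 1 ≤ t → t ≤ N → H (lineBundle v (complexOfNonface p) (k + ε * t))) →
      H (lineBundle v (complexOfNonface p) k) := fun k hk => by
    have := hull_lineBundle_last hB (H := H) (k + ε * N) fun I hI => by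
      have h1 := (h.sum_le hI.subset)
      have h2 := h1.2.2.2 hI
      rw [hfac]
      have := hk (N - ∑ i ∈ I, ε * v i) (by lia) (by lia)
      rwa [mul_sub, ← add_sub_assoc] at this
    rwa [htot, add_sub_cancel_right] at this
  have up : ∀ k, (∀ t : ℤ, 1 ≤ t → t ≤ N → H (lineBundle v (complexOfNonface p) (k - t))) →
      H (lineBundle v (complexOfNonface p) k) := fun k hk => by
    rcases h.unit with rfl | rfl
    · exact step1 k fun t h1 h2 => by simpa using hk t h1 h2
    · exact step2 k fun t h1 h2 => by simpa [← sub_eq_add_neg] using hk t h1 h2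
  have down : ∀ k, (∀ t : ℤ, 1 ≤ t → t ≤ N → H (lineBundle v (complexOfNonface p) (k + t))) →
      H (lineBundle v (complexOfNonface p) k) := fun k hk => by
    rcases h.unit with rfl | rfl
    · exact step2 k fun t h1 h2 => by simpa using hk t h1 h2
    · exact step1 k fun t h1 h2 => by simpa using hk t h1 h2
  have hall : ∀ (m : ℕ) (k : ℤ), -m ≤ k → k < N + m →
      H (lineBundle v (complexOfNonface p) k) := by
    intro m
    induction m with
    | zero => exact fun k h1 h2 => hS k (by simpa using h1) (by simpa using h2)
    | succ m ih =>
      intro k h1 h2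
      push_cast at h1 h2
      rcases lt_or_ge k (-m) with hk | hk
      · exact down k fun t h3 h4 => ih _ (by lia) (by lia)
      · rcases lt_or_ge k (N + m) with hk' | hk'
        · exact ih k hk hk'
        · exact up k fun t h3 h4 => ih _ (by lia) (by lia)
  exact hull_lineBundle (fun k => hall k.natAbs k (by lia) (by
    have : (0 : ℤ) ≤ N := by lia
    have := (h.sum_le (Finset.Subset.refl p)).2.2.1 h.nonempty
    rw [h.sum_mem] at this
    lia)) X

end Generation

/-! ### Morphisms in a Verdier quotient -/

section Verdier

open Pretriangulated

variable {C : Type*} [Category* C] [HasShift C ℤ] [Preadditive C]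
  [∀ k : ℤ, (shiftFunctor C k).Additive]

theorem eq_zero_of_shift_neg {X Y : C} (h : ∀ f : X ⟶ Y⟦(1 : ℤ)⟧, f = 0) (f : X⟦(-1 : ℤ)⟧ ⟶ Y) :
    f = 0 := by
  apply (shiftFunctor C (1 : ℤ)).map_injective
  rw [CategoryTheory.Functor.map_zero]
  have h1 := h (((shiftEquiv C (1 : ℤ)).counitIso.app X).inv ≫ f⟦(1 : ℤ)⟧')
  exact (cancel_epi ((shiftEquiv C (1 : ℤ)).counitIso.app X).inv).1 (h1.trans comp_zero.symm)

/-- If every map from `X` to an object of `T` factors through an object `K` of `T` with no maps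
to `Y` and `Y⟦1⟧`, then maps `X ⟶ Y` do not change in the Verdier quotient by `T`. -/
theorem trW_Q_map_bijective [HasZeroObject C] [Pretriangulated C] [IsTriangulated C]
    (T : ObjectProperty C) [T.IsTriangulated]
    {X Y : C} (h : ∀ Z, T Z → ∀ a : X ⟶ Z, ∃ (K : C) (p : X ⟶ K) (b : K ⟶ Z), T K ∧ a = p ≫ b ∧
      (∀ f : K ⟶ Y, f = 0) ∧ ∀ f : K ⟶ Y⟦(1 : ℤ)⟧, f = 0) :
    Function.Bijective (fun f : X ⟶ Y => T.trW.Q.map f) := by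
  constructor
  · intro f g hfg
    obtain ⟨X', s, hs, hsf⟩ := (MorphismProperty.map_eq_iff_precomp T.trW.Q T.trW f g).1 hfg
    obtain ⟨Z, a, δ, hT, hZ⟩ := (T.trW_iff s).1 hs
    obtain ⟨c, hc⟩ := Triangle.yoneda_exact₂ _ hT (f - g)
      ((Preadditive.comp_sub _ _ _).trans (sub_eq_zero.2 hsf))
    obtain ⟨K, p, b, -, rfl, hK, -⟩ := h Z hZ a
    refine sub_eq_zero.1 (hc.trans ((Category.assoc _ _ _).trans ?_))
    exact (congrArg (p ≫ ·) (hK (b ≫ c))).trans comp_zero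
  · intro φ
    obtain ⟨ψ, rfl⟩ := Localization.exists_rightFraction T.trW.Q T.trW φ
    obtain ⟨Z, a, δ, hT, hZ⟩ := (T.trW_iff ψ.s).1 ψ.hs
    obtain ⟨K, p, b, hK, rfl, hK0, hK1⟩ := h Z hZ a
    -- the fibre of `X ⟶ K` refines the given fraction, and its map to `Y` extends to `X`
    obtain ⟨X', s, δ', hT'⟩ := distinguished_cocone_triangle₁ p
    obtain ⟨t, ht⟩ : ∃ t : X' ⟶ ψ.X', s = t ≫ ψ.s := Triangle.coyoneda_exact₂ _ hT s (by
      change s ≫ p ≫ b = 0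
      have := comp_distTriang_mor_zero₁₂ _ hT'
      change s ≫ p = 0 at this
      rw [reassoc_of% this, zero_comp])
    obtain ⟨g, hg⟩ : ∃ g : X ⟶ Y, t ≫ ψ.f = s ≫ g :=
      Triangle.yoneda_exact₂ _ (inv_rot_of_distTriang _ hT') (t ≫ ψ.f)
      (eq_zero_of_shift_neg hK1 _)
    have hs : T.trW s := (T.trW_iff s).2 ⟨_, _, _, hT', hK⟩
    have := Localization.inverts T.trW.Q T.trW s hs
    refine ⟨g, ?_⟩
    change T.trW.Q.map g = _
    rw [← cancel_epi (T.trW.Q.map s), ← Functor.map_comp, ← hg, ht, Functor.map_comp,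
      Functor.map_comp, Category.assoc, MorphismProperty.RightFraction.map_s_comp_map]

end Verdier

/-! ### Morphisms out of line bundles -/

section Nilpotent

open Pretriangulated GrMod

variable {n : ℕ} {q : Fin n → ℤ}

/-- Every map from a twist of `G` to a shift of `Z` is killed by a power of `xᵢ`. -/
def NilOn (G : GrMod q) (i : Fin n) : ObjectProperty (DGr q) := fun Z =>
  ∀ (l k : ℤ) (a : (toD q).obj (G.twist k) ⟶ Z⟦l⟧), ∃ (m : ℕ) (k' : ℤ)
    (hf : MvPolynomial.IsWeightedHomogeneous q ((MvPolynomial.X i : PolyRing n) ^ m) (k - k')),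
    (toD q).map (mulHom G _ k' k hf) ≫ a = 0

/-- The source of a multiplication map is determined by its target. -/
theorem NilOn.exists_forall {G : GrMod q} {i : Fin n} {Z : DGr q} (h : NilOn G i Z) {l k : ℤ}
    (a : (toD q).obj (G.twist k) ⟶ Z⟦l⟧) : ∃ m : ℕ, ∀ (k' : ℤ)
    (hf : MvPolynomial.IsWeightedHomogeneous q ((MvPolynomial.X i : PolyRing n) ^ m) (k - k')),
    (toD q).map (mulHom G _ k' k hf) ≫ a = 0 := by
  obtain ⟨m, k', hf, hk⟩ := h l k a
  refine ⟨m, fun k'' hf' => ?_⟩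
  have h1 := hf.inj_right (pow_ne_zero m (MvPolynomial.X_ne_zero i)) hf'
  obtain rfl : k' = k'' := by lia
  exact hk

theorem NilOn.exists_forall' {G : GrMod q} {i : Fin n} {Z : DGr q} (h : NilOn G i Z) {k : ℤ}
    (a : (toD q).obj (G.twist k) ⟶ Z) : ∃ m : ℕ, ∀ (k' : ℤ)
    (hf : MvPolynomial.IsWeightedHomogeneous q ((MvPolynomial.X i : PolyRing n) ^ m) (k - k')),
    (toD q).map (mulHom G _ k' k hf) ≫ a = 0 := by
  obtain ⟨m, hm⟩ := h.exists_forall (a ≫ (shiftFunctorZero (DGr q) ℤ).inv.app Z)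
  refine ⟨m, fun k' hf => ?_⟩
  have := hm k' hf
  rw [← Category.assoc] at this
  exact (cancel_mono ((shiftFunctorZero (DGr q) ℤ).inv.app Z)).1 (this.trans zero_comp.symm)

theorem mulHom_comp (G : GrMod q) (f g : PolyRing n) (k l m : ℤ)
    (hf : MvPolynomial.IsWeightedHomogeneous q f (l - k))
    (hg : MvPolynomial.IsWeightedHomogeneous q g (m - l))
    (hfg : MvPolynomial.IsWeightedHomogeneous q (g * f) (m - k)) :
    mulHom G f k l hf ≫ mulHom G g l m hg = mulHom G (g * f) k m hfg := by
  ext x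
  exact (mul_smul g f (x : G.carrier)).symm

theorem mulHom_commute (G : GrMod q) (f g : PolyRing n) (k l l' m : ℤ)
    (hf : MvPolynomial.IsWeightedHomogeneous q f (l - k))
    (hg : MvPolynomial.IsWeightedHomogeneous q g (m - l))
    (hg' : MvPolynomial.IsWeightedHomogeneous q g (l' - k))
    (hf' : MvPolynomial.IsWeightedHomogeneous q f (m - l')) :
    mulHom G f k l hf ≫ mulHom G g l m hg = mulHom G g k l' hg' ≫ mulHom G f l' m hf' := by
  ext x
  exact smul_comm g f (x : G.carrier)

instance (G : GrMod q) (i : Fin n) : (NilOn G i).IsClosedUnderIsomorphisms where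
  of_iso {Z Z'} e h l k a := by
    obtain ⟨m, k', hf, hk⟩ := h l k (a ≫ (e.inv)⟦l⟧')
    refine ⟨m, k', hf, ?_⟩
    rw [← Category.assoc] at hk
    exact (cancel_mono ((e.inv)⟦l⟧')).1 (hk.trans zero_comp.symm)

instance (G : GrMod q) (i : Fin n) : (NilOn G i).IsTriangulated where
  exists_zero := ⟨0, isZero_zero _, fun l k a => ⟨0, _, isWeightedHomogeneous_X_pow i 0 k, by
    have : IsZero ((0 : DGr q)⟦l⟧) := (shiftFunctor (DGr q) l).map_isZero (isZero_zero _)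
    exact this.eq_of_tgt _ _⟩⟩
  isStableUnderShiftBy c := ⟨fun Z h l k a => by
    obtain ⟨m, k', hf, hk⟩ := h (c + l) k (a ≫ (shiftFunctorAdd (DGr q) c l).inv.app Z)
    refine ⟨m, k', hf, ?_⟩
    rw [← Category.assoc] at hk
    exact (cancel_mono ((shiftFunctorAdd (DGr q) c l).inv.app Z)).1 (hk.trans zero_comp.symm)⟩
  toIsTriangulatedClosed₂ := .mk' fun T hT h₁ h₃ l k a => by
    have hT' := Triangle.shift_distinguished T hT l
    obtain ⟨f, g, hfg⟩ : ∃ (f : T.obj₁⟦l⟧ ⟶ T.obj₂⟦l⟧) (g : T.obj₂⟦l⟧ ⟶ T.obj₃⟦l⟧),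
        ∀ {W : DGr q} (u : W ⟶ T.obj₂⟦l⟧), u ≫ g = 0 → ∃ b, u = b ≫ f :=
      ⟨_, _, fun u hu => Triangle.coyoneda_exact₂ _ hT' u hu⟩
    obtain ⟨m, k', hf, hk⟩ := h₃ l k (a ≫ g)
    rw [← Category.assoc] at hk
    obtain ⟨b, hb⟩ := hfg _ hk
    obtain ⟨m', k'', hf', hk'⟩ := h₁ l k' b
    have hff := hf.mul hf'
    rw [sub_add_sub_cancel, ← pow_add] at hff
    refine ⟨m + m', k'', hff, ?_⟩
    have h1 : mulHom G _ k'' k hff = mulHom G _ k'' k' hf' ≫ mulHom G _ k' k hf := by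
      rw [mulHom_comp _ _ _ _ _ _ _ _ (by rwa [← pow_add])]
      congr 1
      exact pow_add _ _ _
    rw [h1, Functor.map_comp, Category.assoc, hb, reassoc_of% hk', zero_comp]

variable {Sig : Set (Finset (Fin n))} {p : Finset (Fin n)}

/-- Maps from free modules to shifts of a module are elements of the module in degree `0` and vanish in
other degrees, the free modules being projective. -/
theorem nilOn_free_of_killed {I : Ideal (PolyRing n)} {M : GrMod q} {m : ℕ} {i : Fin n}
    (hM : Killed (I ^ m) M) (hi : MvPolynomial.X i ∈ I) : NilOn (free q) i ((toD q).obj M) := by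
  intro l k a
  have : Projective ((free q).twist k) := projective_S (q := q) k
  by_cases hl : l = 0
  · subst hl
    obtain ⟨g, hg⟩ := (toD q).map_surjective
      (a ≫ (shiftFunctorZero (DGr q) ℤ).hom.app ((toD q).obj M))
    refine ⟨m, _, isWeightedHomogeneous_X_pow i m k, ?_⟩
    have h0 : mulHom (free q) _ _ k (isWeightedHomogeneous_X_pow i m k) ≫ g = 0 := by
      ext s
      exact (map_smul g.lin ((MvPolynomial.X i : PolyRing n) ^ m) s).trans
        (hM _ (Ideal.pow_mem_pow hi m) _)
    rw [← cancel_mono ((shiftFunctorZero (DGr q) ℤ).hom.app ((toD q).obj M)), Category.assoc]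
    refine (congrArg ((toD q).map _ ≫ ·) hg.symm).trans ?_
    rw [zero_comp, ← Functor.map_comp, h0, CategoryTheory.Functor.map_zero]
  · refine ⟨0, _, isWeightedHomogeneous_X_pow i 0 k, ?_⟩
    rw [hom_toD_shift_eq_zero_of_projective ((free q).twist k) M hl a, comp_zero]

/-- The distinguished triangle obtained by dividing out a further power `x_j^{e_j}`, and its
compatibility with multiplication by polynomials. -/
theorem K_triangle (e : Fin n → ℕ) (A : Finset (Fin n)) (j : Fin n) (hj : j ∉ A) :
    ∃ δ : ∀ k, (toD q).obj (K q e (insert j A) k) ⟶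
        ((toD q).obj (K q e A (k - e j * q j)))⟦(1 : ℤ)⟧,
      (∀ k, Triangle.mk ((toD q).map (mulHom (quotPows q e A) _ _ k
          (isWeightedHomogeneous_X_pow j (e j) k)))
        ((toD q).map (twistMap (quotPowsMap q (e := e) (e' := e) (A := A) (A' := insert j A)
          (fun _ h => ⟨Finset.mem_insert_of_mem h, le_rfl⟩)) k)) (δ k) ∈ distTriang (DGr q)) ∧
      ∀ (k k' : ℤ) (f : PolyRing n) (hf : MvPolynomial.IsWeightedHomogeneous q f (k - k'))
        (hf' : MvPolynomial.IsWeightedHomogeneous q f ((k - e j * q j) - (k' - e j * q j))),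
        (toD q).map (mulHom (quotPows q e (insert j A)) f k' k hf) ≫ δ k =
          δ k' ≫ ((toD q).map (mulHom (quotPows q e A) f _ _ hf'))⟦(1 : ℤ)⟧' := by
  refine ⟨fun k => connecting (K_shortExact (q := q) e A j hj k).2,
    fun k => connecting_distinguished (K_shortExact (q := q) e A j hj k).2,
    fun k k' f hf hf' => ?_⟩
  exact connecting_naturality (K_shortExact (q := q) e A j hj k').2
    (K_shortExact (q := q) e A j hj k).2
    { τ₁ := mulHom (quotPows q e A) _ _ _ hf'
      τ₂ := mulHom (quotPows q e A) _ _ _ hf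
      τ₃ := mulHom (quotPows q e (insert j A)) _ _ _ hf
      comm₁₂ := mulHom_commute _ _ _ _ _ _ _ hf' (isWeightedHomogeneous_X_pow j (e j) k)
        (isWeightedHomogeneous_X_pow j (e j) k') hf
      comm₂₃ := mulHom_naturality _ _ _ _ hf }

theorem torsion_le_nilOn_free
    (hB : coxIdeal Sig = Ideal.span (MvPolynomial.X '' (p : Set (Fin n)))) {i : Fin n}
    (hi : i ∈ p) {Z : DGr q} (hZ : torsion q Sig Z) : NilOn (free q) i Z := by
  refine hZ _ inferInstance inferInstance ?_
  rintro _ ⟨M, ⟨m, hM⟩, rfl⟩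
  exact nilOn_free_of_killed hM (hB ▸ Ideal.subset_span ⟨i, hi, rfl⟩)

/-- Maps from `S/(x_j^{e_j} : j ∈ A)` to a torsion object are killed by powers of the `xᵢ`. -/
theorem torsion_le_nilOn
    (hB : coxIdeal Sig = Ideal.span (MvPolynomial.X '' (p : Set (Fin n)))) (e : Fin n → ℕ)
    (A : Finset (Fin n)) {i : Fin n} (hi : i ∈ p) {Z : DGr q} (hZ : torsion q Sig Z) :
    NilOn (quotPows q e A) i Z := by
  induction A using Finset.induction with
  | empty =>
    intro l k a
    let α : ∀ k, (free q).twist k ≅ K q e ∅ k := KEmptyIso e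
    obtain ⟨m, k', hf, hk⟩ := torsion_le_nilOn_free hB hi hZ l k ((toD q).map (α k).hom ≫ a)
    refine ⟨m, k', hf, ?_⟩
    have h1 : (α k').hom ≫ mulHom (quotPows q e ∅) _ k' k hf =
      mulHom (free q) _ k' k hf ≫ (α k).hom := rfl
    rw [← cancel_epi ((toD q).map (α k').hom), ← Functor.map_comp_assoc, h1,
      Functor.map_comp_assoc]
    exact hk.trans comp_zero.symm
  | insert j A hj ih =>
    intro l k b
    obtain ⟨δ, hδ, hnat⟩ := K_triangle (q := q) e A j hj
    let π := quotPowsMap q (e := e) (e' := e) (A := A) (A' := insert j A)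
      (fun _ h => ⟨Finset.mem_insert_of_mem h, le_rfl⟩)
    obtain ⟨m, k', hf, hk⟩ := ih l k ((toD q).map (twistMap π k) ≫ b)
    -- the product with `xᵢ^m` factors through the connecting map
    obtain ⟨c, hc⟩ : ∃ c : ((toD q).obj (K q e A (k' - e j * q j)))⟦(1 : ℤ)⟧ ⟶ Z⟦l⟧,
        (toD q).map (mulHom (quotPows q e (insert j A)) _ k' k hf) ≫ b = δ k' ≫ c := by
      refine Triangle.yoneda_exact₃ _ (hδ k') _ (Eq.trans ?_ hk)
      change (toD q).map (twistMap π k') ≫ _ = _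
      rw [← Functor.map_comp_assoc, ← Functor.map_comp_assoc, mulHom_naturality]
    obtain ⟨c', hc'⟩ := (shiftFunctor (DGr q) (1 : ℤ)).map_surjective
      (c ≫ (shiftFunctorAdd' (DGr q) (l - 1) 1 l (by lia)).hom.app Z)
    obtain ⟨m', hm'⟩ := ih.exists_forall c'
    have hf' := isWeightedHomogeneous_X_pow (q := q) i m' k'
    have hf'' : MvPolynomial.IsWeightedHomogeneous q ((MvPolynomial.X i : PolyRing n) ^ m')
      ((k' - e j * q j) - ((k' - m' * q i) - e j * q j)) := by rwa [sub_sub_sub_cancel_right]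
    have hff := hf.mul hf'
    rw [sub_add_sub_cancel, ← pow_add] at hff
    refine ⟨m + m', k' - m' * q i, hff, ?_⟩
    have h1 : mulHom (quotPows q e (insert j A)) _ _ k hff =
        mulHom _ _ _ k' hf' ≫ mulHom _ _ k' k hf := by
      rw [mulHom_comp _ _ _ _ _ _ _ _ (by rwa [← pow_add])]
      congr 1
      exact pow_add _ _ _
    have h3 : ((toD q).map (mulHom (quotPows q e A) _ _ _ hf''))⟦(1 : ℤ)⟧' ≫ c = 0 := by
      rw [← cancel_mono ((shiftFunctorAdd' (DGr q) (l - 1) 1 l (by lia)).hom.app Z),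
        Category.assoc]
      refine (congrArg (_ ≫ ·) hc'.symm).trans ?_
      rw [zero_comp, ← Functor.map_comp]
      exact (congrArg (shiftFunctor (DGr q) (1 : ℤ)).map (hm' _ hf'')).trans
        (CategoryTheory.Functor.map_zero _ _ _)
    rw [h1, Functor.map_comp_assoc, hc, reassoc_of% (hnat _ _ _ hf' hf''), h3, comp_zero]

/-- Every map from `S(k)` to a torsion object factors through some `S/(x_i^{e_i} : i ∈ A)`. -/
theorem exists_factor_K
    (hB : coxIdeal Sig = Ideal.span (MvPolynomial.X '' (p : Set (Fin n)))) {Z : DGr q}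
    (hZ : torsion q Sig Z) {k : ℤ} (a : (toD q).obj (S q k) ⟶ Z) {A : Finset (Fin n)} (hA : A ⊆ p) :
    ∃ (e : Fin n → ℕ) (b : (toD q).obj (K q e A k) ⟶ Z), a = (toD q).map (KMk e A k) ≫ b := by
  induction A using Finset.induction with
  | empty =>
    refine ⟨0, (toD q).map (KEmptyIso 0 k).inv ≫ a, ?_⟩
    rw [← Functor.map_comp_assoc]
    change a = (toD q).map ((KEmptyIso 0 k).hom ≫ (KEmptyIso 0 k).inv) ≫ a
    rw [Iso.hom_inv_id, CategoryTheory.Functor.map_id, Category.id_comp]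
  | insert j A hj ih =>
    obtain ⟨e, b, hb⟩ := ih ((Finset.subset_insert j A).trans hA)
    obtain ⟨m, hm⟩ := (torsion_le_nilOn hB e A (hA (Finset.mem_insert_self j A)) hZ).exists_forall' b
    have he : ∀ i ∈ A, Function.update e j m i = e i := fun i hi =>
      Function.update_of_ne (fun hc => hj (by rwa [← hc])) _ _
    have hej : Function.update e j m j = m := Function.update_self j m e
    generalize Function.update e j m = e' at he hej
    subst hej
    let ψ := quotPowsMap q (e := e') (e' := e) (A := A) (A' := A)
      (fun i hi => ⟨hi, (he i hi).ge⟩)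
    obtain ⟨δ, hδ, -⟩ := K_triangle (q := q) e' A j hj
    obtain ⟨b', hb'⟩ : ∃ b' : (toD q).obj (K q e' (insert j A) k) ⟶ Z,
        (toD q).map (twistMap ψ k) ≫ b = (toD q).map (twistMap (quotPowsMap q
          (fun _ h => ⟨Finset.mem_insert_of_mem h, le_rfl⟩)) k) ≫ b' := by
      refine Triangle.yoneda_exact₂ _ (hδ k) _ ?_
      change (toD q).map (mulHom _ _ _ _ _) ≫ _ = 0
      rw [← Functor.map_comp_assoc, mulHom_naturality, Functor.map_comp_assoc, hm, comp_zero]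
    refine ⟨e', b', ?_⟩
    have h1 : KMk (q := q) e A k = KMk e' A k ≫ twistMap ψ k := rfl
    rw [hb, h1, Functor.map_comp_assoc, hb', ← Functor.map_comp_assoc]
    rfl

/-- Maps from `S(k)` do not change in `D(X_Σ)` if the target and its shift receive no maps from the
modules `S/(x_i^{e_i} : i ∈ p)(k)`. -/
theorem Q_map_bijective
    (hB : coxIdeal Sig = Ideal.span (MvPolynomial.X '' (p : Set (Fin n)))) (k : ℤ) (Y : DGr q)
    (h₀ : ∀ (e : Fin n → ℕ) (f : (toD q).obj (K q e p k) ⟶ Y), f = 0)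
    (h₁ : ∀ (e : Fin n → ℕ) (f : (toD q).obj (K q e p k) ⟶ Y⟦(1 : ℤ)⟧), f = 0) :
    Function.Bijective (fun f : (toD q).obj (S q k) ⟶ Y => (torsion q Sig).trW.Q.map f) := by
  refine trW_Q_map_bijective _ fun Z hZ a => ?_
  obtain ⟨e, b, hb⟩ := exists_factor_K hB hZ a le_rfl
  exact ⟨_, _, b, torsion_K hB e k, hb, h₀ e, h₁ e⟩

end Nilpotent

/-! ### Grothendieck groups and Euler characteristics -/

section GrothendieckGroup

open Pretriangulated

variable {C : Type*} [Category* C] [HasZeroObject C] [HasShift C ℤ] [Preadditive C]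
  [∀ k : ℤ, (shiftFunctor C k).Additive] [Pretriangulated C]

theorem K0.cls_add (T : Triangle C) (hT : T ∈ distTriang C) :
    K0.cls T.obj₂ = K0.cls T.obj₁ + K0.cls T.obj₃ := by
  have h : (QuotientAddGroup.mk (FreeAbelianGroup.of T.obj₁ - .of T.obj₂ + .of T.obj₃) : K0 C) = 0 :=
    (QuotientAddGroup.eq_zero_iff _).2 (AddSubgroup.subset_closure ⟨T, hT, rfl⟩)
  have h' : K0.cls T.obj₁ - K0.cls T.obj₂ + K0.cls T.obj₃ = 0 := h
  rw [← sub_eq_zero, ← neg_eq_zero, ← h']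
  abel

theorem K0.cls_eq_zero {X : C} (hX : IsZero X) : K0.cls X = 0 := by
  have h := K0.cls_add _ (isomorphic_distinguished _ (contractible_distinguished X)
    (Triangle.mk (𝟙 X) (0 : X ⟶ X) 0) (Triangle.isoMk _ _ (Iso.refl _) (Iso.refl _)
      (hX.iso (isZero_zero _)) (hX.eq_of_src _ _) (hX.eq_of_src _ _) (hX.eq_of_src _ _)))
  change K0.cls X = K0.cls X + K0.cls X at h
  simpa using h

theorem K0.cls_iso {X Y : C} (e : X ≅ Y) : K0.cls X = K0.cls Y := by
  have h := K0.cls_add _ (isomorphic_distinguished _ (contractible_distinguished X)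
    (Triangle.mk e.hom (0 : Y ⟶ 0) 0) (Triangle.isoMk _ _ (Iso.refl _) e.symm (Iso.refl _)
      (e.hom_inv_id.trans (Category.comp_id _).symm) ((isZero_zero C).eq_of_tgt _ _)
      ((isZero_zero C).eq_of_src _ _)))
  change K0.cls Y = K0.cls X + K0.cls 0 at h
  rw [h, K0.cls_eq_zero (isZero_zero C), add_zero]

theorem K0.cls_shift_one (X : C) : K0.cls (X⟦(1 : ℤ)⟧) = -K0.cls X := by
  have h1 := K0.cls_add _ (rot_of_distTriang _ (contractible_distinguished X))
  change K0.cls (0 : C) = K0.cls X + K0.cls (X⟦(1 : ℤ)⟧) at h1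
  rw [K0.cls_eq_zero (isZero_zero C)] at h1
  exact (neg_eq_of_add_eq_zero_right h1.symm).symm

/-- The objects whose class lies in a given subgroup form a triangulated subcategory. -/
theorem K0.cls_mem_of_hull {P : ObjectProperty C} {G : AddSubgroup (K0 C)}
    (hP : ∀ X, P X → K0.cls X ∈ G) {X : C} (hX : triangulatedHull P X) : K0.cls X ∈ G := by
  let Q : ObjectProperty C := fun X => K0.cls X ∈ G
  have hiso : Q.IsClosedUnderIsomorphisms := ⟨fun e h => by
    change K0.cls _ ∈ G
    rw [← K0.cls_iso e]
    exact h⟩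
  have hone : ∀ X : C, Q X ↔ Q (X⟦(1 : ℤ)⟧) := fun X => by
    change K0.cls _ ∈ G ↔ K0.cls _ ∈ G
    rw [K0.cls_shift_one, neg_mem_iff]
  have hshift : ∀ (k : ℤ) (X : C), Q X → Q (X⟦k⟧) := by
    intro k
    induction k using Int.induction_on with
    | zero => exact fun X h => Q.prop_of_iso ((shiftFunctorZero C ℤ).symm.app X) h
    | succ k ih => exact fun X h =>
        Q.prop_of_iso ((shiftFunctorAdd C (k : ℤ) 1).symm.app X) ((hone _).1 (ih X h))
    | pred k ih => exact fun X h => (hone _).2 (Q.prop_of_iso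
        ((shiftFunctorAdd' C (-(k : ℤ) - 1) 1 (-k) (by lia)).app X) (ih X h))
  have htri : Q.IsTriangulated :=
    { exists_zero := ⟨0, isZero_zero C, by
        change K0.cls _ ∈ G
        rw [K0.cls_eq_zero (isZero_zero C)]
        exact G.zero_mem⟩
      isStableUnderShiftBy := fun k => ⟨hshift k⟩
      toIsTriangulatedClosed₂ := .mk' fun T hT h₁ h₃ => by
        change K0.cls _ ∈ G
        rw [K0.cls_add T hT]
        exact G.add_mem h₁ h₃ }
  exact hX Q htri hiso hP

end GrothendieckGroup

section HomTo

variable {C : Type*} [Category* C] [Preadditive C]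
variable {k : Type*} [Field k] {Y : C} (ρ : k →+* End Y)

/-- The group of maps `X ⟶ Y` as a vector space over a field acting on `Y`. -/
def HomTo (_ : k →+* End Y) (X : C) : Type _ := X ⟶ Y

instance (X : C) : AddCommGroup (HomTo ρ X) := inferInstanceAs (AddCommGroup (X ⟶ Y))

instance (X : C) : Module k (HomTo ρ X) := Module.compHom (X ⟶ Y) ρ

namespace HomTo

/-- Precomposition, as a linear map. -/
def precomp {X X' : C} (f : X ⟶ X') : HomTo ρ X' →ₗ[k] HomTo ρ X where
  toFun g := f ≫ (g : X' ⟶ Y)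
  map_add' g h := Preadditive.comp_add _ _ _ f g h
  map_smul' c g := (Category.assoc f g (ρ c)).symm

theorem precomp_comp {X X' X'' : C} (f : X ⟶ X') (f' : X' ⟶ X'') :
    precomp ρ (f ≫ f') = precomp ρ f ∘ₗ precomp ρ f' := by
  ext g
  exact Category.assoc _ _ _

/-- Isomorphic objects have isomorphic spaces of maps to `Y`. -/
def equiv {X X' : C} (e : X ≅ X') : HomTo ρ X' ≃ₗ[k] HomTo ρ X :=
  LinearEquiv.ofLinearMap (precomp ρ e.hom) (precomp ρ e.inv)
    (by rw [← precomp_comp, Iso.hom_inv_id]; ext g; exact Category.id_comp _)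
    (by rw [← precomp_comp, Iso.inv_hom_id]; ext g; exact Category.id_comp _)

/-- The rank of precomposition with `f`. -/
def rk {X X' : C} (f : X ⟶ X') : ℕ := Module.finrank k (LinearMap.range (precomp ρ f))

theorem rk_neg {X X' : C} (f : X ⟶ X') : rk ρ (-f) = rk ρ f := by
  have h : precomp ρ (-f) = -precomp ρ f := by
    ext g
    exact Preadditive.neg_comp _ _
  rw [rk, rk, h, LinearMap.range_neg]

theorem rk_units_smul {X X' : C} (u : ℤˣ) (f : X ⟶ X') : rk ρ (u • f) = rk ρ f := by
  rcases Int.units_eq_one_or u with rfl | rfl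
  · rw [one_smul]
  · rw [Units.neg_smul, one_smul, rk_neg]

theorem rk_iso {X X' Z Z' : C} (e : X ≅ Z) (e' : X' ≅ Z') (f : X ⟶ X') (g : Z ⟶ Z')
    (h : e.hom ≫ g = f ≫ e'.hom) : rk ρ f = rk ρ g := by
  have h1 : precomp ρ f = (equiv ρ e).toLinearMap ∘ₗ precomp ρ g ∘ₗ (equiv ρ e').symm.toLinearMap := by
    have : f = e.hom ≫ g ≫ e'.inv := by rw [reassoc_of% h, Iso.hom_inv_id, Category.comp_id]
    rw [this, precomp_comp, precomp_comp]
    rfl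
  rw [rk, rk, h1, LinearMap.range_comp, LinearMap.range_comp, LinearEquiv.range, Submodule.map_top]
  exact LinearEquiv.finrank_map_eq (equiv ρ e) _

variable [HasShift C ℤ]

/-- The dimension of the space of maps `X⟦i⟧ ⟶ Y`. -/
def dim (X : C) (i : ℤ) : ℕ := Module.finrank k (HomTo ρ (X⟦i⟧))

/-- `X` has an Euler characteristic against `Y`: the spaces of maps `X⟦i⟧ ⟶ Y` are finite-dimensional
and all but finitely many of them vanish. -/
def Bounded : ObjectProperty C := fun X =>
  (∀ i : ℤ, FiniteDimensional k (HomTo ρ (X⟦i⟧))) ∧ {i : ℤ | dim ρ X i ≠ 0}.Finite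

/-- The Euler characteristic of the spaces of maps `X⟦i⟧ ⟶ Y`; a junk value unless `X` is `Bounded`. -/
def euler (X : C) : ℤ := ∑ᶠ i : ℤ, (i.negOnePow : ℤ) * dim ρ X i

theorem dim_iso {X X' : C} (e : X ≅ X') (i : ℤ) : dim ρ X i = dim ρ X' i :=
  (equiv ρ ((shiftFunctor C i).mapIso e)).finrank_eq.symm

/-- If only maps from `X` itself to `Y` are nonzero, the Euler characteristic is a dimension. -/
theorem bounded_of_forall_ne [∀ i : ℤ, (shiftFunctor C i).Additive] {X : C}
    [FiniteDimensional k (HomTo ρ X)]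
    (h : ∀ i : ℤ, i ≠ 0 → ∀ f : X ⟶ Y⟦i⟧, f = 0) :
    Bounded ρ X ∧ euler ρ X = Module.finrank k (HomTo ρ X) := by
  have h1 : ∀ i : ℤ, i ≠ 0 → Subsingleton (HomTo ρ (X⟦i⟧)) := fun i hi =>
    ⟨fun f g => by
      have key : ∀ f : X⟦i⟧ ⟶ Y, f = 0 := fun f => by
        apply (shiftFunctor C (-i)).map_injective
        rw [CategoryTheory.Functor.map_zero]
        have := h (-i) (neg_ne_zero.2 hi) (((shiftEquiv C i).unitIso.app X).hom ≫ f⟦-i⟧')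
        exact (cancel_epi ((shiftEquiv C i).unitIso.app X).hom).1 (this.trans comp_zero.symm)
      exact (key f).trans (key g).symm⟩
  have e : HomTo ρ X ≃ₗ[k] HomTo ρ (X⟦(0 : ℤ)⟧) := equiv ρ ((shiftFunctorZero C ℤ).app X)
  have hdim : ∀ i : ℤ, i ≠ 0 → dim ρ X i = 0 := fun i hi => by
    have := h1 i hi
    exact Module.finrank_zero_of_subsingleton
  refine ⟨⟨fun i => ?_, (Set.finite_singleton (0 : ℤ)).subset fun i hi => ?_⟩, ?_⟩
  · by_cases hi : i = 0
    · subst hi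
      exact e.finiteDimensional
    · have := h1 i hi
      infer_instance
  · by_contra hc
    exact hi (hdim i hc)
  · rw [euler, finsum_eq_single _ (0 : ℤ) fun i hi => by rw [hdim i hi]; simp]
    rw [e.finrank_eq]
    simp [dim]

end HomTo

end HomTo

section EulerCharacteristic

open Pretriangulated

variable {C : Type*} [Category* C] [HasZeroObject C] [HasShift C ℤ] [Preadditive C]
  [∀ k : ℤ, (shiftFunctor C k).Additive] [Pretriangulated C]
  {k : Type*} [Field k] {Y : C} (ρ : k →+* End Y)

namespace HomTo

theorem ker_eq_range (T : Triangle C) (hT : T ∈ distTriang C) :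
    LinearMap.ker (precomp ρ T.mor₁) = LinearMap.range (precomp ρ T.mor₂) := by
  ext g
  constructor
  · intro hg
    obtain ⟨c, hc⟩ := Triangle.yoneda_exact₂ T hT g hg
    exact ⟨c, hc.symm⟩
  · rintro ⟨c, rfl⟩
    exact comp_distTriang_mor_zero₁₂_assoc _ hT (show T.obj₃ ⟶ Y from c) |>.trans zero_comp

theorem finrank_eq (T : Triangle C) (hT : T ∈ distTriang C)
    (h : FiniteDimensional k (HomTo ρ T.obj₂)) :
    Module.finrank k (HomTo ρ T.obj₂) = rk ρ T.mor₁ + rk ρ T.mor₂ := by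
  rw [← LinearMap.finrank_range_add_finrank_ker (precomp ρ T.mor₁), ker_eq_range ρ T hT]
  rfl

theorem finite_of_exact (T : Triangle C) (hT : T ∈ distTriang C)
    (h₁ : FiniteDimensional k (HomTo ρ T.obj₁)) (h₃ : FiniteDimensional k (HomTo ρ T.obj₃)) :
    FiniteDimensional k (HomTo ρ T.obj₂) := by
  have h : FiniteDimensional k (LinearMap.ker (precomp ρ T.mor₁)) := by
    rw [ker_eq_range ρ T hT]
    infer_instance
  have h' : FiniteDimensional k (HomTo ρ T.obj₂ ⧸ LinearMap.ker (precomp ρ T.mor₁)) :=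
    (precomp ρ T.mor₁).quotKerEquivRange.symm.finiteDimensional
  exact Module.Finite.of_submodule_quotient (LinearMap.ker (precomp ρ T.mor₁))

instance : (Bounded ρ).IsClosedUnderIsomorphisms where
  of_iso {X X'} e h := by
    refine ⟨fun i => ?_, ?_⟩
    · have := h.1 i
      exact (equiv ρ ((shiftFunctor C i).mapIso e)).symm.finiteDimensional
    · simp only [← dim_iso ρ e]
      exact h.2

/-- The dimensions along a distinguished triangle, in terms of the ranks of its maps. -/
theorem exists_ranks (T : Triangle C) (hT : T ∈ distTriang C) (h₁ : Bounded ρ T.obj₁)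
    (h₃ : Bounded ρ T.obj₃) : Bounded ρ T.obj₂ ∧ ∃ α β γ : ℤ → ℕ,
      (∀ i, dim ρ T.obj₁ (i + 1) = γ i + β (i + 1)) ∧ (∀ i, dim ρ T.obj₂ i = β i + α i) ∧
      ∀ i, dim ρ T.obj₃ i = α i + γ i := by
  have hT' := fun i => Triangle.shift_distinguished T hT i
  have fin1 := h₁.1
  have fin3 := h₃.1
  have fin2 : ∀ i : ℤ, FiniteDimensional k (HomTo ρ (T.obj₂⟦i⟧)) := fun i =>
    finite_of_exact ρ _ (hT' i) (fin1 i) (fin3 i)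
  let β : ℤ → ℕ := fun i => rk ρ (T.mor₁⟦i⟧')
  let α : ℤ → ℕ := fun i => rk ρ (T.mor₂⟦i⟧')
  let γ : ℤ → ℕ := fun i => rk ρ ((Triangle.shiftFunctor C i).obj T).mor₃
  have e1 : ∀ i, rk ρ ((Triangle.shiftFunctor C i).obj T).mor₁ = β i := fun i =>
    rk_units_smul ρ _ _
  have e2 : ∀ i, rk ρ ((Triangle.shiftFunctor C i).obj T).mor₂ = α i := fun i =>
    rk_units_smul ρ _ _
  have d1 : ∀ i, dim ρ T.obj₁ (i + 1) = γ i + β (i + 1) := fun i => by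
    let e := fun X : C => (shiftFunctorAdd C i (1 : ℤ)).app X
    have h1 : dim ρ T.obj₁ (i + 1) = Module.finrank k (HomTo ρ ((T.obj₁⟦i⟧)⟦(1 : ℤ)⟧)) :=
      (equiv ρ (e _)).finrank_eq.symm
    have h2 := finrank_eq ρ _ (rot_of_distTriang _ (rot_of_distTriang _ (hT' i)))
      (have := fin1 (i + 1); (equiv ρ (e T.obj₁)).symm.finiteDimensional)
    have h3 : rk ρ ((Triangle.shiftFunctor C i).obj T).rotate.rotate.mor₂ = β (i + 1) := by
      refine (rk_neg ρ _).trans ?_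
      change rk ρ ((i.negOnePow • T.mor₁⟦i⟧')⟦(1 : ℤ)⟧') = _
      rw [Functor.map_units_smul, rk_units_smul]
      exact (rk_iso ρ (e _) (e _) _ _ ((shiftFunctorAdd C i (1 : ℤ)).hom.naturality T.mor₁).symm).symm
    rw [h1, ← h3]
    exact h2
  have d2 : ∀ i, dim ρ T.obj₂ i = β i + α i := fun i => by
    rw [← e1, ← e2]
    exact finrank_eq ρ _ (hT' i) (fin2 i)
  have d3 : ∀ i, dim ρ T.obj₃ i = α i + γ i := fun i => by
    rw [← e2]
    exact finrank_eq ρ _ (rot_of_distTriang _ (hT' i)) (fin3 i)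
  refine ⟨⟨fin2, ?_⟩, α, β, γ, d1, d2, d3⟩
  refine (h₁.2.union h₃.2).subset fun i hi => ?_
  by_contra hc
  rw [Set.mem_union, not_or, Set.mem_ofPred_eq, Set.mem_ofPred_eq, not_not, not_not] at hc
  have h1 := d1 (i - 1)
  have h3 := d3 i
  rw [sub_add_cancel] at h1
  exact hi (by rw [d2]; lia)

theorem euler_add (T : Triangle C) (hT : T ∈ distTriang C) (h₁ : Bounded ρ T.obj₁)
    (h₃ : Bounded ρ T.obj₃) : euler ρ T.obj₂ = euler ρ T.obj₁ + euler ρ T.obj₃ := by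
  obtain ⟨h₂, α, β, γ, d1, d2, d3⟩ := exists_ranks ρ T hT h₁ h₃
  have supp : ∀ {X : C}, Bounded ρ X →
      (Function.support fun i : ℤ => (i.negOnePow : ℤ) * dim ρ X i).Finite := fun h =>
    h.2.subset fun i hi hc => hi (by simp [hc])
  have hγ : (Function.support fun i : ℤ => (i.negOnePow : ℤ) * γ i).Finite :=
    h₃.2.subset fun i hi hc => hi (by
      have := d3 i
      have : γ i = 0 := by lia
      simp [this])
  have hγ' : (Function.support fun i : ℤ => ((i + 1).negOnePow : ℤ) * γ i).Finite := by
    refine hγ.subset fun i hi hc => hi ?_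
    replace hc : (i.negOnePow : ℤ) * γ i = 0 := hc
    simp only [Int.negOnePow_succ, Units.val_neg, neg_mul]
    rw [hc, neg_zero]
  -- the contributions of the connecting maps cancel after a shift of the index
  have htel : (∑ᶠ i : ℤ, (i.negOnePow : ℤ) * γ (i - 1)) + ∑ᶠ i : ℤ, (i.negOnePow : ℤ) * γ i = 0 := by
    rw [← finsum_comp_equiv (Equiv.addRight (1 : ℤ))]
    simp only [Equiv.coe_addRight, add_sub_cancel_right]
    rw [← finsum_add_distrib hγ' hγ]
    refine finsum_eq_zero_of_forall_eq_zero fun i => ?_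
    simp [Int.negOnePow_succ]
  have hγ'' : (Function.support fun i : ℤ => (i.negOnePow : ℤ) * γ (i - 1)).Finite := by
    refine (supp h₁).subset fun i hi hc => hi ?_
    have := d1 (i - 1)
    rw [sub_add_cancel] at this
    simp only [mul_eq_zero, Units.ne_zero, false_or] at hc
    have : γ (i - 1) = 0 := by lia
    simp [this]
  rw [← finsum_add_distrib hγ'' hγ] at htel
  rw [← sub_eq_zero, euler, euler, euler, ← finsum_add_distrib (supp h₁) (supp h₃),
    ← finsum_sub_distrib (supp h₂) (((supp h₁).union (supp h₃)).subset
      (Function.support_add _ _)), ← neg_eq_zero, ← finsum_neg_distrib, ← htel]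
  refine finsum_congr fun i => ?_
  have := d1 (i - 1)
  rw [sub_add_cancel] at this
  rw [this, d2, d3]
  push_cast
  ring

instance : (Bounded ρ).IsTriangulated where
  exists_zero := ⟨0, isZero_zero C, by
    have h : ∀ i : ℤ, Subsingleton (HomTo ρ ((0 : C)⟦i⟧)) := fun i =>
      ⟨fun f g => ((shiftFunctor C i).map_isZero (isZero_zero C)).eq_of_src (f : _ ⟶ Y) g⟩
    refine ⟨fun i => inferInstance, ?_⟩
    convert Set.finite_empty
    ext i
    simp only [Set.mem_ofPred_eq, Set.mem_empty_iff_false, iff_false, not_not]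
    exact Module.finrank_zero_of_subsingleton⟩
  isStableUnderShiftBy j := ⟨fun X h => by
    have e : ∀ i : ℤ, HomTo ρ (X⟦j + i⟧) ≃ₗ[k] HomTo ρ ((X⟦j⟧)⟦i⟧) := fun i =>
      equiv ρ ((shiftFunctorAdd C j i).symm.app X)
    refine ⟨fun i => ?_, ?_⟩
    · have := h.1 (j + i)
      exact (e i).finiteDimensional
    · refine (h.2.preimage (f := fun i => j + i) (add_right_injective j).injOn).subset fun i hi hc => hi ?_
      exact (e i).finrank_eq.symm.trans hc⟩
  toIsTriangulatedClosed₂ := .mk' fun T hT h₁ h₃ => (exists_ranks ρ T hT h₁ h₃).1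

/-- If all objects are bounded, the Euler characteristic factors through the Grothendieck group. -/
theorem exists_eulerHom (h : ∀ X : C, Bounded ρ X) :
    ∃ φ : K0 C →+ ℤ, ∀ X, φ (K0.cls X) = euler ρ X := by
  refine ⟨QuotientAddGroup.lift _ (FreeAbelianGroup.lift (euler ρ)) ?_, fun X => ?_⟩
  · rw [AddSubgroup.closure_le]
    rintro _ ⟨T, hT, rfl⟩
    change FreeAbelianGroup.lift (euler ρ) _ = 0
    rw [map_add, map_sub, FreeAbelianGroup.lift_apply_of, FreeAbelianGroup.lift_apply_of,
      FreeAbelianGroup.lift_apply_of, euler_add ρ T hT (h _) (h _)]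
    ring
  · exact FreeAbelianGroup.lift_apply_of _ _

end HomTo

end EulerCharacteristic

/-! ### Morphisms between line bundles on `X_Σ` -/

section LineBundles

open GrMod

variable {n : ℕ}

/-- The object of `D(X_Σ)` defined by a graded module. -/
abbrev sheaf (q : Fin n → ℤ) (Sig : Set (Finset (Fin n))) : GrMod q ⥤ DX q Sig :=
  toD q ⋙ (torsion q Sig).trW.Q

section

variable {q : Fin n → ℤ} {Sig : Set (Finset (Fin n))} {p : Finset (Fin n)}

/-- Maps from `S(k)` to a module do not change in `D(X_Σ)` if no modules `S/(xᵢ ^ eᵢ : i ∈ p)(k)` have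
`Ext` groups into it. -/
theorem sheaf_map_bijective
    (hB : coxIdeal Sig = Ideal.span (MvPolynomial.X '' (p : Set (Fin n)))) (k : ℤ) (M : GrMod q)
    (hM : ∀ (e : Fin n → ℕ) (h : ℕ) (x : Abelian.Ext (K q e p k) M h), x = 0) :
    Function.Bijective (fun f : S q k ⟶ M => (sheaf q Sig).map f) := by
  refine (Q_map_bijective hB k ((toD q).obj M) (fun e f => ?_) fun e =>
    hom_toD_shift_eq_zero_of_forall_ext _ _ (hM e) 1).comp
      ⟨(toD q).map_injective, (toD q).map_surjective⟩
  have := hom_toD_shift_eq_zero_of_forall_ext _ _ (hM e) 0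
    (f ≫ (shiftFunctorZero (DGr q) ℤ).inv.app ((toD q).obj M))
  exact (cancel_mono ((shiftFunctorZero (DGr q) ℤ).inv.app ((toD q).obj M))).1
    (this.trans zero_comp.symm)

/-- Under the same hypothesis, line bundles have no maps to the nonzero shifts of the module in
`D(X_Σ)`. -/
theorem hom_shift_eq_zero
    (hB : coxIdeal Sig = Ideal.span (MvPolynomial.X '' (p : Set (Fin n)))) (k : ℤ) (M : GrMod q)
    (hM : ∀ (e : Fin n → ℕ) (h : ℕ) (x : Abelian.Ext (K q e p k) M h), x = 0) {l : ℤ} (hl : l ≠ 0)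
    (f : lineBundle q Sig k ⟶ ((sheaf q Sig).obj M)⟦l⟧) : f = 0 := by
  obtain ⟨g, hg⟩ := (Q_map_bijective hB k (((toD q).obj M)⟦l⟧)
    (fun e => hom_toD_shift_eq_zero_of_forall_ext _ _ (hM e) l) (fun e f => by
      have := hom_toD_shift_eq_zero_of_forall_ext _ _ (hM e) (l + 1)
        (f ≫ (shiftFunctorAdd (DGr q) l 1).inv.app ((toD q).obj M))
      exact (cancel_mono ((shiftFunctorAdd (DGr q) l 1).inv.app ((toD q).obj M))).1
        (this.trans zero_comp.symm))).2
    (f ≫ ((torsion q Sig).trW.Q.commShiftIso l).inv.app ((toD q).obj M))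
  have hg0 : g = 0 := hom_toD_shift_eq_zero_of_projective (S q k) M hl g
  subst hg0
  change (torsion q Sig).trW.Q.map 0 = _ at hg
  rw [CategoryTheory.Functor.map_zero] at hg
  exact (cancel_mono (((torsion q Sig).trW.Q.commShiftIso l).inv.app ((toD q).obj M))).1
    (hg.symm.trans zero_comp.symm)

theorem K_congr {e e' : Fin n → ℕ} {A : Finset (Fin n)} (h : ∀ i ∈ A, e i = e' i) (k : ℤ) :
    K q e A k = K q e' A k := by
  have h1 : powIdeal e A = powIdeal e' A := by
    refine congrArg Ideal.span (Set.image_congr fun i hi => ?_)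
    rw [h i hi]
  unfold K quotPows
  simp only [h1]

end

variable {v : Fin n → ℤ} {p : Finset (Fin n)} {ε : ℤ} {N : ℕ}

theorem mul_weight_eq (v : Fin n → ℤ) (p : Finset (Fin n)) (ε : ℤ) (b : Fin n →₀ ℕ) :
    ε * Finsupp.weight v b =
    ∑ i ∈ p, b i * (ε * v i) + ∑ i ∈ pᶜ, b i * (ε * v i) := by
  rw [Finsupp.weight_apply, Finsupp.sum_fintype _ _ (by simp), Finset.sum_add_sum_compl,
    Finset.mul_sum]
  exact Finset.sum_congr rfl fun i _ => by rw [nsmul_eq_mul]; ring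

/-- A monomial of degree `j + ∑_{i ∈ p} eᵢ vᵢ - k` is divisible by some `xᵢ ^ eᵢ` with `i ∈ p` when
`|j - k| < N`. This numerical fact is behind all vanishing of `Ext` groups inside the window. -/
theorem IsSide.exists_le (h : IsSide v p ε N) {j k : ℤ} (hjk : |j - k| < N) (e : Fin n → ℕ)
    (b : Fin n →₀ ℕ) (hb : Finsupp.weight v b = j + ∑ i ∈ p, e i * v i - k) :
    ∃ i ∈ p, e i ≤ b i := by
  by_contra! hc
  have h1 := mul_weight_eq v p ε b
  have h2 : ∑ i ∈ pᶜ, (b i : ℤ) * (ε * v i) ≤ 0 := Finset.sum_nonpos fun i hi =>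
    mul_nonpos_of_nonneg_of_nonpos (by positivity) (not_lt.1 fun hc =>
      (Finset.mem_compl.1 hi) ((h.mem i).2 hc))
  have h3 : ∑ i ∈ p, (b i : ℤ) * (ε * v i) + N ≤ ∑ i ∈ p, e i * (ε * v i) := by
    rw [← h.sum_mem, ← Finset.sum_add_distrib]
    refine Finset.sum_le_sum fun i hi => ?_
    have h4 := (h.mem i).1 hi
    have h5 : (b i : ℤ) + 1 ≤ e i := by exact_mod_cast hc i hi
    nlinarith
  have h4 : ∑ i ∈ p, (e i : ℤ) * (ε * v i) = ε * ∑ i ∈ p, e i * v i := by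
    rw [Finset.mul_sum]
    exact Finset.sum_congr rfl fun i _ => by ring
  have h5 : -N < ε * (j - k) := by
    rw [← h.abs_mul] at hjk
    exact (abs_lt.1 hjk).1
  rw [hb] at h1
  have h6 : ε * (j + ∑ i ∈ p, e i * v i - k) = ε * (j - k) + ε * ∑ i ∈ p, e i * v i := by ring
  lia

theorem IsSide.ext_S_eq_zero (h : IsSide v p ε N) {j k : ℤ} (hjk : |j - k| < N) (e : Fin n → ℕ)
    (i : ℕ) (x : Abelian.Ext (K v e p k) (S v j) i) : x = 0 :=
  ext_K_eq_zero e p ∅ (Finset.disjoint_empty_right p) (KEmptyIso e j) k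
    (fun b hb => by rw [Finset.union_empty]; exact h.exists_le hjk e b hb) i x

theorem IsSide.ext_K_compl_eq_zero (h : IsSide v p ε N) {j k : ℤ} (hjk : |j - k| < N)
    (e : Fin n → ℕ) (i : ℕ) (x : Abelian.Ext (K v e p k) (K v (fun _ => 1) pᶜ j) i) : x = 0 := by
  have h1 : K v e p k = K v (fun i => if i ∈ p then e i else 1) p k :=
    K_congr (fun i hi => (if_pos hi).symm) k
  have h2 : K v (fun _ => 1) pᶜ j = K v (fun i => if i ∈ p then e i else 1) pᶜ j :=
    K_congr (fun i hi => (if_neg (Finset.mem_compl.1 hi)).symm) j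
  generalize K v (fun _ => 1) pᶜ j = M at h2 x
  generalize K v e p k = M' at h1 x
  subst h1 h2
  refine ext_K_eq_zero _ p pᶜ disjoint_compl_right (Iso.refl _) k (fun b hb => ?_) i x
  obtain ⟨i, hi, hle⟩ := h.exists_le hjk _ b hb
  exact ⟨i, Finset.mem_union_left _ hi, hle⟩

/-! ### The classes of line bundles in the Grothendieck group -/

/-- The action of the scalars on the object of `D(X_Σ)` defined by `G(j)`. -/
def scalarHom (q : Fin n → ℤ) (Sig : Set (Finset (Fin n))) (G : GrMod q) (j : ℤ) :
    ℂ →+* End ((sheaf q Sig).obj (G.twist j)) where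
  toFun c := (sheaf q Sig).map (mulHom G (MvPolynomial.C c) j j
    (by rw [sub_self]; exact MvPolynomial.isWeightedHomogeneous_C q c))
  map_one' := by
    refine Eq.trans (congrArg (sheaf q Sig).map ?_) ((sheaf q Sig).map_id _)
    ext m
    change (MvPolynomial.C 1 : PolyRing n) • m = m
    rw [MvPolynomial.C_1]
    exact one_smul _ (m : G.carrier)
  map_mul' c c' := by
    refine Eq.trans (congrArg (sheaf q Sig).map ?_) ((sheaf q Sig).map_comp _ _)
    ext m
    change (MvPolynomial.C (c * c') : PolyRing n) • m =
      (MvPolynomial.C c : PolyRing n) • (MvPolynomial.C c' : PolyRing n) • m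
    rw [MvPolynomial.C_mul]
    exact mul_smul _ _ (m : G.carrier)
  map_zero' := by
    refine Eq.trans (congrArg (sheaf q Sig).map ?_) ((sheaf q Sig).map_zero _ _)
    ext m
    change (MvPolynomial.C 0 : PolyRing n) • m = 0
    rw [MvPolynomial.C_0]
    exact zero_smul _ (m : G.carrier)
  map_add' c c' := by
    refine Eq.trans (congrArg (sheaf q Sig).map ?_) ((sheaf q Sig).map_add)
    ext m
    change (MvPolynomial.C (c + c') : PolyRing n) • m =
      (MvPolynomial.C c : PolyRing n) • m + (MvPolynomial.C c' : PolyRing n) • m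
    rw [MvPolynomial.C_add]
    exact add_smul _ _ (m : G.carrier)

/-- The exponents of the monomials of degree `d` in the variables `xᵢ`, `i ∈ p`. -/
def exponents (v : Fin n → ℤ) (p : Finset (Fin n)) (d : ℤ) : Set (Fin n →₀ ℕ) :=
  {b | Finsupp.weight v b = d ∧ ∀ i ∈ pᶜ, b i = 0}

theorem IsSide.exponents_bound (h : IsSide v p ε N) {d : ℤ} {b : Fin n →₀ ℕ}
    (hb : b ∈ exponents v p d) (i : Fin n) : (b i : ℤ) ≤ ε * d := by
  have h1 := mul_weight_eq v p ε b
  have h2 : ∑ i ∈ pᶜ, (b i : ℤ) * (ε * v i) = 0 :=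
    Finset.sum_eq_zero fun i hi => by rw [hb.2 i hi, Nat.cast_zero, zero_mul]
  have h3 : ∀ i ∈ p, (b i : ℤ) ≤ b i * (ε * v i) := fun i hi =>
    le_mul_of_one_le_right (by positivity) ((h.mem i).1 hi)
  rw [hb.1, h2, add_zero] at h1
  rw [h1]
  have h4 : ∀ i ∈ p, (0 : ℤ) ≤ b i * (ε * v i) := fun i hi => le_trans (by positivity) (h3 i hi)
  by_cases hi : i ∈ p
  · exact (h3 i hi).trans (Finset.single_le_sum h4 hi)
  · rw [hb.2 i (Finset.mem_compl.2 hi)]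
    exact Finset.sum_nonneg h4

theorem IsSide.exponents_finite (h : IsSide v p ε N) (d : ℤ) : (exponents v p d).Finite := by
  refine (Set.finite_Iic (Finsupp.equivFunOnFinite.symm fun _ => (ε * d).toNat)).subset
    fun b hb => ?_
  intro i
  have := h.exponents_bound hb i
  change b i ≤ (ε * d).toNat
  lia

theorem IsSide.exponents_eq_empty (h : IsSide v p ε N) {d : ℤ} (hd : ε * d < 0) :
    exponents v p d = ∅ := by
  refine Set.eq_empty_iff_forall_notMem.2 fun b hb => ?_
  have := h.exponents_bound hb h.nonempty.choose
  lia

/-- Multiplication by a monomial, as a map from `S(k)` to `(S/(xᵢ : i ∉ p))(j)`. -/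
def monomialHom (v : Fin n → ℤ) (p : Finset (Fin n)) (k j : ℤ) (b : exponents v p (j - k)) :
    S v k ⟶ K v (fun _ => 1) pᶜ j :=
  mulHom (free v) (MvPolynomial.monomial b.1 1) k j
    (MvPolynomial.isWeightedHomogeneous_monomial v _ _ b.2.1) ≫ KMk (fun _ => 1) pᶜ j

/-- Multiplication by a scalar. -/
abbrev scalarMul (G : GrMod v) (j : ℤ) (c : ℂ) : G.twist j ⟶ G.twist j :=
  mulHom G (MvPolynomial.C c) j j
    (by rw [sub_self]; exact MvPolynomial.isWeightedHomogeneous_C v c)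

/-- Every map `S(k) → (S/(xᵢ : i ∉ p))(j)` is a combination of monomials. -/
theorem exists_eq_sum_monomialHom {k j : ℤ} [Fintype (exponents v p (j - k))]
    (f : S v k ⟶ K v (fun _ => 1) pᶜ j) :
    ∃ c : exponents v p (j - k) → ℂ,
      f = ∑ b, monomialHom v p k j b ≫ scalarMul (quotPows v (fun _ => 1) pᶜ) j (c b) := by
  obtain ⟨(s : PolyRing n), hs, hfs⟩ := f.map_mem _ _ (one_mem_S v k)
  replace hs : MvPolynomial.IsWeightedHomogeneous v s (j + -k) := hs
  refine ⟨fun b => MvPolynomial.coeff b.1 s, S_hom_ext ?_⟩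
  let ev : (S v k ⟶ K v (fun _ => 1) pᶜ j) →+ (quotPows v (fun _ => 1) pᶜ).carrier :=
    AddMonoidHom.mk' (fun f => f.lin (1 : PolyRing n)) fun f g => rfl
  have h1 : ev (∑ b, monomialHom v p k j b ≫ scalarMul (quotPows v (fun _ => 1) pᶜ) j
      (MvPolynomial.coeff b.1 s)) = (powIdeal (fun _ => 1) pᶜ).mkQ
        (∑ b : exponents v p (j - k), MvPolynomial.monomial b.1 (MvPolynomial.coeff b.1 s)) := by
    rw [map_sum, map_sum]
    refine Finset.sum_congr rfl fun b _ => ?_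
    change (powIdeal (fun _ => 1) pᶜ).mkQ (MvPolynomial.C (MvPolynomial.coeff b.1 s) *
      (MvPolynomial.monomial b.1 1 * 1)) = _
    rw [mul_one, MvPolynomial.C_mul_monomial, mul_one]
  refine Eq.trans hfs.symm (Eq.trans ?_ h1.symm)
  refine (Submodule.Quotient.eq (powIdeal (fun _ => 1) pᶜ)).2 (mem_powIdeal.2 fun b hb => ?_)
  classical
  rw [MvPolynomial.mem_support_iff, MvPolynomial.coeff_sub, MvPolynomial.coeff_sum] at hb
  by_contra! hc
  apply hb
  have hb0 : ∀ i ∈ pᶜ, b i = 0 := fun i hi => Nat.lt_one_iff.1 (hc i hi)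
  by_cases hw : Finsupp.weight v b = j - k
  · rw [Finset.sum_eq_single (⟨b, hw, hb0⟩ : exponents v p (j - k)), MvPolynomial.coeff_monomial,
      if_pos rfl, sub_self]
    · intro b' _ hb'
      rw [MvPolynomial.coeff_monomial, if_neg fun h => hb' (Subtype.ext h)]
    · exact fun h => absurd (Finset.mem_univ _) h
  · have h0 : MvPolynomial.coeff b s = 0 := by
      by_contra h0
      exact hw (hs h0)
    rw [h0, Finset.sum_eq_zero, sub_zero]
    intro b' _
    rw [MvPolynomial.coeff_monomial, if_neg]
    rintro rfl
    exact hw b'.2.1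

/-- The test object `S/(xᵢ : i ∉ p)`, twisted by `j`, with the scalars acting on it. -/
abbrev testHom (v : Fin n → ℤ) (p : Finset (Fin n)) (j : ℤ) :
    ℂ →+* End ((sheaf v (complexOfNonface p)).obj (K v (fun _ => 1) pᶜ j)) :=
  scalarHom v (complexOfNonface p) (quotPows v (fun _ => 1) pᶜ) j

/-- The map from a line bundle to the test object defined by a monomial. -/
def monomialVec (v : Fin n → ℤ) (p : Finset (Fin n)) (k j : ℤ) (b : exponents v p (j - k)) :
    HomTo (testHom v p j) (lineBundle v (complexOfNonface p) k) :=
  (sheaf v (complexOfNonface p)).map (monomialHom v p k j b)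

theorem IsSide.span_monomialVec (h : IsSide v p ε N) {k j : ℤ} (hjk : |j - k| < N) :
    Submodule.span ℂ (Set.range (monomialVec v p k j)) = ⊤ := by
  refine eq_top_iff.2 fun f _ => ?_
  obtain ⟨g, hg⟩ := (sheaf_map_bijective (coxIdeal_complexOfNonface p) k _
    (h.ext_K_compl_eq_zero hjk)).2 f
  have := (h.exponents_finite (j - k)).fintype
  obtain ⟨c, hc⟩ := exists_eq_sum_monomialHom g
  have h1 : (sheaf v (complexOfNonface p)).map g = ∑ b,
      (sheaf v (complexOfNonface p)).map (monomialHom v p k j b ≫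
        scalarMul (quotPows v (fun _ => 1) pᶜ) j (c b)) := by
    rw [← Functor.map_sum, ← hc]
  have h2 : f = ∑ b, c b • monomialVec v p k j b := hg.symm.trans
    (h1.trans (Finset.sum_congr rfl fun b _ => (sheaf v (complexOfNonface p)).map_comp _ _))
  rw [h2]
  exact Submodule.sum_mem _ fun b _ => Submodule.smul_mem _ (c b) (Submodule.subset_span ⟨b, rfl⟩)

theorem IsSide.finite_homTo (h : IsSide v p ε N) {k j : ℤ} (hjk : |j - k| < N) :
    FiniteDimensional ℂ (HomTo (testHom v p j) (lineBundle v (complexOfNonface p) k)) := by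
  have := (h.exponents_finite (j - k)).to_subtype
  exact Module.finite_def.2 (h.span_monomialVec hjk ▸ Submodule.fg_span (Set.finite_range _))

theorem IsSide.subsingleton_homTo (h : IsSide v p ε N) {k j : ℤ} (hjk : |j - k| < N)
    (hlt : ε * (j - k) < 0) :
    Subsingleton (HomTo (testHom v p j) (lineBundle v (complexOfNonface p) k)) := by
  have h1 := h.span_monomialVec hjk
  have h2 : IsEmpty (exponents v p (j - k)) :=
    Set.isEmpty_coe_sort.2 (h.exponents_eq_empty hlt)
  rw [Set.range_eq_empty, Submodule.span_empty] at h1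
  exact (Submodule.subsingleton_iff ℂ).1 (subsingleton_of_bot_eq_top h1)

theorem IsSide.nontrivial_homTo (h : IsSide v p ε N) (hN : 0 < N) (j : ℤ) :
    Nontrivial (HomTo (testHom v p j) (lineBundle v (complexOfNonface p) j)) := by
  refine ⟨⟨(sheaf v (complexOfNonface p)).map (KMk (fun _ => 1) pᶜ j), 0, fun hc => ?_⟩⟩
  have h1 : KMk (q := v) (fun _ => 1) pᶜ j = 0 :=
    (sheaf_map_bijective (coxIdeal_complexOfNonface p) j _ (h.ext_K_compl_eq_zero (by
      rw [sub_self, abs_zero]; exact_mod_cast hN))).1 (hc.trans ((sheaf _ _).map_zero _ _).symm)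
  have h2 : (powIdeal (fun _ => 1) pᶜ).mkQ (1 : PolyRing n) = 0 :=
    congrArg (fun f => Hom.lin f (1 : PolyRing n)) h1
  obtain ⟨i, -, hi⟩ := mem_powIdeal.1 ((Submodule.Quotient.mk_eq_zero _).1 h2) 0 (by
    rw [MvPolynomial.mem_support_iff]
    simp)
  exact absurd hi (by simp)

theorem abs_fin_sub_lt (i j : Fin N) : |((j : ℕ) : ℤ) - ((i : ℕ) : ℤ)| < N := by
  have hi := i.isLt
  have hj := j.isLt
  rw [abs_lt]
  lia

/-- The Euler characteristics against the test objects `S/(xᵢ : i ∉ p)(j)` form a triangular matrix: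
there are no monomials in the `xᵢ`, `i ∈ p`, of degrees on one side of `0`, and one of degree `0`. -/
theorem IsSide.linearIndependent_cls (h : IsSide v p ε N) : LinearIndependent ℤ
    (fun i : Fin N => K0.cls (lineBundle v (complexOfNonface p) (i : ℕ))) := by
  rw [Fintype.linearIndependent_iff]
  intro g hg
  by_contra! hne
  -- the extremal line bundle with nonzero coefficient is detected by its own test object
  obtain ⟨j, hj, hmin⟩ := Finset.exists_min_image (Finset.univ.filter fun i => g i ≠ 0)
    (fun i : Fin N => ε * ((i : ℕ) : ℤ)) (by
      obtain ⟨i, hi⟩ := hne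
      exact ⟨i, by simpa using hi⟩)
  rw [Finset.mem_filter] at hj
  have hb : ∀ i : Fin N, HomTo.Bounded (testHom v p (j : ℕ))
      (lineBundle v (complexOfNonface p) (i : ℕ)) ∧
      HomTo.euler (testHom v p (j : ℕ)) (lineBundle v (complexOfNonface p) (i : ℕ)) =
        Module.finrank ℂ (HomTo (testHom v p (j : ℕ))
          (lineBundle v (complexOfNonface p) (i : ℕ))) := fun i => by
    have := h.finite_homTo (abs_fin_sub_lt i j)
    exact HomTo.bounded_of_forall_ne _ fun l hl f => hom_shift_eq_zero
      (coxIdeal_complexOfNonface p) _ _ (h.ext_K_compl_eq_zero (abs_fin_sub_lt i j)) hl f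
  obtain ⟨φ, hφ⟩ := HomTo.exists_eulerHom (testHom v p (j : ℕ))
    (h.hull_window (H := HomTo.Bounded (testHom v p (j : ℕ))) fun k hk hk' => by
      lift k to ℕ using hk
      exact (hb ⟨k, by exact_mod_cast hk'⟩).1)
  have h1 := congrArg φ hg
  rw [map_sum, map_zero, Finset.sum_eq_single j, map_zsmul, hφ, (hb j).2, smul_eq_mul,
    mul_eq_zero] at h1
  · rcases h1 with h1 | h1
    · exact hj.2 h1
    · have := h.nontrivial_homTo (Fin.pos j) (j : ℕ)
      have := h.finite_homTo (abs_fin_sub_lt j j)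
      exact Module.finrank_pos.ne' (by exact_mod_cast h1)
  · intro i _ hij
    by_cases hi : g i = 0
    · rw [hi, zero_smul, map_zero]
    · have h2 := hmin i (by simpa using hi)
      have h3 : ((i : ℕ) : ℤ) ≠ ((j : ℕ) : ℤ) := fun hc => hij (Fin.ext (by exact_mod_cast hc))
      have := h.subsingleton_homTo (abs_fin_sub_lt i j) (by
        rcases h.unit with rfl | rfl <;> lia)
      rw [map_zsmul, hφ, (hb i).2, Module.finrank_zero_of_subsingleton, Nat.cast_zero, smul_zero]
  · exact fun hc => absurd (Finset.mem_univ _) hc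

theorem IsSide.exists_basis (h : IsSide v p ε N) :
    ∃ b : Module.Basis (Fin N) ℤ (K0 (DX v (complexOfNonface p))),
      ∀ i, b i = K0.cls (lineBundle v (complexOfNonface p) (i : ℕ)) := by
  refine ⟨Module.Basis.mk h.linearIndependent_cls ?_, fun i => Module.Basis.mk_apply _ _ i⟩
  let G : Submodule ℤ (K0 (DX v (complexOfNonface p))) := Submodule.span ℤ
    (Set.range fun i : Fin N => K0.cls (lineBundle v (complexOfNonface p) (i : ℕ)))
  have key : ∀ X, K0.cls X ∈ G.toAddSubgroup := fun X =>
    K0.cls_mem_of_hull (P := fun Y => ∃ i : Fin N, Y = lineBundle v (complexOfNonface p) (i : ℕ))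
      (by rintro _ ⟨i, rfl⟩; exact Submodule.subset_span ⟨i, rfl⟩)
      (h.hull_window (fun k hk hk' => by
        lift k to ℕ using hk
        exact fun Q _ _ hP => hP _ ⟨⟨k, by exact_mod_cast hk'⟩, rfl⟩) X)
  rintro x -
  obtain ⟨x, rfl⟩ := QuotientAddGroup.mk_surjective x
  induction x using FreeAbelianGroup.induction_on with
  | zero => exact G.zero_mem
  | of X => exact key X
  | neg X _ => exact G.neg_mem (key X)
  | add x y hx hy => exact G.add_mem hx hy

/-- No line bundle of the window is generated by the others, since classes in the Grothendieck
group would be dependent. -/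
theorem IsSide.not_hull_others (h : IsSide v p ε N) (j : Fin N) :
    ¬ triangulatedHull (fun Y => ∃ i : Fin N, i ≠ j ∧
      Y = lineBundle v (complexOfNonface p) (i : ℕ)) (lineBundle v (complexOfNonface p) (j : ℕ)) := by
  intro hj
  have h1 := K0.cls_mem_of_hull (G := (Submodule.span ℤ ((fun i : Fin N =>
    K0.cls (lineBundle v (complexOfNonface p) (i : ℕ))) '' {i | i ≠ j})).toAddSubgroup) (by
      rintro _ ⟨i, hi, rfl⟩
      exact Submodule.subset_span ⟨i, hi, rfl⟩) hj
  exact h.linearIndependent_cls.notMem_span_image (by simp) h1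

end LineBundles

/-! ### The tilting set -/

section Tilting

open GrMod

variable {n : ℕ} {v : Fin n → ℤ} {p : Finset (Fin n)} {ε : ℤ} {N : ℕ}

/-- Within the window, maps between line bundles are maps between free modules. -/
def IsSide.lineEquiv (h : IsSide v p ε N) (i j : Fin N) :
    (S v (i : ℕ) ⟶ S v (j : ℕ)) ≃+
      (lineBundle v (complexOfNonface p) (i : ℕ) ⟶ lineBundle v (complexOfNonface p) (j : ℕ)) :=
  AddEquiv.ofBijective (sheaf v (complexOfNonface p)).mapAddHom
    (sheaf_map_bijective (coxIdeal_complexOfNonface p) _ _ (h.ext_S_eq_zero (abs_fin_sub_lt i j)))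

/-- The homogeneous polynomial by which a map between line bundles multiplies. -/
def IsSide.polyOf (h : IsSide v p ε N) (i j : Fin N) :
    (lineBundle v (complexOfNonface p) (i : ℕ) ⟶ lineBundle v (complexOfNonface p) (j : ℕ)) →+
      PolyRing n :=
  (AddMonoidHom.mk' (fun f : S v (i : ℕ) ⟶ S v (j : ℕ) => f.lin (1 : PolyRing n))
    fun _ _ => rfl).comp (h.lineEquiv i j).symm.toAddMonoidHom

theorem IsSide.polyOf_map (h : IsSide v p ε N) {i j : Fin N} (g : S v (i : ℕ) ⟶ S v (j : ℕ)) :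
    h.polyOf i j ((sheaf v (complexOfNonface p)).map g) = g.lin (1 : PolyRing n) :=
  congrArg (fun f : S v (i : ℕ) ⟶ S v (j : ℕ) => f.lin (1 : PolyRing n))
    ((h.lineEquiv i j).symm_apply_apply g)

theorem IsSide.exists_map_eq (h : IsSide v p ε N) {i j : Fin N}
    (f : lineBundle v (complexOfNonface p) (i : ℕ) ⟶ lineBundle v (complexOfNonface p) (j : ℕ)) :
    ∃ g : S v (i : ℕ) ⟶ S v (j : ℕ), (sheaf v (complexOfNonface p)).map g = f :=
  (h.lineEquiv i j).surjective f

theorem IsSide.polyOf_id (h : IsSide v p ε N) (i : Fin N) : h.polyOf i i (𝟙 _) = 1 :=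
  (congrArg (h.polyOf i i) ((sheaf v (complexOfNonface p)).map_id _).symm).trans
    (h.polyOf_map (𝟙 _))

theorem IsSide.polyOf_comp (h : IsSide v p ε N) {i j l : Fin N}
    (f : lineBundle v (complexOfNonface p) (i : ℕ) ⟶ lineBundle v (complexOfNonface p) (j : ℕ))
    (g : lineBundle v (complexOfNonface p) (j : ℕ) ⟶ lineBundle v (complexOfNonface p) (l : ℕ)) :
    h.polyOf i l (f ≫ g) = h.polyOf j l g * h.polyOf i j f := by
  obtain ⟨f, rfl⟩ := h.exists_map_eq f
  obtain ⟨g, rfl⟩ := h.exists_map_eq g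
  refine (congrArg (h.polyOf i l) ((sheaf v (complexOfNonface p)).map_comp f g).symm).trans ?_
  rw [h.polyOf_map, h.polyOf_map, h.polyOf_map]
  let s : PolyRing n := f.lin (1 : PolyRing n)
  let t : PolyRing n := g.lin (1 : PolyRing n)
  have h1 : g.lin (s • (1 : PolyRing n) : PolyRing n) = s • t := map_smul g.lin s (1 : PolyRing n)
  have h2 : s • (1 : PolyRing n) = s := mul_one s
  rw [h2] at h1
  exact h1.trans (mul_comm s t)

theorem IsSide.polyOf_injective (h : IsSide v p ε N) (i j : Fin N) :
    Function.Injective (h.polyOf i j) := by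
  intro f g hfg
  obtain ⟨f, rfl⟩ := h.exists_map_eq f
  obtain ⟨g, rfl⟩ := h.exists_map_eq g
  rw [h.polyOf_map, h.polyOf_map] at hfg
  rw [S_hom_ext hfg]

theorem IsSide.exists_polyOf_eq_iff (h : IsSide v p ε N) (i j : Fin N) (s : PolyRing n) :
    (∃ f, h.polyOf i j f = s) ↔
      MvPolynomial.IsWeightedHomogeneous v s (((j : ℕ) : ℤ) - ((i : ℕ) : ℤ)) := by
  constructor
  · rintro ⟨f, rfl⟩
    obtain ⟨f, rfl⟩ := h.exists_map_eq f
    rw [h.polyOf_map]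
    exact f.map_mem _ _ (one_mem_S v _)
  · intro hs
    refine ⟨(sheaf v (complexOfNonface p)).map (ofMem (S v (j : ℕ)) (i : ℕ) s hs), ?_⟩
    rw [h.polyOf_map]
    exact one_mul s

variable (v p N) in
/-- The `N` line bundles of the window. -/
abbrev window (i : Fin N) : DX v (complexOfNonface p) := lineBundle v (complexOfNonface p) (i : ℕ)

/-- The endomorphism ring of the sum of the line bundles of the window is the ring of matrices of
homogeneous polynomials of the appropriate degrees. -/
def IsSide.matrixHom (h : IsSide v p ε N) :
    End (⨁ window v p N) →+*
      Matrix (Fin N) (Fin N) (PolyRing n) where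
  toFun f := Matrix.of fun j i => h.polyOf i j
    (biproduct.ι (window v p N) i ≫ End.asHom f ≫ biproduct.π (window v p N) j)
  map_one' := by
    refine Matrix.ext fun j i => ?_
    change h.polyOf i j (biproduct.ι (window v p N) i ≫ 𝟙 _ ≫ biproduct.π (window v p N) j) = _
    rw [Category.id_comp]
    by_cases hij : i = j
    · subst hij
      rw [biproduct.ι_π_self, h.polyOf_id, Matrix.one_apply_eq]
    · rw [biproduct.ι_π_ne _ hij, map_zero, Matrix.one_apply_ne (Ne.symm hij)]
  map_mul' f g := by
    refine Matrix.ext fun j i => ?_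
    rw [Matrix.mul_apply]
    change h.polyOf i j (biproduct.ι (window v p N) i ≫ (End.asHom g ≫ End.asHom f) ≫
      biproduct.π (window v p N) j) =
      ∑ l, h.polyOf l j (biproduct.ι (window v p N) l ≫ End.asHom f ≫ biproduct.π (window v p N) j) *
        h.polyOf i l (biproduct.ι (window v p N) i ≫ End.asHom g ≫ biproduct.π (window v p N) l)
    simp_rw [← h.polyOf_comp]
    rw [← map_sum]
    congr 1
    simp_rw [Category.assoc]
    have h1 : End.asHom f ≫ biproduct.π (window v p N) j =
        ∑ l : Fin N, biproduct.π (window v p N) l ≫ biproduct.ι (window v p N) l ≫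
          End.asHom f ≫ biproduct.π (window v p N) j := by
      simp_rw [← Category.assoc, ← Preadditive.sum_comp]
      rw [biproduct.total, Category.id_comp]
    conv_lhs => rw [h1]
    rw [Preadditive.comp_sum, Preadditive.comp_sum]
  map_zero' := by
    refine Matrix.ext fun j i => ?_
    change h.polyOf i j (biproduct.ι (window v p N) i ≫ 0 ≫ biproduct.π (window v p N) j) = 0
    rw [zero_comp, comp_zero, map_zero]
  map_add' f g := by
    refine Matrix.ext fun j i => ?_
    change h.polyOf i j (biproduct.ι (window v p N) i ≫ (End.asHom f + End.asHom g) ≫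
      biproduct.π (window v p N) j) = _
    rw [Preadditive.add_comp, Preadditive.comp_add, map_add]
    rfl

theorem IsSide.isGradedMatrixRing (h : IsSide v p ε N) : IsGradedMatrixRing v h.matrixHom where
  injective f g hfg := by
    refine biproduct.hom_ext' _ _ fun i => biproduct.hom_ext _ _ fun j => ?_
    rw [Category.assoc, Category.assoc]
    exact h.polyOf_injective i j (congrFun (congrFun hfg j) i)
  mem_range B := by
    constructor
    · rintro ⟨f, rfl⟩ i j
      exact (h.exists_polyOf_eq_iff i j _).1 ⟨_, rfl⟩
    · intro hB
      choose c hc using fun i j => (h.exists_polyOf_eq_iff i j _).2 (hB i j)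
      refine ⟨End.of (biproduct.desc fun i => biproduct.lift fun j => c i j), ?_⟩
      refine Matrix.ext fun j i => ?_
      change h.polyOf i j (biproduct.ι (window v p N) i ≫
        biproduct.desc (fun i => biproduct.lift fun j => c i j) ≫
        biproduct.π (window v p N) j) = _
      rw [biproduct.ι_desc_assoc, biproduct.lift_π, hc]

/-- The endomorphism ring of a line bundle is a domain, so it has only the trivial idempotents. -/
theorem IsSide.indecomposable (h : IsSide v p ε N) (i : Fin N) :
    Indecomposable (lineBundle v (complexOfNonface p) (i : ℕ)) := by
  constructor
  · intro h0
    have h1 := h.polyOf_id i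
    rw [h0.eq_of_src (𝟙 _) 0, map_zero] at h1
    exact zero_ne_one h1
  · intro Y Z e
    -- the projection to `Y` is an idempotent
    let c := e.hom ≫ biprod.fst ≫ biprod.inl ≫ e.inv
    have hc : c ≫ c = c := by simp [c]
    have h1 := h.polyOf_comp c c
    rw [hc] at h1
    have h2 : h.polyOf i i c * (h.polyOf i i c - 1) = 0 := by
      rw [mul_sub, ← h1, mul_one, sub_self]
    rcases mul_eq_zero.1 h2 with h3 | h3
    · left
      have h4 : c = 0 := h.polyOf_injective i i (h3.trans (map_zero _).symm)
      rw [IsZero.iff_id_eq_zero]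
      have h5 : biprod.inl ≫ e.inv ≫ c ≫ e.hom ≫ biprod.fst = 𝟙 Y := by simp [c]
      rw [← h5, h4]
      simp
    · right
      have h4 : c = 𝟙 _ := h.polyOf_injective i i ((sub_eq_zero.1 h3).trans (h.polyOf_id i).symm)
      rw [IsZero.iff_id_eq_zero]
      have h5 : biprod.inr ≫ e.inv ≫ c ≫ e.hom ≫ biprod.snd = (0 : Z ⟶ Z) := by simp [c]
      rw [← h5, h4]
      simp

theorem IsSide.isTiltingSet (h : IsSide v p ε N) {p₁ p₂ : Finset (Fin n)}
    (h₁ : IsSide v p₁ 1 N) (h₂ : IsSide v p₂ (-1) N) :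
    IsTiltingSet (fun i : Fin N => lineBundle v (complexOfNonface p) (i : ℕ)) where
  indecomposable := h.indecomposable
  ext_eq_zero i j k hk f := hom_shift_eq_zero (coxIdeal_complexOfNonface p) _ _
    (h.ext_S_eq_zero (abs_fin_sub_lt i j)) hk.ne' f
  generates := h.hull_window fun k hk hk' => by
    lift k to ℕ using hk
    exact fun Q _ _ hP => hP _ ⟨⟨k, by exact_mod_cast hk'⟩, rfl⟩
  globalDimension := h.isGradedMatrixRing.hasFiniteGlobalDimension h₁ h₂

end Tilting

end ToricPhases

end

theorem mainTheorem2 {n d : ℕ} [NeZero d] (a : Fin n → Fin d → ℤ)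
    (ha : Function.Injective a) (hone : ∀ i, a i 0 = 1)
    (hsurj : Function.Surjective (pointMap a))
    (hrank : Module.finrank ℤ (LinearMap.ker (pointMap a)) = 1)
    (v : Fin n → ℤ) (hv : LinearMap.ker (pointMap a) = Submodule.span ℤ {v}) :
    0 < posSum v ∧
    -- there are exactly two phases
    (∀ Sig : Set (Finset (Fin n)), IsPhase a Sig ↔
      Sig = complexOfNonface (posSupport v) ∨ Sig = complexOfNonface (negSupport v)) ∧
    complexOfNonface (posSupport v) ≠ complexOfNonface (negSupport v) ∧
    -- in each of them, with the same line bundles in both: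
    ∀ p : Finset (Fin n), (p = posSupport v ∨ p = negSupport v) →
      coxIdeal (complexOfNonface p) = Ideal.span (MvPolynomial.X '' (p : Set (Fin n))) ∧
      -- finiteness of the set of degrees that are acyclic together with their negative
      {δ : ℤ | IsAcyclic v (complexOfNonface p) δ ∧
        IsAcyclic v (complexOfNonface p) (-δ)}.Finite ∧
      -- the degrees `0, …, N - 1` form a maximal set with acyclic differences
      Maximal (IsAcyclicSet v (complexOfNonface p)) (Set.Ico (0 : ℤ) (posSum v)) ∧
      -- the corresponding line bundles are a tilting set
      IsTiltingSet (fun i : Fin (posSum v) => lineBundle v (complexOfNonface p) (i : ℕ)) ∧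
      -- every line bundle at an end of a Koszul complex is generated by the other terms
      (∀ k : ℤ,
        triangulatedHull (fun Y => ∃ I ⊆ p, I.Nonempty ∧
          Y = lineBundle v (complexOfNonface p) (k - ∑ i ∈ I, v i))
          (lineBundle v (complexOfNonface p) k) ∧
        triangulatedHull (fun Y => ∃ I ⊂ p,
          Y = lineBundle v (complexOfNonface p) (k - ∑ i ∈ I, v i))
          (lineBundle v (complexOfNonface p) (k - ∑ i ∈ p, v i))) ∧
      -- their classes are a basis of the Grothendieck group, which thus has rank `N`
      (∃ b : Module.Basis (Fin (posSum v)) ℤ (K0 (DX v (complexOfNonface p))),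
        ∀ i, b i = K0.cls (lineBundle v (complexOfNonface p) (i : ℕ))) ∧
      -- none of them lies in the triangulated subcategory generated by the others
      ∀ j : Fin (posSum v),
        ¬ triangulatedHull (fun Y => ∃ i : Fin (posSum v), i ≠ j ∧
          Y = lineBundle v (complexOfNonface p) (i : ℕ))
          (lineBundle v (complexOfNonface p) (j : ℕ)) := by
  obtain ⟨β, c, hs⟩ := exists_splitting hsurj hv
  have h : IsSplit a v β c :=
    { rel := sum_relation hv
      ne_zero := relation_ne_zero hrank hv
      sum_eq_zero := by simpa [hone] using sum_relation hv 0
      split := hs }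
  have hpos := h.isSide_posSupport
  have hneg := h.isSide_negSupport
  have h0 : (0 : ℤ) < posSum v :=
    hpos.sum_mem ▸ (hpos.sum_le (Finset.Subset.refl _)).2.2.1 hpos.nonempty
  have key : ∀ p : Finset (Fin n), (p = posSupport v ∨ p = negSupport v) →
      ∃ ε, IsSide v p ε (posSum v) := by
    rintro p (rfl | rfl)
    exacts [⟨_, hpos⟩, ⟨_, hneg⟩]
  refine ⟨by exact_mod_cast h0, h.isPhase_iff, h.complex_ne, fun p hp => ?_⟩
  obtain ⟨ε, hside⟩ := key p hp
  have hB := coxIdeal_complexOfNonface p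
  exact ⟨hB, hside.finite, hside.maximal, hside.isTiltingSet hpos hneg,
    fun k => ⟨hull_lineBundle_first hB k fun I hI hI' => fun Q _ _ hP => hP _ ⟨I, hI, hI', rfl⟩,
      hull_lineBundle_last hB k fun I hI => fun Q _ _ hP => hP _ ⟨I, hI, rfl⟩⟩,
    hside.exists_basis, hside.not_hull_others⟩
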